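/- **Conventions.** In $\{-1,1\}^n$ the value $-1$ means "true". For $S\subseteq[n]$ let $\mathsf{OR}_S(x)=1$ if $x_i=-1$ for some $i\in S$ and $\mathsf{OR}_S(x)=0$ otherwise, except that $\mathsf{OR}_\emptyset\equiv 1$. A coverage function is a non-negative combination $c=\sum_{u\in U} w(u)\,\mathsf{OR}_{S_u}$ of monotone disjunctions ($U$ finite, $w\ge 0$); equivalently, $c(x)$ is the total weight of the elements of a weighted universe $U$ that lie in $\bigcup_{i:x_i=-1}A_i$, plus a non-negative constant (the empty disjunction). $\mathsf{size}(c)$ is the least possible $|U|$ (the constant term, if present, counts as one element), and $\mathcal{CV}$ is the class of coverage functions on $\{-1,1\}^n$ with range in $[0,1]$. Let $\|f\|_1=\mathbf E_x|f(x)|$ for $x$ uniform on $\{-1,1\}^n$, and $$s_\epsilon=\min\{\max(1,\mathsf{size}(c)),\ (12/\epsilon)^{2\lceil\log_2(6/\epsilon)\rceil}\}.$$ An algorithm is a program for a real random access machine with unit-cost steps (operations $+$ and truncated subtraction on natural numbers, $+,-,\times,/$ on reals, comparisons, indirect addressing, no rounding of reals). On request it receives an example $(x,c(x))$ with $x$ independent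 and uniform on $\{-1,1\}^n$, at a cost of $n+1$ steps, and it outputs its hypothesis as a list of disjunctions with real coefficients. **Theorem (proper PAC learning of coverage functions).** (a) There are an algorithm and constants $C,d$ such that for all $n$, all $\epsilon>0$ and all $c\in\mathcal{CV}$ the following holds. Given $n$, $\epsilon$ and random uniform examples of $c$, the algorithm always halts, and with probability at least $2/3$ all of the following hold: it outputs $h\in\mathcal{CV}$ with $\|h-c\|_1\le\epsilon$ and $\mathsf{size}(h)\le C s_\epsilon/\epsilon^2$; it runs in time at most $$C\,(n+1)\log^d(n+2)\,(1+s_\epsilon/\epsilon)^d=\tilde O(n)\cdot\mathsf{poly}(s_\epsilon/\epsilon);$$ and it uses at most $$C\log(n+2)\cdot\frac{s_\epsilon^2}{\epsilon^4}\log^d\!\Big(2+\frac{s_\epsilon^2}{\epsilon^4}\Big)=\log n\cdot\tilde O(s_\epsilon^2/\epsilon^4)$$ examples. (b) There are likewise an algorithm and constants $C,d$ such that for all $n$, $\epsilon>0$ and $c\in\mathcal{CV}$, if the algorithm is in addition given $\mathsf{size}(c)$, then in every run it halts within these bounds on the time and on the number of examples, and with probability at least $2/3$ it outputs $h\in\mathcal{CV}$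 with $\|h-c\|_1\le\epsilon$ and $\mathsf{size}(h)\le C s_\epsilon/\epsilon^2$. -/

import Mathlib

open MeasureTheory
open scoped ENNReal

noncomputable section

namespace CoverageLearning

/-! ### Coverage functions -/

/-- The hypercube `{-1,1}^n`; the value `-1` stands for "true". -/
abbrev Cube (n : ℕ) : Type := Fin n → ℤˣ

open Classical in
/-- The monotone disjunction of the variables in `S`, with values in `{0,1}`.
The empty disjunction is, by convention, the constant `1`. -/
def OR {n : ℕ} (S : Finset (Fin n)) (x : Cube n) : ℝ :=
  if S = ∅ ∨ ∃ i ∈ S, x i = -1 then 1 else 0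

/-- `c` is a coverage function over a universe of `k` weighted elements. The element `u` has weight
`w u ≥ 0`, and `S u` is the set of those `i` for which `u` belongs to the `i`-th set of the family,
so that `OR (S u) x = 1` exactly when `u` is covered by the sets chosen by `x`
(or `S u = ∅`: constant term). Equivalently: `c` is a non-negative combination of `k`
monotone disjunctions. -/
def IsCoverageOn {n : ℕ} (k : ℕ) (c : Cube n → ℝ) : Prop :=
  ∃ (w : Fin k → ℝ) (S : Fin k → Finset (Fin n)),
    (∀ u, 0 ≤ w u) ∧ ∀ x, c x = ∑ u, w u * OR (S u) x

/-- The class of coverage functions on `{-1,1}^n` with range in `[0,1]`. -/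
def CV (n : ℕ) : Set (Cube n → ℝ) :=
  {c | (∃ k, IsCoverageOn k c) ∧ ∀ x, 0 ≤ c x ∧ c x ≤ 1}

/-- The size of a coverage function: the least size of a universe that defines it. -/
def size {n : ℕ} (c : Cube n → ℝ) : ℕ := sInf {k | IsCoverageOn k c}

/-- The distance `E |f x - g x|` for uniformly distributed `x`. -/
def l1dist {n : ℕ} (f g : Cube n → ℝ) : ℝ :=
  (∑ x, |f x - g x|) / (Fintype.card (Cube n) : ℝ)

/-! ### A real random access machine

The memory consists of arrays of natural numbers and arrays of real numbers. A program names
finitely many arrays explicitly; the position inside an array is computed. The arithmetic on natural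
numbers is addition and truncated subtraction; the arithmetic on real numbers is `+`, `-`, `*`, `/`,
and there is no rounding from reals to integers. -/

/-- Expressions with values in the natural numbers. `ex e` is the `e`-th bit of the current
example. -/
inductive NExp : Type
  | const (k : ℕ)
  | load (a : ℕ) (e : NExp)
  | ex (e : NExp)
  | add (e f : NExp)
  | sub (e f : NExp)

/-- Expressions with values in the real numbers. `label` is the label of the current example. -/
inductive RExp : Type
  | ofNat (e : NExp)
  | load (a : ℕ) (e : NExp)
  | label
  | add (r s : RExp)
  | sub (r s : RExp)
  | mul (r s : RExp)
  | div (r s : RExp)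

/-- Tests: comparisons and their Boolean combinations. -/
inductive Test : Type
  | nle (e f : NExp)
  | rle (r s : RExp)
  | not (t : Test)
  | and (t u : Test)

/-- Programs. `draw` requests a fresh labelled example. `pushVar e` adds the variable with index `e`
to the disjunction that is being written, and `pushTerm r` completes that disjunction, outputs it
with coefficient `r`, and starts a new (empty) one. -/
inductive Prog : Type
  | skip
  | setN (a : ℕ) (i e : NExp)
  | setR (a : ℕ) (i : NExp) (r : RExp)
  | draw
  | pushVar (e : NExp)
  | pushTerm (r : RExp)
  | seq (p q : Prog)
  | ite (t : Test) (p q : Prog)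
  | while (t : Test) (p : Prog)

/-- Configurations of the machine. -/
structure Config : Type where
  /-- the arrays of natural numbers -/
  nat : ℕ → ℕ → ℕ
  /-- the arrays of real numbers -/
  real : ℕ → ℕ → ℝ
  /-- the bits of the current example (bit `1` for the coordinate value `-1`) -/
  ex : ℕ → ℕ
  /-- the label of the current example -/
  label : ℝ
  /-- the variables of the disjunction that is being written -/
  term : List ℕ
  /-- the disjunctions written so far, with their coefficients -/
  out : List (List ℕ × ℝ)
  /-- the number of examples drawn so far -/
  drawn : ℕ
  /-- the number of steps made so far -/
  time : ℕ

def NExp.eval (σ : Config) : NExp → ℕ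
  | .const k => k
  | .load a e => σ.nat a (e.eval σ)
  | .ex e => σ.ex (e.eval σ)
  | .add e f => e.eval σ + f.eval σ
  | .sub e f => e.eval σ - f.eval σ

def RExp.eval (σ : Config) : RExp → ℝ
  | .ofNat e => (e.eval σ : ℝ)
  | .load a e => σ.real a (e.eval σ)
  | .label => σ.label
  | .add r s => r.eval σ + s.eval σ
  | .sub r s => r.eval σ - s.eval σ
  | .mul r s => r.eval σ * s.eval σ
  | .div r s => r.eval σ / s.eval σ

def Test.Holds (σ : Config) : Test → Prop
  | .nle e f => e.eval σ ≤ f.eval σ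
  | .rle r s => r.eval σ ≤ s.eval σ
  | .not t => ¬ t.Holds σ
  | .and t u => t.Holds σ ∧ u.Holds σ

/-! The cost of an expression or test is the number of operations and accesses in it. -/

def NExp.cost : NExp → ℕ
  | .const _ => 1
  | .load _ e => e.cost + 1
  | .ex e => e.cost + 1
  | .add e f => e.cost + f.cost + 1
  | .sub e f => e.cost + f.cost + 1

def RExp.cost : RExp → ℕ
  | .ofNat e => e.cost + 1
  | .load _ e => e.cost + 1
  | .label => 1
  | .add r s => r.cost + s.cost + 1
  | .sub r s => r.cost + s.cost + 1
  | .mul r s => r.cost + s.cost + 1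
  | .div r s => r.cost + s.cost + 1

def Test.cost : Test → ℕ
  | .nle e f => e.cost + f.cost + 1
  | .rle r s => r.cost + s.cost + 1
  | .not t => t.cost + 1
  | .and t u => t.cost + u.cost + 1

/-- Let `k` steps pass. -/
def Config.tick (σ : Config) (k : ℕ) : Config := { σ with time := σ.time + k }

/-- Array `a` with the entry at position `i` replaced by `v`. -/
def write {α : Type} (m : ℕ → ℕ → α) (a i : ℕ) (v : α) : ℕ → ℕ → α :=
  Function.update m a (Function.update (m a) i v)

/-- The bits of a point of the cube, padded by zeros. -/
def bits {n : ℕ} (x : Cube n) (i : ℕ) : ℕ :=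
  if h : i < n then (if x ⟨i, h⟩ = -1 then 1 else 0) else 0

/-- `Exec c ω p σ τ`: program `p`, started in configuration `σ`, halts in configuration `τ`, where
the `j`-th example that is drawn is the point `ω j` labelled by `c (ω j)`. Every elementary command
costs one step plus the cost of its expressions; drawing an example costs `n + 1` steps. -/
inductive Exec {n : ℕ} (c : Cube n → ℝ) (ω : ℕ → Cube n) : Prog → Config → Config → Prop
  | skip (σ : Config) : Exec c ω .skip σ (σ.tick 1)
  | setN (a : ℕ) (i e : NExp) (σ : Config) :
      Exec c ω (.setN a i e) σ
        ({ σ with nat := write σ.nat a (i.eval σ) (e.eval σ) }.tick (i.cost + e.cost + 1))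
  | setR (a : ℕ) (i : NExp) (r : RExp) (σ : Config) :
      Exec c ω (.setR a i r) σ
        ({ σ with real := write σ.real a (i.eval σ) (r.eval σ) }.tick (i.cost + r.cost + 1))
  | draw (σ : Config) :
      Exec c ω .draw σ
        ({ σ with
            ex := bits (ω σ.drawn)
            label := c (ω σ.drawn)
            drawn := σ.drawn + 1 }.tick (n + 1))
  | pushVar (e : NExp) (σ : Config) :
      Exec c ω (.pushVar e) σ ({ σ with term := e.eval σ :: σ.term }.tick (e.cost + 1))
  | pushTerm (r : RExp) (σ : Config) :
      Exec c ω (.pushTerm r) σ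
        ({ σ with term := [], out := (σ.term, r.eval σ) :: σ.out }.tick (r.cost + 1))
  | seq (p q : Prog) (σ τ υ : Config) :
      Exec c ω p σ τ → Exec c ω q τ υ → Exec c ω (.seq p q) σ υ
  | ite_true (t : Test) (p q : Prog) (σ τ : Config) :
      t.Holds σ → Exec c ω p (σ.tick (t.cost + 1)) τ → Exec c ω (.ite t p q) σ τ
  | ite_false (t : Test) (p q : Prog) (σ τ : Config) :
      ¬ t.Holds σ → Exec c ω q (σ.tick (t.cost + 1)) τ → Exec c ω (.ite t p q) σ τ
  | while_true (t : Test) (p : Prog) (σ τ υ : Config) :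
      t.Holds σ → Exec c ω p (σ.tick (t.cost + 1)) τ → Exec c ω (.while t p) τ υ →
        Exec c ω (.while t p) σ υ
  | while_false (t : Test) (p : Prog) (σ : Config) :
      ¬ t.Holds σ → Exec c ω (.while t p) σ (σ.tick (t.cost + 1))

/-- The initial configuration: the dimension `n` in cell `0` of the array `nat 0`, the size
information `k` in its cell `1` (where `0` serves as "no information"), the accuracy `ε` in cell `0`
of the array `real 0`; everything else is zero or empty. -/
def start (n k : ℕ) (ε : ℝ) : Config where
  nat := write (write (fun _ _ => 0) 0 0 n) 0 1 k
  real := write (fun _ _ => 0) 0 0 ε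
  ex := fun _ => 0
  label := 0
  term := []
  out := []
  drawn := 0
  time := 0

open Classical in
/-- The function represented by an output: the linear combination of the disjunctions in it. -/
def hypothesis (n : ℕ) (out : List (List ℕ × ℝ)) (x : Cube n) : ℝ :=
  (out.map fun t => t.2 * OR (Finset.univ.filter fun i : Fin n => (i : ℕ) ∈ t.1) x).sum

/-! ### Random examples and resource bounds -/

/-- The law of an infinite sequence of independent uniformly distributed points of the cube. -/
def examples (n : ℕ) : Measure (ℕ → Cube n) :=
  Measure.infinitePi fun _ => (PMF.uniformOfFintype (Cube n)).toMeasure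

/-- `s_ε = min {size c, (12/ε)^(2⌈log₂ (6/ε)⌉)}`, with `size c` read as `1` for `c = 0`. -/
def sEps {n : ℕ} (c : Cube n → ℝ) (ε : ℝ) : ℝ :=
  min (max 1 (size c : ℝ)) ((12 / ε) ^ (2 * ⌈Real.logb 2 (6 / ε)⌉))

/-- A bound of the form `Õ(n) · poly(s/ε)`. -/
def timeBound (C : ℝ) (d n : ℕ) (s ε : ℝ) : ℝ :=
  C * (n + 1) * Real.log (n + 2) ^ d * (1 + s / ε) ^ d

/-- A bound of the form `log n · Õ(s²/ε⁴)`. -/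
def sampleBound (C : ℝ) (d n : ℕ) (s ε : ℝ) : ℝ :=
  C * Real.log (n + 2) * (s ^ 2 / ε ^ 4 * Real.log (2 + s ^ 2 / ε ^ 4) ^ d)

/-- The output in configuration `σ` is a coverage function with `ℓ₁`-error at most `ε` and size at
most `C · s_ε/ε²`. -/
def GoodOutput {n : ℕ} (c : Cube n → ℝ) (ε C : ℝ) (σ : Config) : Prop :=
  hypothesis n σ.out ∈ CV n ∧ l1dist (hypothesis n σ.out) c ≤ ε ∧
    (size (hypothesis n σ.out) : ℝ) ≤ C * sEps c ε / ε ^ 2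

/-- The resources spent in configuration `σ` obey the bounds in terms of `s_ε`. -/
def WithinBounds {n : ℕ} (c : Cube n → ℝ) (ε C : ℝ) (d : ℕ) (σ : Config) : Prop :=
  (σ.time : ℝ) ≤ timeBound C d n (sEps c ε) ε ∧
    (σ.drawn : ℝ) ≤ sampleBound C d n (sEps c ε) ε

end CoverageLearning

end

noncomputable section

namespace CoverageLearning

open scoped BigOperators

local infixr:60 " ;; " => Prog.seq

section

/-! ### Averages over lists of independent uniform points -/

/-! A disjunction of a non-empty set S is 1 minus the indicator `nor S` that no variable of S is
true. If c has weights v, its Fourier coefficient at a non-empty T, with sign reversed, is therefore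
the sum of v_S 2^{-|S|} over all S ⊇ T (`IsRep.coef_eq`). So these coefficients are non-negative,
decrease as T grows (`IsRep.coef_anti`), and sum to at most 1 over all T (`IsRep.sum_coef_le_one`).
At most 2τ sets have a coefficient of at least 1/(2τ), and every set with a large coefficient can be
reached from ∅ by adding its variables in increasing order without leaving the sets with large
coefficients (`exists_family_set_eq`).

These sets suffice for approximation (`exists_comparator`). A disjunction longer than log₂(6/ε) is
almost constantly 1, and disjunctions of weight below ε/(6s) can be dropped if there are at most s
of them; each survivor has a coefficient of at least 1/τ, where τ = 72s/ε². If c has too many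
elements, it is first averaged over all variables i with coefficient below ε²/16 at {i}. The squared
L² error of this is at most the largest coefficient that is lost
(`IsRep.expect_sq_sub_restrict_le`), and over the remaining at most 16/ε² variables there are at
most (12/ε)^{2L} short disjunctions, where L = ⌈log₂(6/ε)⌉.

A round with guess s draws m examples, of order τ² log(nτ), estimates coefficients to within 1/(4τ)
and collects a family of O(τ) sets. On m fresh examples it runs multiplicative weights for the
absolute loss, with the disjunctions of the family as experts. By the regret bound
(`MW.regret_init`) the online loss competes with the best sub-convex combination. The average of the
online predictors is a coverage function on the family, and by a martingale bound its risk is close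
to the average online loss (`MW.expect_avg_le`, `listProb_pathSum_ge_le`). The observed loss is
therefore also a trustworthy acceptance test.

If the size is known, one round with s = s_ε is enough. Otherwise the guess is doubled until a round
accepts or the guess reaches (12/ε)^{2L}. A round with guess s accepts wrongly with probability
O(1/s), which is summable over the doublings; the first guess above s_ε is rejected with probability
at most 1/100, and it exceeds s_ε by a factor of at most 2.

The rest is a verified implementation. Each set is stored as a pointer to a parent with one variable
less, so that its row of character values, or its value on an example, comes from the parent with
one multiplication. -/

/-- The average of `F` over all lists of length `N`. -/
def listAvg {α : Type*} [Fintype α] : ℕ → (List α → ℝ) → ℝ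
  | 0, F => F []
  | N + 1, F => 𝔼 x, listAvg N fun l => F (x :: l)

section listAvg

variable {α : Type*} [Fintype α]

theorem listAvg_mono {F G : List α → ℝ} (N : ℕ) (h : ∀ l, l.length = N → F l ≤ G l) :
    listAvg N F ≤ listAvg N G := by
  induction N generalizing F G with
  | zero => exact h [] rfl
  | succ N ih =>
    exact Finset.expect_le_expect fun x _ => ih fun l hl => h _ (by simp [hl])

theorem listAvg_mul_left (a : ℝ) (F : List α → ℝ) (N : ℕ) :
    listAvg N (fun l => a * F l) = a * listAvg N F := by
  induction N generalizing F with
  | zero => rfl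
  | succ N ih => simp only [listAvg, ih, Finset.mul_expect]

theorem listAvg_add (F G : List α → ℝ) (N : ℕ) :
    listAvg N (fun l => F l + G l) = listAvg N F + listAvg N G := by
  induction N generalizing F G with
  | zero => rfl
  | succ N ih => simp only [listAvg, ih, Finset.expect_add_distrib]

theorem listAvg_sum {ι : Type*} (s : Finset ι) (F : ι → List α → ℝ) (N : ℕ) :
    listAvg N (fun l => ∑ i ∈ s, F i l) = ∑ i ∈ s, listAvg N (F i) := by
  induction N generalizing F with
  | zero => rfl
  | succ N ih => simp only [listAvg, ih, Finset.expect_sum_comm]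

theorem listAvg_append (F : List α → ℝ) (M N : ℕ) :
    listAvg (M + N) F = listAvg M fun l => listAvg N fun l' => F (l ++ l') := by
  induction M generalizing F with
  | zero => simp [listAvg]
  | succ M ih => rw [Nat.succ_add]; simp [listAvg, ih]

variable [Nonempty α]

theorem listAvg_const (a : ℝ) (N : ℕ) : listAvg (α := α) N (fun _ => a) = a := by
  induction N with
  | zero => rfl
  | succ N ih => simp [listAvg, ih]

end listAvg

open Classical in
/-- The probability of an event on lists of length `N`. -/
def listProb {α : Type*} [Fintype α] (N : ℕ) (E : List α → Prop) : ℝ :=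
  listAvg N fun l => if E l then 1 else 0

section listProb

variable {α : Type*} [Fintype α]

theorem listProb_mono {E E' : List α → Prop} (N : ℕ) (h : ∀ l, l.length = N → E l → E' l) :
    listProb N E ≤ listProb N E' := by
  refine listAvg_mono N fun l hl => ?_
  by_cases h1 : E l
  · simp [h1, h l hl h1]
  · simp only [h1, if_false]; split_ifs <;> norm_num

theorem listProb_or (E E' : List α → Prop) (N : ℕ) :
    listProb N (fun l => E l ∨ E' l) ≤ listProb N E + listProb N E' := by
  unfold listProb
  rw [← listAvg_add]
  refine listAvg_mono N fun l _ => ?_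
  by_cases h1 : E l <;> by_cases h2 : E' l <;> simp [h1, h2]

theorem listProb_exists {ι : Type*} (s : Finset ι) (E : ι → List α → Prop) (N : ℕ) :
    listProb N (fun l => ∃ i ∈ s, E i l) ≤ ∑ i ∈ s, listProb N (E i) := by
  classical
  unfold listProb
  rw [← listAvg_sum]
  refine listAvg_mono N fun l _ => ?_
  have hnn : ∀ i ∈ s, (0 : ℝ) ≤ if E i l then 1 else 0 := fun i _ => by split_ifs <;> norm_num
  split_ifs with h
  · obtain ⟨i, hi, hE⟩ := h
    calc (1 : ℝ) = if E i l then 1 else 0 := by simp [hE]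
      _ ≤ _ := Finset.single_le_sum hnn hi
  · exact Finset.sum_nonneg hnn

variable [Nonempty α]

/-- An event about the first `M` points. -/
theorem listProb_take (E : List α → Prop) (M N : ℕ) :
    listProb (M + N) (fun l => E (l.take M)) = listProb M E := by
  classical
  unfold listProb
  rw [listAvg_append]
  apply le_antisymm <;>
  · refine listAvg_mono M fun l hl => ?_
    rw [← hl]
    simp only [List.take_left, listAvg_const, le_refl]

/-- An event about the first `M` and the next `N` points, whose probability is small for every
choice of the first `M` points. -/
theorem listProb_take_drop_le (E : List α → List α → Prop) (M N : ℕ) (δ : ℝ)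
    (h : ∀ l, listProb N (E l) ≤ δ) :
    listProb (M + N) (fun l => E (l.take M) (l.drop M)) ≤ δ := by
  classical
  unfold listProb
  rw [listAvg_append, ← listAvg_const (α := α) δ M]
  refine listAvg_mono M fun l hl => ?_
  refine le_trans (le_of_eq ?_) (h l)
  unfold listProb
  congr 1
  funext l'
  simp only [← hl, List.take_left, List.drop_left]

end listProb

/-! ### Concentration for adapted sums -/

/-- The sum of `g` along the trajectory of a state machine that reads a list. -/
def pathSum {α σ : Type*} (step : σ → α → σ) (g : σ → α → ℝ) : σ → List α → ℝ
  | _, [] => 0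
  | s, x :: l => g s x + pathSum step g (step s x) l

theorem exp_le_one_add_add_sq {y : ℝ} (hy : |y| ≤ 1) : Real.exp y ≤ 1 + y + y ^ 2 := by
  have := Real.abs_exp_sub_one_sub_id_le hy
  linarith [(abs_le.1 this).2]

/-- Conditioning on the first point, E exp(t g) ≤ 1 + t E g + t² ≤ exp(t²), because |t g| ≤ 1 and E
g ≤ 0; every further point contributes the same factor, whatever state has been reached. -/
theorem listAvg_exp_pathSum_le {α σ : Type*} [Fintype α] [Nonempty α] (step : σ → α → σ)
    (g : σ → α → ℝ) (hg : ∀ s x, |g s x| ≤ 1) (hm : ∀ s, 𝔼 x, g s x ≤ 0) {t : ℝ} (ht : 0 ≤ t)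
    (ht1 : t ≤ 1) (N : ℕ) (s : σ) :
    listAvg N (fun l => Real.exp (t * pathSum step g s l)) ≤ Real.exp (t ^ 2 * N) := by
  induction N generalizing s with
  | zero => simp [listAvg, pathSum]
  | succ N ih =>
    have key : ∀ x, listAvg N (fun l => Real.exp (t * pathSum step g s (x :: l))) ≤
        (1 + t * g s x + t ^ 2) * Real.exp (t ^ 2 * N) := by
      intro x
      have hb : |t * g s x| ≤ 1 := by
        rw [abs_mul, abs_of_nonneg ht]; exact mul_le_one₀ ht1 (abs_nonneg _) (hg s x)
      have h1 : Real.exp (t * g s x) ≤ 1 + t * g s x + t ^ 2 := by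
        have := exp_le_one_add_add_sq hb
        have h2 : (t * g s x) ^ 2 ≤ t ^ 2 := by
          rw [mul_pow]
          have : g s x ^ 2 ≤ 1 := (sq_le_one_iff_abs_le_one _).2 (hg s x)
          nlinarith [sq_nonneg t]
        linarith
      simp only [pathSum, mul_add, Real.exp_add, listAvg_mul_left]
      exact mul_le_mul h1 (ih _) ((by
        rw [← listAvg_const (α := α) 0 N]
        exact listAvg_mono N fun l _ => (Real.exp_pos _).le)) ((Real.exp_pos _).le.trans h1)
    calc listAvg (N + 1) (fun l => Real.exp (t * pathSum step g s l))
        ≤ 𝔼 x, (1 + t * g s x + t ^ 2) * Real.exp (t ^ 2 * N) :=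
          Finset.expect_le_expect fun x _ => key x
      _ = (1 + t * (𝔼 x, g s x) + t ^ 2) * Real.exp (t ^ 2 * N) := by
          rw [← Finset.expect_mul, Finset.expect_add_distrib, Finset.expect_add_distrib,
            ← Finset.mul_expect]
          simp
      _ ≤ (1 + t ^ 2) * Real.exp (t ^ 2 * N) := by
          gcongr
          nlinarith [mul_nonneg ht (neg_nonneg.2 (hm s))]
      _ ≤ Real.exp (t ^ 2) * Real.exp (t ^ 2 * N) := by
          gcongr
          linarith [Real.add_one_le_exp (t ^ 2)]
      _ = Real.exp (t ^ 2 * (N + 1 : ℕ)) := by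
          rw [← Real.exp_add]; push_cast; ring_nf

/-- A Hoeffding-type bound for sums of adapted bounded terms of non-positive conditional mean. -/
theorem listProb_pathSum_ge_le {α σ : Type*} [Fintype α] [Nonempty α] (step : σ → α → σ)
    (g : σ → α → ℝ) (hg : ∀ s x, |g s x| ≤ 1) (hm : ∀ s, 𝔼 x, g s x ≤ 0) {a : ℝ} (ha : 0 ≤ a)
    (ha1 : a ≤ 2) (N : ℕ) (s : σ) :
    listProb N (fun l => a * N ≤ pathSum step g s l) ≤ Real.exp (-(a ^ 2 * N / 4)) := by
  classical
  -- Markov's inequality for exp(t · sum) with t = a/2, which minimizes t² - ta; the condition a ≤ 2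
  -- keeps t ≤ 1.
  calc listProb N (fun l => a * N ≤ pathSum step g s l)
      ≤ listAvg N (fun l => Real.exp (-(a ^ 2 * N / 2)) *
          Real.exp (a / 2 * pathSum step g s l)) := by
        refine listAvg_mono N fun l _ => ?_
        rw [← Real.exp_add]
        split_ifs with h
        · rw [Real.one_le_exp_iff]
          nlinarith [mul_le_mul_of_nonneg_left h (by positivity : 0 ≤ a / 2)]
        · positivity
    _ ≤ Real.exp (-(a ^ 2 * N / 2)) * Real.exp ((a / 2) ^ 2 * N) := by
        rw [listAvg_mul_left]
        gcongr
        exact listAvg_exp_pathSum_le step g hg hm (by positivity) (by linarith) N s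
    _ = _ := by rw [← Real.exp_add]; congr 1; ring

/-- The sum of `f` over a list as a path sum with a trivial state. -/
theorem pathSum_const {α : Type*} (f : α → ℝ) (l : List α) :
    pathSum (fun (_ : Unit) _ => ()) (fun _ => f) () l = (l.map f).sum := by
  induction l with
  | nil => rfl
  | cons x l ih => simp [pathSum, ih]

/-- A Hoeffding-type bound for sums of independent bounded terms. -/
theorem listProb_sum_ge_le {α : Type*} [Fintype α] [Nonempty α] (f : α → ℝ)
    (hf : ∀ x, |f x| ≤ 1) (hm : 𝔼 x, f x ≤ 0) {a : ℝ} (ha : 0 ≤ a) (ha1 : a ≤ 2) (N : ℕ) :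
    listProb N (fun l => a * N ≤ (l.map f).sum) ≤ Real.exp (-(a ^ 2 * N / 4)) := by
  have := listProb_pathSum_ge_le (fun (_ : Unit) (_ : α) => ()) (fun _ => f) (fun _ => hf)
    (fun _ => hm) ha ha1 N ()
  simpa only [pathSum_const] using this

/-! ### Segments of the random sequence -/

/-- The block of `N` consecutive entries that starts at position `d`. -/
def segment {α : Type*} (ω : ℕ → α) (d N : ℕ) : List α := (List.range N).map fun j => ω (d + j)

@[simp] theorem length_segment {α : Type*} (ω : ℕ → α) (d N : ℕ) :
    (segment ω d N).length = N := by simp [segment]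

theorem segment_succ {α : Type*} (ω : ℕ → α) (d N : ℕ) :
    segment ω d (N + 1) = segment ω d N ++ [ω (d + N)] := by
  simp [segment, List.range_succ]

theorem segment_add {α : Type*} (ω : ℕ → α) (d M N : ℕ) :
    segment ω d (M + N) = segment ω d M ++ segment ω (d + M) N := by
  induction N with
  | zero => simp [segment]
  | succ N ih => rw [← add_assoc, segment_succ, ih, segment_succ]; simp [add_assoc]

theorem take_segment_add {α : Type*} (ω : ℕ → α) (d M N : ℕ) :
    (segment ω d (M + N)).take M = segment ω d M := by
  rw [segment_add, List.take_left' (length_segment _ _ _)]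

theorem drop_segment_add {α : Type*} (ω : ℕ → α) (d M N : ℕ) :
    (segment ω d (M + N)).drop M = segment ω (d + M) N := by
  rw [segment_add, List.drop_left' (length_segment _ _ _)]

theorem listAvg_eq_sum {α : Type*} [Fintype α] (N : ℕ) (F : List α → ℝ) :
    listAvg N F = ∑ v : Fin N → α, F (List.ofFn v) * ((Fintype.card α : ℝ)⁻¹) ^ N := by
  induction N generalizing F with
  | zero => simp [listAvg]
  | succ N ih =>
    rw [listAvg, ← (Fin.consEquiv fun _ => α).sum_comp, Fintype.sum_prod_type,
      Fintype.expect_eq_sum_div_card, Finset.sum_div]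
    refine Finset.sum_congr rfl fun x _ => ?_
    rw [ih, Finset.sum_div]
    refine Finset.sum_congr rfl fun v _ => ?_
    simp [Fin.consEquiv, List.ofFn_succ, pow_succ, div_eq_mul_inv]
    ring

instance (n : ℕ) : MeasurableSingletonClass (Cube n) := by
  have : MeasurableSingletonClass ℤˣ := ⟨fun u => by
    rw [show ({u} : Set ℤˣ) = (fun v : ℤˣ => (v : ℤ)) ⁻¹' {(u : ℤ)} by ext; simp [Units.ext_iff]]
    exact (comap_measurable _) (measurableSet_singleton _)⟩
  infer_instance

theorem examples_segment_eq {n : ℕ} (d N : ℕ) (v : Fin N → Cube n) :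
    examples n {ω | segment ω d N = List.ofFn v} =
      ((Fintype.card (Cube n) : ENNReal)⁻¹) ^ N := by
  classical
  have hset : {ω : ℕ → Cube n | segment ω d N = List.ofFn v} =
      Set.pi ((Finset.range N).map (addLeftEmbedding d))
        (fun i => {x | ∀ h : i - d < N, x = v ⟨i - d, h⟩}) := by
    ext ω
    simp only [Set.mem_ofPred_eq, Set.mem_pi, Finset.coe_map, Set.mem_image, Finset.mem_coe,
      Finset.mem_range, addLeftEmbedding_apply, forall_exists_index, and_imp,
      forall_apply_eq_imp_iff₂, add_tsub_cancel_left]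
    rw [List.ext_get_iff]
    simp [segment]
  rw [hset, examples, Measure.infinitePi_pi _ (fun i _ => by
    by_cases h : i - d < N
    · simp only [h, forall_true_left, Set.ofPred_eq_eq_singleton]
      exact measurableSet_singleton _
    · simp [h])]
  rw [Finset.prod_map]
  rw [Finset.prod_congr rfl (g := fun _ => ((Fintype.card (Cube n) : ENNReal)⁻¹))]
  · simp
  · intro i hi
    have h := Finset.mem_range.1 hi
    simp only [addLeftEmbedding_apply, add_tsub_cancel_left, h, forall_true_left,
      Set.ofPred_eq_eq_singleton]
    rw [PMF.toMeasure_apply_singleton _ _ (measurableSet_singleton _)]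
    simp

/-- This carries bounds for bad events from finite lists over to the infinite sequence. Only an
upper bound is needed, so monotonicity and subadditivity suffice and no event has to be measurable.
-/
theorem examples_segment_le {n : ℕ} (d N : ℕ) (E : List (Cube n) → Prop) :
    examples n {ω | E (segment ω d N)} ≤ ENNReal.ofReal (listProb N E) := by
  classical
  have hsub : {ω : ℕ → Cube n | E (segment ω d N)} ⊆
      ⋃ v ∈ Finset.univ.filter (fun v : Fin N → Cube n => E (List.ofFn v)),
        {ω | segment ω d N = List.ofFn v} := by
    intro ω hω
    have h : segment ω d N = List.ofFn (fun j : Fin N => ω (d + j)) := by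
      refine List.ext_get (by simp) fun i h1 h2 => ?_
      simp [segment]
    simp only [Set.mem_iUnion, Finset.mem_filter, Finset.mem_univ, true_and, exists_prop]
    exact ⟨_, h ▸ hω, h⟩
  refine (measure_mono hsub).trans ((measure_biUnion_finset_le _ _).trans ?_)
  simp only [examples_segment_eq]
  rw [listProb, listAvg_eq_sum]
  have : ∀ v : Fin N → Cube n, (if E (List.ofFn v) then (1 : ℝ) else 0) *
      ((Fintype.card (Cube n) : ℝ)⁻¹) ^ N =
      if E (List.ofFn v) then ((Fintype.card (Cube n) : ℝ)⁻¹) ^ N else 0 := by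
    intro v; split_ifs <;> simp
  simp only [this]
  rw [← Finset.sum_filter, ENNReal.ofReal_sum_of_nonneg fun _ _ => by positivity]
  refine Finset.sum_le_sum fun v _ => ?_
  rw [ENNReal.ofReal_pow (by positivity), ENNReal.ofReal_inv_of_pos (by positivity)]
  simp

end

section

/-! ### Fourier coefficients of coverage functions -/

/-- The character of the set `T`. -/
def chi {n : ℕ} (T : Finset (Fin n)) (x : Cube n) : ℝ := ∏ i ∈ T, ((x i : ℤ) : ℝ)

/-- The indicator function of the event that no variable in `S` is true. -/
def nor {n : ℕ} (S : Finset (Fin n)) (x : Cube n) : ℝ := ∏ i ∈ S, (1 + ((x i : ℤ) : ℝ)) / 2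

/-- The negative of the Fourier coefficient of `c` at `T`. -/
def coef {n : ℕ} (c : Cube n → ℝ) (T : Finset (Fin n)) : ℝ := -𝔼 x, c x * chi T x

variable {n : ℕ}

theorem OR_eq (S : Finset (Fin n)) (x : Cube n) : OR S x = if S = ∅ then 1 else 1 - nor S x := by
  unfold OR nor
  by_cases hS : S = ∅
  · simp [hS]
  by_cases h : ∃ i ∈ S, x i = -1
  · obtain ⟨i, hi, hx⟩ := h
    rw [if_pos (Or.inr ⟨i, hi, hx⟩), if_neg hS, Finset.prod_eq_zero hi (by simp [hx])]
    norm_num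
  · rw [if_neg (not_or.2 ⟨hS, h⟩), if_neg hS, Finset.prod_eq_one, sub_self]
    intro i hi
    have : x i = 1 := (Int.units_eq_one_or (x i)).resolve_right fun h' => h ⟨i, hi, h'⟩
    simp [this]

@[simp] theorem OR_empty (x : Cube n) : OR ∅ x = 1 := by simp [OR_eq]

theorem OR_of_nonempty {S : Finset (Fin n)} (hS : S.Nonempty) (x : Cube n) :
    OR S x = 1 - nor S x := by rw [OR_eq, if_neg hS.ne_empty]

@[simp] theorem nor_empty (x : Cube n) : nor ∅ x = 1 := by simp [nor]

theorem nor_nonneg (S : Finset (Fin n)) (x : Cube n) : 0 ≤ nor S x := by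
  refine Finset.prod_nonneg fun i _ => ?_
  rcases Int.units_eq_one_or (x i) with h | h <;> simp [h]

theorem OR_eq_zero_or_one (S : Finset (Fin n)) (x : Cube n) : OR S x = 0 ∨ OR S x = 1 := by
  unfold OR; split_ifs <;> simp

theorem OR_nonneg (S : Finset (Fin n)) (x : Cube n) : 0 ≤ OR S x := by
  rcases OR_eq_zero_or_one S x with h | h <;> simp [h]

theorem OR_le_one (S : Finset (Fin n)) (x : Cube n) : OR S x ≤ 1 := by
  rcases OR_eq_zero_or_one S x with h | h <;> simp [h]

theorem chi_eq_or (T : Finset (Fin n)) (x : Cube n) : chi T x = 1 ∨ chi T x = -1 := by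
  unfold chi
  refine Finset.prod_induction (fun i => ((x i : ℤ) : ℝ)) (fun y => y = 1 ∨ y = -1) ?_ (by simp) ?_
  · rintro a b (rfl | rfl) (rfl | rfl) <;> simp
  · intro i _
    rcases Int.units_eq_one_or (x i) with h | h <;> simp [h]

theorem abs_chi (T : Finset (Fin n)) (x : Cube n) : |chi T x| = 1 := by
  rcases chi_eq_or T x with h | h <;> simp [h]

theorem chi_insert {T : Finset (Fin n)} {i : Fin n} (h : i ∉ T) (x : Cube n) :
    chi (insert i T) x = ((x i : ℤ) : ℝ) * chi T x := Finset.prod_insert h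

theorem nor_insert {T : Finset (Fin n)} {i : Fin n} (h : i ∉ T) (x : Cube n) :
    nor (insert i T) x = (1 + ((x i : ℤ) : ℝ)) / 2 * nor T x := Finset.prod_insert h

theorem nor_eq_sum (S : Finset (Fin n)) (x : Cube n) :
    nor S x = (1 / 2) ^ S.card * ∑ T ∈ S.powerset, chi T x := by
  unfold nor chi
  rw [← Finset.prod_one_add, ← Finset.prod_const, ← Finset.prod_mul_distrib]
  exact Finset.prod_congr rfl fun i _ => by ring

theorem expect_prod (f : Fin n → ℤˣ → ℝ) :
    𝔼 x : Cube n, ∏ i, f i (x i) = ∏ i, ((f i 1 + f i (-1)) / 2) := by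
  have h : ∀ i, f i 1 + f i (-1) = ∑ u : ℤˣ, f i u := fun i => by
    rw [show (Finset.univ : Finset ℤˣ) = {1, -1} from rfl]
    exact (Finset.sum_pair (by decide)).symm
  simp only [h]
  rw [Finset.prod_div_distrib, Finset.prod_univ_sum, Fintype.expect_eq_sum_div_card,
    Fintype.piFinset_univ]
  simp

/-- The expectation factorizes over the coordinates. A coordinate in S gives 1/2 whether or not it
lies in T, one in T \ S gives 0, and the others give 1. -/
theorem expect_nor_mul_chi (S T : Finset (Fin n)) :
    𝔼 x, nor S x * chi T x = if T ⊆ S then (1 / 2 : ℝ) ^ S.card else 0 := by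
  have h : ∀ x : Cube n, nor S x * chi T x = ∏ i,
      ((if i ∈ S then (1 + ((x i : ℤ) : ℝ)) / 2 else 1) * if i ∈ T then ((x i : ℤ) : ℝ) else 1) := by
    intro x
    rw [Finset.prod_mul_distrib, Finset.prod_ite_mem, Finset.prod_ite_mem]
    simp [nor, chi]
  simp only [h]
  rw [expect_prod (fun i u => (if i ∈ S then (1 + ((u : ℤ) : ℝ)) / 2 else 1) *
    if i ∈ T then ((u : ℤ) : ℝ) else 1)]
  split_ifs with hTS
  · rw [← Finset.prod_const, ← Finset.univ_inter S, ← Finset.prod_ite_mem]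
    refine Finset.prod_congr rfl fun i _ => ?_
    by_cases hS : i ∈ S
    · by_cases hT : i ∈ T <;> simp [hS, hT]
    · have hT : i ∉ T := fun h => hS (hTS h)
      simp [hS, hT]
  · obtain ⟨i, hT, hS⟩ := Finset.not_subset.1 hTS
    exact Finset.prod_eq_zero (Finset.mem_univ i) (by simp [hT, hS])

theorem expect_chi (T : Finset (Fin n)) : 𝔼 x, chi T x = if T = ∅ then 1 else 0 := by
  have := expect_nor_mul_chi ∅ T
  simpa using this

theorem expect_nor (S : Finset (Fin n)) : 𝔼 x, nor S x = (1 / 2 : ℝ) ^ S.card := by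
  have := expect_nor_mul_chi S ∅
  simpa [chi] using this

/-- The constant 1 in OR = 1 - nor is orthogonal to every non-trivial character. The reversed sign
in `coef` makes the remaining coefficients non-negative. -/
theorem coef_OR (S : Finset (Fin n)) {T : Finset (Fin n)} (hT : T.Nonempty) :
    coef (OR S) T = if T ⊆ S then (1 / 2 : ℝ) ^ S.card else 0 := by
  unfold coef
  rcases S.eq_empty_or_nonempty with rfl | hS
  · simp [expect_chi, hT.ne_empty]
  · simp only [OR_of_nonempty hS, sub_mul, one_mul, Finset.expect_sub_distrib, expect_chi,
      hT.ne_empty, if_false, expect_nor_mul_chi]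
    simp

/-- `v` gives the coefficients of `c` as a non-negative combination of monotone disjunctions. -/
structure IsRep (c : Cube n → ℝ) (v : Finset (Fin n) → ℝ) : Prop where
  nonneg : ∀ S, 0 ≤ v S
  eq : ∀ x, c x = ∑ S, v S * OR S x
  sum_le : ∑ S, v S ≤ 1

/-- At the point where all variables are true every disjunction equals 1, the empty one by
convention. -/
theorem sum_weights_le_one {ι : Type*} (s : Finset ι) (w : ι → ℝ) (S : ι → Finset (Fin n))
    (h : ∀ x, ∑ u ∈ s, w u * OR (S u) x ≤ 1) : ∑ u ∈ s, w u ≤ 1 := by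
  refine le_trans (le_of_eq (Finset.sum_congr rfl fun u _ => ?_)) (h fun _ => -1)
  rcases (S u).eq_empty_or_nonempty with h | ⟨i, hi⟩
  · simp [h]
  · rw [OR, if_pos (Or.inr ⟨i, hi, rfl⟩), mul_one]

/-- Elements of an optimal universe with the same set are merged, which cannot increase their
number. -/
theorem exists_isRep {c : Cube n → ℝ} (hc : c ∈ CV n) :
    ∃ v, IsRep c v ∧ (Finset.univ.filter fun S => v S ≠ 0).card ≤ size c := by
  classical
  obtain ⟨⟨k, hk⟩, hr⟩ := hc
  obtain ⟨w, S, hw, he⟩ : IsCoverageOn (size c) c :=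
    Nat.sInf_mem (s := {k | IsCoverageOn k c}) ⟨k, hk⟩
  have heq : ∀ x, c x = ∑ T, (∑ u with S u = T, w u) * OR T x := by
    intro x
    rw [he, ← Finset.sum_fiberwise Finset.univ S]
    refine Finset.sum_congr rfl fun T _ => ?_
    rw [Finset.sum_mul]
    exact Finset.sum_congr rfl fun u hu => by rw [(Finset.mem_filter.1 hu).2]
  refine ⟨fun T => ∑ u with S u = T, w u, ⟨fun T => Finset.sum_nonneg fun u _ => hw u, heq,
    sum_weights_le_one _ _ id fun x => ?_⟩, ?_⟩
  · exact (heq x).symm.le.trans (hr x).2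
  · calc (Finset.univ.filter fun T => ∑ u with S u = T, w u ≠ 0).card
        ≤ (Finset.univ.image S).card := by
          refine Finset.card_le_card fun T hT => ?_
          obtain ⟨u, hu, _⟩ := Finset.exists_ne_zero_of_sum_ne_zero (Finset.mem_filter.1 hT).2
          exact Finset.mem_image.2 ⟨u, Finset.mem_univ _, (Finset.mem_filter.1 hu).2⟩
      _ ≤ (Finset.univ : Finset (Fin (size c))).card := Finset.card_image_le
      _ = size c := by simp

namespace IsRep

variable {c : Cube n → ℝ} {v : Finset (Fin n) → ℝ}

theorem coef_eq (h : IsRep c v) {T : Finset (Fin n)} (hT : T.Nonempty) :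
    coef c T = ∑ S, v S * if T ⊆ S then (1 / 2 : ℝ) ^ S.card else 0 := by
  have h1 : coef c T = ∑ S, v S * coef (OR S) T := by
    simp only [coef, h.eq, Finset.sum_mul, Finset.expect_sum_comm, mul_assoc, ← Finset.mul_expect,
      mul_neg, Finset.sum_neg_distrib]
  rw [h1]
  exact Finset.sum_congr rfl fun S _ => by rw [coef_OR S hT]

/-- Enlarging T only removes non-negative terms from the sum over S ⊇ T. This monotonicity makes the
search by one-variable extensions complete. -/
theorem coef_anti (h : IsRep c v) {T T' : Finset (Fin n)} (hT : T.Nonempty) (hTT : T ⊆ T') :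
    coef c T' ≤ coef c T := by
  rw [h.coef_eq hT, h.coef_eq (hT.mono hTT)]
  refine Finset.sum_le_sum fun S _ => mul_le_mul_of_nonneg_left ?_ (h.nonneg S)
  by_cases h1 : T' ⊆ S
  · simp [h1, hTT.trans h1]
  · simp only [h1, if_false]; split_ifs <;> positivity

theorem weight_le_coef (h : IsRep c v) {S : Finset (Fin n)} (hS : S.Nonempty) :
    v S * (1 / 2) ^ S.card ≤ coef c S := by
  rw [h.coef_eq hS]
  refine le_trans (by simp) (Finset.single_le_sum (f := fun S' => v S' *
    if S ⊆ S' then (1 / 2 : ℝ) ^ S'.card else 0) (fun S' _ => mul_nonneg (h.nonneg S') ?_)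
    (Finset.mem_univ S))
  split_ifs <;> positivity

/-- After exchanging sums, each S is counted for at most 2^{|S|} sets T ⊆ S, each time with the
factor 2^{-|S|}; what remains is the total weight. -/
theorem sum_coef_le_one (h : IsRep c v) (𝒯 : Finset (Finset (Fin n))) (h𝒯 : ∀ T ∈ 𝒯, T.Nonempty) :
    ∑ T ∈ 𝒯, coef c T ≤ 1 := by
  rw [Finset.sum_congr rfl fun T hT => h.coef_eq (h𝒯 T hT), Finset.sum_comm]
  refine le_trans (Finset.sum_le_sum fun S _ => ?_) h.sum_le
  rw [← Finset.mul_sum]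
  refine mul_le_of_le_one_right (h.nonneg S) ?_
  rw [← Finset.sum_filter, Finset.sum_const, nsmul_eq_mul]
  have : (𝒯.filter fun T => T ⊆ S).card ≤ 2 ^ S.card := by
    rw [← Finset.card_powerset]
    exact Finset.card_le_card fun T hT => Finset.mem_powerset.2 (Finset.mem_filter.1 hT).2
  calc ((𝒯.filter fun T => T ⊆ S).card : ℝ) * (1 / 2) ^ S.card
      ≤ 2 ^ S.card * (1 / 2) ^ S.card := by gcongr; exact_mod_cast this
    _ = 1 := by rw [← mul_pow]; norm_num

theorem card_coef_ge (h : IsRep c v) {α : ℝ} (𝒯 : Finset (Finset (Fin n)))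
    (h𝒯 : ∀ T ∈ 𝒯, T.Nonempty ∧ α ≤ coef c T) : 𝒯.card * α ≤ 1 := by
  rw [← nsmul_eq_mul]
  exact (Finset.card_nsmul_le_sum _ _ _ fun T hT => (h𝒯 T hT).2).trans
    (h.sum_coef_le_one 𝒯 fun T hT => (h𝒯 T hT).1)

end IsRep

/-! ### Approximation by few short disjunctions -/

theorem expect_abs_sum_le {ι : Type*} (s : Finset ι) (f : ι → Cube n → ℝ) :
    𝔼 x, |∑ i ∈ s, f i x| ≤ ∑ i ∈ s, 𝔼 x, |f i x| := by
  rw [← Finset.expect_sum_comm]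
  exact Finset.expect_le_expect fun x _ => Finset.abs_sum_le_sum_abs _ _

/-- Long disjunctions are replaced by constants, and disjunctions of small weight are dropped. -/
theorem IsRep.truncate {c : Cube n → ℝ} {v : Finset (Fin n) → ℝ} (h : IsRep c v) (L : ℕ) {β : ℝ}
    {k : ℝ} (hβ : 0 ≤ β)
    (hk : ((Finset.univ.filter fun S => S ≠ ∅ ∧ S.card ≤ L ∧ v S ≠ 0).card : ℝ) ≤ k) :
    ∃ (κ : ℝ) (F : Finset (Finset (Fin n))), 0 ≤ κ ∧ κ + ∑ S ∈ F, v S ≤ 1 ∧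
      (∀ S ∈ F, S ≠ ∅ ∧ S.card ≤ L ∧ β ≤ v S) ∧
      𝔼 x, |κ + ∑ S ∈ F, v S * OR S x - c x| ≤ (1 / 2) ^ (L + 1) + k * β := by
  classical
  -- A collects what becomes part of the constant: the long disjunctions, which differ from 1 with
  -- probability at most 2^{-(L+1)}, and the empty one, which is already constant. F is kept, D is
  -- dropped.
  set A := Finset.univ.filter fun S : Finset (Fin n) => S = ∅ ∨ L < S.card with hA
  set F := Finset.univ.filter fun S : Finset (Fin n) => ¬(S = ∅ ∨ L < S.card) ∧ β ≤ v S with hF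
  set D := Finset.univ.filter fun S : Finset (Fin n) => ¬(S = ∅ ∨ L < S.card) ∧ ¬ β ≤ v S with hD
  have split : ∀ f : Finset (Fin n) → ℝ, ∑ S, f S = ∑ S ∈ A, f S + ∑ S ∈ F, f S + ∑ S ∈ D, f S := by
    intro f
    rw [← Finset.sum_filter_add_sum_filter_not Finset.univ
      (fun S : Finset (Fin n) => S = ∅ ∨ L < S.card), add_assoc]
    congr 1
    rw [← Finset.sum_filter_add_sum_filter_not _ (fun S : Finset (Fin n) => β ≤ v S),
      Finset.filter_filter, Finset.filter_filter]
  refine ⟨∑ S ∈ A, v S, F, Finset.sum_nonneg fun S _ => h.nonneg S, ?_, ?_, ?_⟩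
  · have := split v
    have hd : 0 ≤ ∑ S ∈ D, v S := Finset.sum_nonneg fun S _ => h.nonneg S
    linarith [h.sum_le]
  · intro S hS
    have := (Finset.mem_filter.1 hS).2
    push Not at this
    exact ⟨this.1.1.ne_empty, this.1.2, this.2⟩
  · have hdiff : ∀ x, ∑ S ∈ A, v S + ∑ S ∈ F, v S * OR S x - c x =
        ∑ S ∈ A, v S * (1 - OR S x) + ∑ S ∈ D, -(v S * OR S x) := by
      intro x
      rw [h.eq, split fun S => v S * OR S x]
      simp only [mul_sub, mul_one, Finset.sum_sub_distrib, Finset.sum_neg_distrib]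
      ring
    have hAle : 𝔼 x, |∑ S ∈ A, v S * (1 - OR S x)| ≤ (1 / 2) ^ (L + 1) := by
      refine (expect_abs_sum_le _ _).trans ?_
      calc ∑ S ∈ A, 𝔼 x, |v S * (1 - OR S x)|
          ≤ ∑ S ∈ A, v S * (1 / 2) ^ (L + 1) := by
            refine Finset.sum_le_sum fun S hS => ?_
            simp only [abs_mul, abs_of_nonneg (h.nonneg S), ← Finset.mul_expect]
            refine mul_le_mul_of_nonneg_left ?_ (h.nonneg S)
            rcases S.eq_empty_or_nonempty with rfl | hne
            · simp
            · have hc : L + 1 ≤ S.card := by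
                rcases (Finset.mem_filter.1 hS).2 with h | h
                · exact absurd h hne.ne_empty
                · exact h
              simp only [OR_of_nonempty hne, sub_sub_cancel, abs_of_nonneg (nor_nonneg _ _),
                expect_nor]
              exact pow_le_pow_of_le_one (by norm_num) (by norm_num) hc
        _ = (∑ S ∈ A, v S) * (1 / 2) ^ (L + 1) := by rw [Finset.sum_mul]
        _ ≤ 1 * (1 / 2) ^ (L + 1) := by
            gcongr
            exact (Finset.sum_le_univ_sum_of_nonneg h.nonneg).trans h.sum_le
        _ = _ := one_mul _
    have hDle : 𝔼 x, |∑ S ∈ D, -(v S * OR S x)| ≤ k * β := by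
      refine (expect_abs_sum_le _ _).trans ?_
      -- Sets of weight zero cost nothing, so only those counted by k contribute, each at most β.
      set D' := D.filter fun S => v S ≠ 0
      have hcard : (D'.card : ℝ) ≤ k := by
        refine le_trans (Nat.cast_le.2 (Finset.card_le_card fun S hS => ?_)) hk
        simp only [D', D, Finset.mem_filter, Finset.mem_univ, true_and, not_or, not_lt] at hS ⊢
        exact ⟨hS.1.1.1, hS.1.1.2, hS.2⟩
      calc ∑ S ∈ D, 𝔼 x, |-(v S * OR S x)|
          = ∑ S ∈ D', 𝔼 x, |-(v S * OR S x)| := by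
            symm
            refine Finset.sum_filter_of_ne fun S _ hne => ?_
            contrapose! hne
            simp [hne]
        _ ≤ ∑ S ∈ D', β := by
            refine Finset.sum_le_sum fun S hS => ?_
            have hb : v S ≤ β := by
              have := (Finset.mem_filter.1 (Finset.mem_filter.1 hS).1).2.2
              linarith
            refine le_trans (Finset.expect_le_expect (g := fun _ => β) fun x _ => ?_) (by simp)
            rw [abs_neg, abs_of_nonneg (mul_nonneg (h.nonneg S) (OR_nonneg S x))]
            exact (mul_le_of_le_one_right (h.nonneg S) (OR_le_one S x)).trans hb
        _ = D'.card * β := by simp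
        _ ≤ k * β := by gcongr
    calc 𝔼 x, |∑ S ∈ A, v S + ∑ S ∈ F, v S * OR S x - c x|
        ≤ 𝔼 x, (|∑ S ∈ A, v S * (1 - OR S x)| + |∑ S ∈ D, -(v S * OR S x)|) :=
          Finset.expect_le_expect fun x _ => by rw [hdiff]; exact abs_add_le _ _
      _ ≤ _ := by rw [Finset.expect_add_distrib]; exact add_le_add hAle hDle

/-- The coefficients of the average of `∑ S, v S * OR S` over the variables outside `I`. -/
def restrictWeights (v : Finset (Fin n) → ℝ) (I R : Finset (Fin n)) : ℝ :=
  if R = ∅ then ∑ S, v S - ∑ S with S ≠ ∅, v S * (1 / 2) ^ (S \ I).card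
  else ∑ S with S ≠ ∅ ∧ S ∩ I = R, v S * (1 / 2) ^ (S \ I).card

/-- Averaging over the variables outside I turns nor S into 2^{-|S \ I|} nor (S ∩ I), so the
right-hand side is the averaged function. Grouping the S by R = S ∩ I gives the new weights; sets
disjoint from I only influence the constant. -/
theorem sum_restrictWeights_mul_OR (v : Finset (Fin n) → ℝ) (I : Finset (Fin n)) (x : Cube n) :
    ∑ R, restrictWeights v I R * OR R x =
      ∑ S, v S - ∑ S with S ≠ ∅, v S * ((1 / 2) ^ (S \ I).card * nor (S ∩ I) x) := by
  classical
  have h1 : ∀ R, restrictWeights v I R * OR R x =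
      (if R = ∅ then ∑ S, v S - ∑ S with S ≠ ∅, v S * (1 / 2) ^ (S \ I).card else 0) +
        ∑ S ∈ Finset.univ.filter (fun S : Finset (Fin n) => S ≠ ∅) with S ∩ I = R,
          v S * (1 / 2) ^ (S \ I).card * (1 - nor (S ∩ I) x) := by
    intro R
    by_cases hR : R = ∅
    · subst hR
      have h0 : ∑ S ∈ Finset.univ.filter (fun S : Finset (Fin n) => S ≠ ∅) with S ∩ I = ∅,
          v S * (1 / 2) ^ (S \ I).card * (1 - nor (S ∩ I) x) = 0 :=
        Finset.sum_eq_zero fun S hS => by rw [(Finset.mem_filter.1 hS).2]; simp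
      rw [h0]
      simp [restrictWeights]
    · rw [restrictWeights, if_neg hR, if_neg hR, zero_add, Finset.sum_mul, Finset.filter_filter]
      refine Finset.sum_congr rfl fun S hS => ?_
      rw [(Finset.mem_filter.1 hS).2.2, OR_of_nonempty (Finset.nonempty_iff_ne_empty.2 hR)]
  simp only [h1]
  rw [Finset.sum_add_distrib, Finset.sum_fiberwise]
  simp only [Finset.sum_ite_eq', Finset.mem_univ, if_true, mul_sub, mul_one, ← mul_assoc,
    Finset.sum_sub_distrib]
  ring

theorem IsRep.restrict {c : Cube n → ℝ} {v : Finset (Fin n) → ℝ} (h : IsRep c v)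
    (I : Finset (Fin n)) :
    IsRep (fun x => ∑ R, restrictWeights v I R * OR R x) (restrictWeights v I) := by
  classical
  refine ⟨fun R => ?_, fun x => rfl, ?_⟩
  · unfold restrictWeights
    split_ifs
    · refine sub_nonneg.2 (le_trans (Finset.sum_le_sum fun S _ => ?_)
        (Finset.sum_le_univ_sum_of_nonneg h.nonneg))
      exact mul_le_of_le_one_right (h.nonneg S) (pow_le_one₀ (by norm_num) (by norm_num))
    · exact Finset.sum_nonneg fun S _ => mul_nonneg (h.nonneg S) (by positivity)
  · refine sum_weights_le_one _ _ id fun x => ?_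
    simp only [id]
    rw [sum_restrictWeights_mul_OR]
    have : 0 ≤ ∑ S with S ≠ ∅, v S * ((1 / 2) ^ (S \ I).card * nor (S ∩ I) x) :=
      Finset.sum_nonneg fun S _ => mul_nonneg (h.nonneg S)
        (mul_nonneg (by positivity) (nor_nonneg _ _))
    linarith [h.sum_le]

/-- Since |S \ I| + |S ∩ I| = |S|, the left-hand side is the part of the sum for `coef c R` over
those S ⊇ R with S ∩ I = R. Survivors of the averaged function thus have large coefficients in c
itself, where they can be detected. -/
theorem IsRep.restrictWeights_le_coef {c : Cube n → ℝ} {v : Finset (Fin n) → ℝ} (h : IsRep c v)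
    (I : Finset (Fin n)) {R : Finset (Fin n)} (hR : R.Nonempty) :
    restrictWeights v I R * (1 / 2) ^ R.card ≤ coef c R := by
  rw [restrictWeights, if_neg hR.ne_empty, h.coef_eq hR, Finset.sum_mul]
  simp only [mul_ite, mul_zero]
  rw [← Finset.sum_filter]
  refine le_trans (Finset.sum_le_sum (g := fun S => v S * (1 / 2) ^ S.card) fun S hS => le_of_eq ?_)
    (Finset.sum_le_sum_of_subset_of_nonneg (fun S hS => ?_) fun S _ _ =>
      mul_nonneg (h.nonneg S) (by positivity))
  · obtain ⟨-, -, rfl⟩ := Finset.mem_filter.1 hS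
    rw [mul_assoc, ← pow_add, Finset.card_sdiff_add_card_inter]
  · obtain ⟨-, -, rfl⟩ := Finset.mem_filter.1 hS
    simp

/-- The average of `c` over the variables outside `I` is close to `c` if the coefficients outside
`I` are small. -/
theorem IsRep.expect_sq_sub_restrict_le {c : Cube n → ℝ} {v : Finset (Fin n) → ℝ} (h : IsRep c v)
    (I : Finset (Fin n)) {α : ℝ} (hα : 0 ≤ α) (hI : ∀ T, ¬ T ⊆ I → coef c T ≤ α) :
    𝔼 x, (c x - ∑ R, restrictWeights v I R * OR R x) ^ 2 ≤ α := by
  classical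
  set d : Finset (Fin n) → Cube n → ℝ :=
    fun S x => (1 / 2) ^ (S \ I).card * nor (S ∩ I) x - nor S x with hd
  set g : Cube n → ℝ := fun x => c x - ∑ R, restrictWeights v I R * OR R x with hg
  have hgd : ∀ x, g x = ∑ S with S ≠ ∅, v S * d S x := by
    intro x
    simp only [hg]
    rw [sum_restrictWeights_mul_OR, h.eq]
    have h1 : ∑ S, v S * OR S x = ∑ S, v S - ∑ S with S ≠ ∅, v S * nor S x := by
      rw [Finset.sum_filter, ← Finset.sum_sub_distrib]
      refine Finset.sum_congr rfl fun S _ => ?_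
      rw [OR_eq]
      by_cases hS : S = ∅ <;> simp [hS, mul_sub]
    rw [h1]
    simp only [hd, mul_sub, Finset.sum_sub_distrib]
    ring
  -- The difference of nor S and its average has no Fourier mass on subsets of I; outside it keeps
  -- that of nor S.
  have hdchi : ∀ S T, 𝔼 x, d S x * chi T x =
      -(if T ⊆ I then 0 else if T ⊆ S then (1 / 2 : ℝ) ^ S.card else 0) := by
    intro S T
    simp only [hd, sub_mul, Finset.expect_sub_distrib, mul_assoc, ← Finset.mul_expect,
      expect_nor_mul_chi, Finset.subset_inter_iff]
    by_cases h1 : T ⊆ I <;> by_cases h2 : T ⊆ S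
    · simp only [h1, h2, and_self, if_true]
      rw [← pow_add, Finset.card_sdiff_add_card_inter]; simp
    all_goals simp [h1, h2]
  have hgchi : ∀ T, 𝔼 x, g x * chi T x = if T ⊆ I then 0 else -coef c T := by
    intro T
    simp only [hgd, Finset.sum_mul, Finset.expect_sum_comm, mul_assoc, ← Finset.mul_expect, hdchi]
    by_cases h1 : T ⊆ I
    · simp [h1]
    · have hT : T.Nonempty := Finset.nonempty_iff_ne_empty.2 fun h0 => h1 (by simp [h0])
      simp only [h1, if_false, h.coef_eq hT, mul_neg, Finset.sum_neg_distrib]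
      congr 1
      refine Finset.sum_filter_of_ne fun S _ hne h0 => hne ?_
      subst h0
      simp [hT.ne_empty]
  have hgnor : ∀ S, 𝔼 x, g x * nor S x =
      (1 / 2) ^ S.card * ∑ T ∈ S.powerset, if T ⊆ I then 0 else -coef c T := by
    intro S
    simp only [nor_eq_sum, mul_left_comm (g _), ← Finset.mul_expect, Finset.mul_sum,
      Finset.expect_sum_comm, hgchi]
  -- Being an average over I, nor (S ∩ I) up to a factor involves only characters of subsets of I,
  -- to which g is orthogonal. The function nor S is the mean of the characters of the subsets of S,
  -- on each of which g has a coefficient of at least -α. As g is a combination of the d S with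
  -- total weight at most 1, this bounds E g² without squaring coefficients.
  have hgd' : ∀ S, 𝔼 x, g x * d S x ≤ α := by
    intro S
    have h1 : 𝔼 x, g x * d S x = (1 / 2) ^ (S \ I).card * (𝔼 x, g x * nor (S ∩ I) x) -
        𝔼 x, g x * nor S x := by
      rw [Finset.mul_expect, ← Finset.expect_sub_distrib]
      exact Finset.expect_congr rfl fun x _ => by simp only [hd]; ring
    rw [h1, hgnor, hgnor, Finset.sum_eq_zero fun T hT => ?_]
    · simp only [mul_zero, zero_sub, ← mul_neg, ← Finset.sum_neg_distrib]
      calc (1 / 2 : ℝ) ^ S.card * ∑ T ∈ S.powerset, -(if T ⊆ I then 0 else -coef c T)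
          ≤ (1 / 2) ^ S.card * ∑ T ∈ S.powerset, α := by
            gcongr with T _
            by_cases h2 : T ⊆ I
            · simpa [h2] using hα
            · simpa [h2] using hI T h2
        _ = α := by
            rw [Finset.sum_const, Finset.card_powerset, nsmul_eq_mul, ← mul_assoc]
            push_cast
            rw [← mul_pow]; norm_num
    · rw [if_pos ((Finset.mem_powerset.1 hT).trans Finset.inter_subset_right)]
  calc 𝔼 x, g x ^ 2 = ∑ S with S ≠ ∅, v S * 𝔼 x, g x * d S x := by
        simp only [Finset.mul_expect, ← Finset.expect_sum_comm]
        refine Finset.expect_congr rfl fun x _ => ?_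
        rw [sq]
        conv_lhs => rw [hgd x, Finset.sum_mul]
        refine Finset.sum_congr rfl fun S _ => by rw [hgd x]; ring
    _ ≤ ∑ S with S ≠ ∅, v S * α :=
        Finset.sum_le_sum fun S _ => mul_le_mul_of_nonneg_left (hgd' S) (h.nonneg S)
    _ = (∑ S with S ≠ ∅, v S) * α := by rw [Finset.sum_mul]
    _ ≤ 1 * α := by
        gcongr
        exact (Finset.sum_le_univ_sum_of_nonneg h.nonneg).trans h.sum_le
    _ = α := one_mul α

/-- A non-empty set of at most L elements is the image of a map from L indices into I: enumerate the
set and fill up with one of its elements. -/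
theorem card_short_subsets_le (I : Finset (Fin n)) (L : ℕ) :
    (Finset.univ.filter fun R : Finset (Fin n) => R ≠ ∅ ∧ R.card ≤ L ∧ R ⊆ I).card ≤ I.card ^ L := by
  classical
  have hcard : (Fintype.piFinset fun _ : Fin L => I).card = I.card ^ L := by simp
  rw [← hcard]
  refine (Finset.card_le_card (t := (Fintype.piFinset fun _ : Fin L => I).image
    fun f => Finset.univ.image f) fun R hR => ?_).trans Finset.card_image_le
  obtain ⟨-, hne, hL, hI⟩ := Finset.mem_filter.1 hR
  obtain ⟨i₀, hi₀⟩ := Finset.nonempty_iff_ne_empty.2 hne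
  refine Finset.mem_image.2 ⟨fun j => if h : (j : ℕ) < R.card then R.equivFin.symm ⟨j, h⟩ else i₀,
    Fintype.mem_piFinset.2 fun j => hI ?_, ?_⟩
  · split_ifs with h
    · exact (R.equivFin.symm ⟨j, h⟩).2
    · exact hi₀
  · ext i
    simp only [Finset.mem_image, Finset.mem_univ, true_and]
    constructor
    · rintro ⟨j, rfl⟩
      split_ifs with h
      · exact (R.equivFin.symm ⟨j, h⟩).2
      · exact hi₀
    · intro hi
      refine ⟨⟨R.equivFin ⟨i, hi⟩, (R.equivFin ⟨i, hi⟩).2.trans_le hL⟩, ?_⟩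
      simp

/-- The truncation length in the definition of `sEps`. -/
theorem exists_sEps_eq {ε : ℝ} (hε : 0 < ε) (hε1 : ε < 1) : ∃ L : ℕ, 6 / ε ≤ 2 ^ L ∧
    (∀ k : ℕ, 6 / ε ≤ 2 ^ k → L ≤ k) ∧ (2 : ℝ) ^ L ≤ 12 / ε ∧
    ∀ c : Cube n → ℝ, sEps c ε = min (max 1 (size c : ℝ)) ((12 / ε) ^ (2 * L)) := by
  have h6 : 1 < 6 / ε := by rw [lt_div_iff₀ hε]; linarith
  have hlog : 0 < Real.logb 2 (6 / ε) := Real.logb_pos (by norm_num) h6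
  obtain ⟨L, hL⟩ := Int.eq_ofNat_of_zero_le (Int.ceil_pos.2 hlog).le
  have h2 : (0 : ℝ) < 6 / ε := by linarith
  have hc1 : Real.logb 2 (6 / ε) ≤ L := by
    have := Int.le_ceil (Real.logb 2 (6 / ε)); rw [hL] at this; exact_mod_cast this
  have hc2 : (L : ℝ) < Real.logb 2 (6 / ε) + 1 := by
    have := Int.ceil_lt_add_one (Real.logb 2 (6 / ε)); rw [hL] at this; exact_mod_cast this
  refine ⟨L, ?_, fun k hk => ?_, ?_, fun c => ?_⟩
  · have := (Real.logb_le_iff_le_rpow (by norm_num) h2).1 hc1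
    rwa [Real.rpow_natCast] at this
  · have h3 : Real.logb 2 (6 / ε) ≤ k := by
      rw [Real.logb_le_iff_le_rpow (by norm_num) h2, Real.rpow_natCast]; exact hk
    have : (⌈Real.logb 2 (6 / ε)⌉ : ℤ) ≤ k := Int.ceil_le.2 (by exact_mod_cast h3)
    rw [hL] at this; exact_mod_cast this
  · have h3 : (L : ℝ) - 1 ≤ Real.logb 2 (6 / ε) := by linarith
    rw [Real.le_logb_iff_rpow_le (by norm_num) h2, Real.rpow_sub_one (by norm_num),
      Real.rpow_natCast] at h3
    calc (2 : ℝ) ^ L = 2 * (2 ^ L / 2) := by ring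
      _ ≤ 2 * (6 / ε) := by gcongr
      _ = 12 / ε := by ring
  · rw [sEps, hL]
    norm_cast

theorem one_le_sEps (c : Cube n → ℝ) {ε : ℝ} (hε : 0 < ε) (hε1 : ε < 1) : 1 ≤ sEps c ε := by
  obtain ⟨L, -, -, -, h⟩ := exists_sEps_eq (n := n) hε hε1
  rw [h]
  refine le_min (le_max_left _ _) (one_le_pow₀ ?_)
  rw [le_div_iff₀ hε]; linarith

/-- The error budget is ε/12 for the long disjunctions, s · ε/(6s) = ε/6 for the light ones, and ε/4
for replacing c by c'. A survivor has weight at least ε/(6s) and length at most L with 2^L ≤ 12/ε,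
which explains ε²/(72s). -/
theorem IsRep.exists_comparator_aux {c c' : Cube n → ℝ} {v : Finset (Fin n) → ℝ} (h : IsRep c' v)
    {ε s : ℝ} {L : ℕ} (hε : 0 < ε) (hs : 0 < s) (hL : 6 / ε ≤ 2 ^ L) (hL' : (2 : ℝ) ^ L ≤ 12 / ε)
    (hcoef : ∀ S : Finset (Fin n), S.Nonempty → v S * (1 / 2) ^ S.card ≤ coef c S)
    (hk : ((Finset.univ.filter fun S => S ≠ ∅ ∧ S.card ≤ L ∧ v S ≠ 0).card : ℝ) ≤ s)
    (hd : 𝔼 x, |c' x - c x| ≤ ε / 4) :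
    ∃ (κ : ℝ) (F : Finset (Finset (Fin n))) (v : Finset (Fin n) → ℝ), 0 ≤ κ ∧ (∀ S, 0 ≤ v S) ∧
      κ + ∑ S ∈ F, v S ≤ 1 ∧ (∀ S ∈ F, S.Nonempty ∧ ε ^ 2 / (72 * s) ≤ coef c S) ∧
      𝔼 x, |κ + ∑ S ∈ F, v S * OR S x - c x| ≤ ε / 2 := by
  obtain ⟨κ, F, h0, h1, h2, h3⟩ := h.truncate L (β := ε / (6 * s)) (by positivity) hk
  refine ⟨κ, F, v, h0, h.nonneg, h1, fun S hS => ?_, ?_⟩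
  · obtain ⟨hne, hle, hw⟩ := h2 S hS
    have hne' := Finset.nonempty_iff_ne_empty.2 hne
    refine ⟨hne', le_trans ?_ (hcoef S hne')⟩
    calc ε ^ 2 / (72 * s) = ε / (6 * s) * (12 / ε)⁻¹ := by field_simp; norm_num
      _ ≤ v S * (2 ^ S.card)⁻¹ := by
        gcongr
        · exact h.nonneg S
        · exact (pow_le_pow_right₀ (by norm_num) hle).trans hL'
      _ = v S * (1 / 2) ^ S.card := by rw [one_div, inv_pow]
  · have h4 : (1 / 2 : ℝ) ^ (L + 1) ≤ ε / 12 := by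
      rw [pow_succ, one_div, inv_pow]
      calc ((2 : ℝ) ^ L)⁻¹ * 2⁻¹ ≤ (6 / ε)⁻¹ * 2⁻¹ := by gcongr
        _ = ε / 12 := by field_simp; norm_num
    have h5 : s * (ε / (6 * s)) = ε / 6 := by field_simp
    calc 𝔼 x, |κ + ∑ S ∈ F, v S * OR S x - c x|
        ≤ 𝔼 x, (|κ + ∑ S ∈ F, v S * OR S x - c' x| + |c' x - c x|) :=
          Finset.expect_le_expect fun x _ => abs_sub_le _ _ _
      _ ≤ ((1 / 2) ^ (L + 1) + s * (ε / (6 * s))) + ε / 4 := by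
          rw [Finset.expect_add_distrib]; exact add_le_add h3 hd
      _ ≤ ε / 2 := by rw [h5]; linarith

/-- Every coverage function is close to a combination of the constant and of disjunctions with
large Fourier coefficients. -/
theorem exists_comparator {c : Cube n → ℝ} (hc : c ∈ CV n) {ε s : ℝ} (hε : 0 < ε) (hε1 : ε < 1)
    (hs : sEps c ε ≤ s) :
    ∃ (κ : ℝ) (F : Finset (Finset (Fin n))) (v : Finset (Fin n) → ℝ), 0 ≤ κ ∧ (∀ S, 0 ≤ v S) ∧
      κ + ∑ S ∈ F, v S ≤ 1 ∧ (∀ S ∈ F, S.Nonempty ∧ ε ^ 2 / (72 * s) ≤ coef c S) ∧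
      𝔼 x, |κ + ∑ S ∈ F, v S * OR S x - c x| ≤ ε / 2 := by
  classical
  obtain ⟨v, hv, hcard⟩ := exists_isRep hc
  obtain ⟨L, hL1, -, hL2, hLs⟩ := exists_sEps_eq (n := n) hε hε1
  have hs1 : 1 ≤ s := (one_le_sEps c hε hε1).trans hs
  have hs0 : 0 < s := by linarith
  rw [hLs] at hs
  rcases min_le_iff.1 hs with h | h
  · refine hv.exists_comparator_aux hε hs0 hL1 hL2 (fun S hS => hv.weight_le_coef hS) ?_ ?_
    · refine le_trans (Nat.cast_le.2 ((Finset.card_le_card fun S hS => ?_).trans hcard))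
        ((le_max_right _ _).trans h)
      simp only [Finset.mem_filter, Finset.mem_univ, true_and] at hS ⊢
      exact hS.2.2
    · simp only [sub_self, abs_zero, Finset.expect_const_zero]; positivity
  -- By monotonicity, a set with a variable outside I has a coefficient of at most ε²/16, and I has
  -- at most 16/ε² elements because singleton coefficients sum to at most 1.
  · set I : Finset (Fin n) := Finset.univ.filter fun i => ε ^ 2 / 16 ≤ coef c {i} with hI
    have hIcard : (I.card : ℝ) ≤ 16 / ε ^ 2 := by
      have := hv.card_coef_ge (α := ε ^ 2 / 16) (I.image fun i => {i}) (fun T hT => by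
        obtain ⟨i, hi, rfl⟩ := Finset.mem_image.1 hT
        exact ⟨Finset.singleton_nonempty i, (Finset.mem_filter.1 hi).2⟩)
      rw [Finset.card_image_of_injective _ Finset.singleton_injective] at this
      rw [le_div_iff₀ (by positivity)]
      linarith
    have hsq := hv.expect_sq_sub_restrict_le I (α := ε ^ 2 / 16) (by positivity) (fun T hT => by
      obtain ⟨i, hi, hiI⟩ := Finset.not_subset.1 hT
      refine (hv.coef_anti (Finset.singleton_nonempty i) (Finset.singleton_subset_iff.2 hi)).trans ?_
      by_contra hlt
      exact hiI (Finset.mem_filter.2 ⟨Finset.mem_univ i, (not_le.1 hlt).le⟩))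
    refine (hv.restrict I).exists_comparator_aux hε hs0 hL1 hL2
      (fun S hS => hv.restrictWeights_le_coef I hS) ?_ ?_
    · refine le_trans ?_ h
      calc _ ≤ ((I.card ^ L : ℕ) : ℝ) := by
            refine Nat.cast_le.2 (le_trans (Finset.card_le_card fun R hR => ?_)
              (card_short_subsets_le I L))
            simp only [Finset.mem_filter, Finset.mem_univ, true_and] at hR ⊢
            refine ⟨hR.1, hR.2.1, ?_⟩
            by_contra hRI
            refine hR.2.2 ?_
            rw [restrictWeights, if_neg hR.1, Finset.sum_eq_zero]
            intro S hS
            exact absurd ((Finset.mem_filter.1 hS).2.2 ▸ Finset.inter_subset_right) hRI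
        _ = (I.card : ℝ) ^ L := by push_cast; rfl
        _ ≤ (16 / ε ^ 2) ^ L := by gcongr
        _ ≤ ((12 / ε) ^ 2) ^ L := by
            gcongr
            rw [div_pow]
            gcongr
            norm_num
        _ = _ := by rw [pow_mul]
    -- From L² to L¹ by y ≤ (2/ε) y² + ε/8, which is (4y - ε)² ≥ 0.
    · calc _ ≤ 𝔼 x, ((c x - ∑ R, restrictWeights v I R * OR R x) ^ 2 * (2 / ε) + ε / 8) := by
            refine Finset.expect_le_expect fun x _ => ?_
            rw [abs_sub_comm]
            set y := |c x - ∑ R, restrictWeights v I R * OR R x| with hy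
            rw [← sq_abs, ← hy]
            have : y ^ 2 * (2 / ε) + ε / 8 - y = (4 * y - ε) ^ 2 / (8 * ε) := by
              field_simp; ring
            have h2 : 0 ≤ (4 * y - ε) ^ 2 / (8 * ε) := by positivity
            linarith
        _ ≤ ε ^ 2 / 16 * (2 / ε) + ε / 8 := by
            rw [Finset.expect_add_distrib, ← Finset.expect_mul]
            simp only [Finset.expect_const Finset.univ_nonempty]
            gcongr
        _ = ε / 4 := by field_simp; norm_num

end

section

/-! ### The search for sets with large coefficients -/

/-- A family of `len` sets, indexed by the natural numbers below `len`. -/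
structure Fam (n : ℕ) where
  /-- the number of sets -/
  len : ℕ
  /-- the sets -/
  set : ℕ → Finset (Fin n)

variable {n : ℕ}

open Classical in
/-- Add the variable `i` to the `k`-th set, and append the result if it satisfies `P`. -/
def Fam.extend (P : Finset (Fin n) → Prop) (cap : ℝ) (i : Fin n) (k : ℕ) (G : Fam n) : Fam n :=
  if P (insert i (G.set k)) ∧ (G.len : ℝ) < cap then
    ⟨G.len + 1, Function.update G.set G.len (insert i (G.set k))⟩
  else G

/-- Try to extend the first `k` sets by the variable `i`. -/
def Fam.scan (P : Finset (Fin n) → Prop) (cap : ℝ) (i : Fin n) (G : Fam n) : ℕ → Fam n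
  | 0 => G
  | k + 1 => (Fam.scan P cap i G k).extend P cap i k

/-- The family that is found when the first `i` variables have been treated. -/
def family (P : Finset (Fin n) → Prop) (cap : ℝ) : ℕ → Fam n
  | 0 => ⟨1, fun _ => ∅⟩
  | i + 1 => if h : i < n then
      (family P cap i).scan P cap ⟨i, h⟩ (family P cap i).len else family P cap i

/-- Properties of the families found by the search that hold unconditionally. -/
structure Fam.Valid (cap : ℝ) (G : Fam n) : Prop where
  pos : 0 < G.len
  zero : G.set 0 = ∅
  len_le : (G.len : ℝ) ≤ cap + 1
  nonempty : ∀ q < G.len, q ≠ 0 → (G.set q).Nonempty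

theorem Fam.Valid.extend {P : Finset (Fin n) → Prop} {cap : ℝ} {i : Fin n} {k : ℕ} {G : Fam n}
    (h : G.Valid cap) : (G.extend P cap i k).Valid cap := by
  unfold Fam.extend
  split_ifs with h1
  · refine ⟨Nat.succ_pos _, ?_, ?_, fun q hq hq0 => ?_⟩
    · simp only
      rw [Function.update_of_ne h.pos.ne, h.zero]
    · push_cast; linarith [h1.2]
    · simp only at hq ⊢
      by_cases hql : q = G.len
      · rw [hql, Function.update_self]; exact Finset.insert_nonempty _ _
      · rw [Function.update_of_ne hql]; exact h.nonempty q (by omega) hq0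
  · exact h

theorem Fam.Valid.scan {P : Finset (Fin n) → Prop} {cap : ℝ} {i : Fin n} {G : Fam n}
    (h : G.Valid cap) (k : ℕ) : (G.scan P cap i k).Valid cap := by
  induction k with
  | zero => exact h
  | succ k ih => exact ih.extend

theorem family_valid (P : Finset (Fin n) → Prop) {cap : ℝ} (hcap : 0 ≤ cap) (i : ℕ) :
    (family P cap i).Valid cap := by
  induction i with
  | zero => exact ⟨Nat.one_pos, rfl, by simpa [family] using hcap, fun q hq hq0 => by
      simp [family] at hq; exact absurd hq hq0⟩
  | succ i ih =>
    rw [family]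
    split_ifs with h
    · exact ih.scan _
    · exact ih

theorem Fam.scan_old (P : Finset (Fin n) → Prop) (cap : ℝ) (i : Fin n) (G : Fam n) (k : ℕ) :
    G.len ≤ (G.scan P cap i k).len ∧ ∀ q < G.len, (G.scan P cap i k).set q = G.set q := by
  induction k with
  | zero => exact ⟨le_rfl, fun _ _ => rfl⟩
  | succ k ih =>
    rw [Fam.scan, Fam.extend]
    split_ifs
    · exact ⟨ih.1.trans (Nat.le_succ _), fun q hq =>
        (Function.update_of_ne (hq.trans_le ih.1).ne _ _).trans (ih.2 q hq)⟩
    · exact ih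

theorem Fam.scan_le {P : Finset (Fin n) → Prop} {cap : ℝ} {i : Fin n} {G : Fam n}
    (hG : ∀ q < G.len, ∀ j ∈ G.set q, j < i) (k : ℕ) (hk : k ≤ G.len) :
    ∀ q < (G.scan P cap i k).len, ∀ j ∈ (G.scan P cap i k).set q, j ≤ i := by
  induction k with
  | zero => exact fun q hq j hj => (hG q hq j hj).le
  | succ k ih =>
    have ih := ih (by omega)
    rw [Fam.scan, Fam.extend]
    split_ifs
    · intro q hq j hj
      simp only at hq hj
      rcases Nat.lt_succ_iff_lt_or_eq.1 hq with hq | rfl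
      · rw [Function.update_of_ne hq.ne] at hj; exact ih q hq j hj
      · rw [Function.update_self, (G.scan_old P cap i k).2 k (by omega)] at hj
        rcases Finset.mem_insert.1 hj with rfl | hj
        · exact le_rfl
        · exact (hG k (by omega) j hj).le
    · exact ih

/-- Variables are added in increasing order, so a variable is new to every set that it is added to;
this also keeps one set from being generated in several ways. -/
theorem family_lt (P : Finset (Fin n) → Prop) (cap : ℝ) (i : ℕ) :
    ∀ q < (family P cap i).len, ∀ j ∈ (family P cap i).set q, (j : ℕ) < i := by
  induction i with
  | zero => intro q _ j hj; simp [family] at hj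
  | succ i ih =>
    rw [family]
    split_ifs with h
    · intro q hq j hj
      exact Nat.lt_succ_of_le (Fam.scan_le (i := ⟨i, h⟩) (fun q hq j hj => ih q hq j hj) _ le_rfl
        q hq j hj)
    · exact fun q hq j hj => (ih q hq j hj).trans (Nat.lt_succ_self i)

/-- Properties of the families found by a search with accurate tests. -/
structure Fam.Sound (a : Finset (Fin n) → ℝ) (α : ℝ) (G : Fam n) : Prop where
  inj : ∀ p < G.len, ∀ q < G.len, G.set p = G.set q → p = q
  large : ∀ q < G.len, q ≠ 0 → α ≤ a (G.set q)

theorem Fam.Sound.large_or {a : Finset (Fin n) → ℝ} {α cap : ℝ} {G : Fam n} (h : G.Sound a α)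
    (hv : G.Valid cap) {q : ℕ} (hq : q < G.len) : G.set q = ∅ ∨ α ≤ a (G.set q) := by
  by_cases h0 : q = 0
  · exact Or.inl (h0 ▸ hv.zero)
  · exact Or.inr (h.large q hq h0)

/-- Apart from entry 0, the sets of a sound family are distinct, non-empty and large, so there are
few of them. The cap guards the resources after bad estimates but never stops an accurate search. -/
theorem Fam.Sound.len_lt {a : Finset (Fin n) → ℝ} {α cap : ℝ} {G : Fam n} (h : G.Sound a α)
    (hv : G.Valid cap) (hcard : ∀ 𝒯 : Finset (Finset (Fin n)), (∀ T ∈ 𝒯, T.Nonempty ∧ α ≤ a T) →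
      (𝒯.card : ℝ) + 1 < cap) : (G.len : ℝ) < cap := by
  classical
  have := hcard ((Finset.Ico 1 G.len).image G.set) fun T hT => by
    obtain ⟨q, hq, rfl⟩ := Finset.mem_image.1 hT
    have hq := Finset.mem_Ico.1 hq
    exact ⟨hv.nonempty q hq.2 (by omega), h.large q hq.2 (by omega)⟩
  rw [Finset.card_image_of_injOn, Nat.card_Ico, Nat.cast_sub hv.pos] at this
  · push_cast at this; linarith
  · intro p hp q hq hpq
    simp only [Finset.coe_Ico, Set.mem_Ico] at hp hq
    exact h.inj p hp.2 q hq.2 hpq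

/-- The state of a scan that started from `G`, after `k` sets. -/
structure Fam.ScanInv (P : Finset (Fin n) → Prop) (a : Finset (Fin n) → ℝ) (α : ℝ) (i : Fin n)
    (G : Fam n) (k : ℕ) (H : Fam n) : Prop where
  sound : H.Sound a α
  le : G.len ≤ H.len
  old : ∀ q < G.len, H.set q = G.set q
  new : ∀ q < H.len, G.len ≤ q → ∃ p < k, H.set q = insert i (G.set p)
  complete : ∀ p < k, P (insert i (G.set p)) → ∃ q < H.len, H.set q = insert i (G.set p)

theorem Fam.scanInv {P : Finset (Fin n) → Prop} {a : Finset (Fin n) → ℝ} {α cap : ℝ} {i : Fin n}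
    {G : Fam n} (hv : G.Valid cap) (hs : G.Sound a α) (hi : ∀ q < G.len, ∀ j ∈ G.set q, j < i)
    (hP : ∀ T : Finset (Fin n), (T = ∅ ∨ α ≤ a T) → i ∉ T → P (insert i T) → α ≤ a (insert i T))
    (hcard : ∀ 𝒯 : Finset (Finset (Fin n)), (∀ T ∈ 𝒯, T.Nonempty ∧ α ≤ a T) →
      (𝒯.card : ℝ) + 1 < cap) (k : ℕ) (hk : k ≤ G.len) :
    Fam.ScanInv P a α i G k (G.scan P cap i k) := by
  have hiG : ∀ q < G.len, i ∉ G.set q := fun q hq h => lt_irrefl _ (hi q hq i h)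
  induction k with
  | zero => exact ⟨hs, le_rfl, fun _ _ => rfl, fun q hq h => absurd hq (not_lt.2 h),
      fun p hp => absurd hp (Nat.not_lt_zero p)⟩
  | succ k ih =>
    have ih := ih (by omega)
    have hvH := hv.scan (P := P) (i := i) k
    rw [Fam.scan]
    set H := G.scan P cap i k with hH
    have hset : H.set k = G.set k := ih.old k (by omega)
    have hlen := ih.sound.len_lt hvH hcard
    unfold Fam.extend
    rw [hset]
    split_ifs with h1
    · have hold : ∀ q < H.len, Function.update H.set H.len (insert i (G.set k)) q = H.set q :=
        fun q hq => Function.update_of_ne hq.ne _ _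
      -- An old set does not contain i, and two equal new sets have equal parents, since i can be
      -- erased.
      have hfresh : ∀ q < H.len, H.set q ≠ insert i (G.set k) := by
        intro q hq heq
        by_cases hqG : q < G.len
        · rw [ih.old q hqG] at heq
          exact hiG q hqG (heq ▸ Finset.mem_insert_self _ _)
        · obtain ⟨p, hp, hpe⟩ := ih.new q hq (by omega)
          rw [hpe] at heq
          have h2 := congrArg (fun T => T.erase i) heq
          simp only [Finset.erase_insert (hiG p (by omega)),
            Finset.erase_insert (hiG k (by omega))] at h2
          exact hp.ne (hs.inj p (by omega) k (by omega) h2)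
      refine ⟨⟨fun p hp q hq hpq => ?_, fun q hq hq0 => ?_⟩, ?_, fun q hq => ?_, fun q hq hGq => ?_,
        fun p hp hPp => ?_⟩
      · simp only at hp hq hpq
        rcases Nat.lt_succ_iff_lt_or_eq.1 hp with hp | rfl <;>
          rcases Nat.lt_succ_iff_lt_or_eq.1 hq with hq | rfl
        · rw [hold p hp, hold q hq] at hpq; exact ih.sound.inj p hp q hq hpq
        · rw [hold p hp, Function.update_self] at hpq; exact absurd hpq (hfresh p hp)
        · rw [hold q hq, Function.update_self] at hpq; exact absurd hpq.symm (hfresh q hq)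
        · rfl
      · simp only at hq ⊢
        rcases Nat.lt_succ_iff_lt_or_eq.1 hq with hq | rfl
        · rw [hold q hq]; exact ih.sound.large q hq hq0
        · rw [Function.update_self]
          exact hP _ (hs.large_or hv (by omega)) (hiG k (by omega)) h1.1
      · exact ih.le.trans (Nat.le_succ _)
      · simp only; rw [hold q (hq.trans_le ih.le)]; exact ih.old q hq
      · simp only at hq ⊢
        rcases Nat.lt_succ_iff_lt_or_eq.1 hq with hq | rfl
        · rw [hold q hq]
          obtain ⟨p, hp, h⟩ := ih.new q hq hGq
          exact ⟨p, by omega, h⟩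
        · exact ⟨k, Nat.lt_succ_self k, Function.update_self _ _ _⟩
      · rcases Nat.lt_succ_iff_lt_or_eq.1 hp with hp | rfl
        · obtain ⟨q, hq, h⟩ := ih.complete p hp hPp
          exact ⟨q, Nat.lt_succ_of_lt hq, (hold q hq).trans h⟩
        · exact ⟨H.len, Nat.lt_succ_self _, Function.update_self _ _ _⟩
    · refine ⟨ih.sound, ih.le, ih.old, fun q hq hGq => ?_, fun p hp hPp => ?_⟩
      · obtain ⟨p, hp, h⟩ := ih.new q hq hGq
        exact ⟨p, by omega, h⟩
      · rcases Nat.lt_succ_iff_lt_or_eq.1 hp with hp | rfl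
        · exact ih.complete p hp hPp
        · exact absurd ⟨hPp, hlen⟩ h1

/-- A search with accurate tests finds all sets with large coefficients. -/
theorem exists_family_set_eq {P : Finset (Fin n) → Prop} {a : Finset (Fin n) → ℝ} {α θ cap : ℝ}
    (hcap : 0 ≤ cap) (hαθ : α ≤ θ)
    (hP : ∀ T i, (T = ∅ ∨ α ≤ a T) → i ∉ T → P (insert i T) → α ≤ a (insert i T))
    (hP' : ∀ T i, (T = ∅ ∨ α ≤ a T) → i ∉ T → θ ≤ a (insert i T) → P (insert i T))
    (ha : ∀ T T' : Finset (Fin n), T.Nonempty → T ⊆ T' → a T' ≤ a T)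
    (hcard : ∀ 𝒯 : Finset (Finset (Fin n)), (∀ T ∈ 𝒯, T.Nonempty ∧ α ≤ a T) →
      (𝒯.card : ℝ) + 1 < cap) {S : Finset (Fin n)} (hS : θ ≤ a S) :
    ∃ q < (family P cap n).len, (family P cap n).set q = S := by
  suffices h : ∀ i ≤ n, (family P cap i).Sound a α ∧
      (∀ q < (family P cap i).len, ∀ j ∈ (family P cap i).set q, (j : ℕ) < i) ∧
      ∀ S : Finset (Fin n), (∀ j ∈ S, (j : ℕ) < i) → (S = ∅ ∨ θ ≤ a S) →
        ∃ q < (family P cap i).len, (family P cap i).set q = S from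
    (h n le_rfl).2.2 S (fun j _ => j.2) (Or.inr hS)
  intro i hi
  induction i with
  | zero =>
    refine ⟨⟨fun p hp q hq _ => ?_, fun q hq hq0 => ?_⟩, fun q _ j hj => ?_, fun S hS _ => ?_⟩
    · simp [family] at hp hq; omega
    · simp [family] at hq; exact absurd hq hq0
    · simp [family] at hj
    · exact ⟨0, Nat.one_pos,
        (Finset.eq_empty_of_forall_notMem fun j hj => Nat.not_lt_zero _ (hS j hj)).symm⟩
  | succ i ih =>
    obtain ⟨hs, hlt, hcomp⟩ := ih (by omega)
    have hv := family_valid P hcap i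
    have hin : i < n := by omega
    rw [family, dif_pos hin]
    set G := family P cap i with hG
    have hinv := Fam.scanInv (P := P) (i := ⟨i, hin⟩) hv hs (fun q hq j hj => hlt q hq j hj)
      (fun T => hP T ⟨i, hin⟩) hcard G.len le_rfl
    refine ⟨hinv.sound, fun q hq j hj => ?_, fun S hS hSa => ?_⟩
    · by_cases hqG : q < G.len
      · rw [hinv.old q hqG] at hj
        exact (hlt q hqG j hj).trans (Nat.lt_succ_self i)
      · obtain ⟨p, hp, h⟩ := hinv.new q hq (by omega)
        rw [h] at hj
        rcases Finset.mem_insert.1 hj with rfl | hj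
        · exact Nat.lt_succ_self i
        · exact (hlt p hp j hj).trans (Nat.lt_succ_self i)
    · by_cases hiS : (⟨i, hin⟩ : Fin n) ∈ S
      · have hSa' : θ ≤ a S := hSa.resolve_left (Finset.ne_empty_of_mem hiS)
        have hSe : insert ⟨i, hin⟩ (S.erase ⟨i, hin⟩) = S := Finset.insert_erase hiS
        -- Without its last variable, S is empty or still above the threshold by monotonicity, hence
        -- already in the family. Completeness is claimed above θ and soundness above α; between the
        -- two the tests may answer either way.
        have h1 : S.erase ⟨i, hin⟩ = ∅ ∨ θ ≤ a (S.erase ⟨i, hin⟩) := by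
          rcases (S.erase ⟨i, hin⟩).eq_empty_or_nonempty with h | h
          · exact Or.inl h
          · exact Or.inr (hSa'.trans (ha _ _ h (Finset.erase_subset _ _)))
        obtain ⟨p, hp, hpe⟩ := hcomp (S.erase ⟨i, hin⟩) (fun j hj => by
          have h1 := hS j (Finset.mem_of_mem_erase hj)
          have h2 : (j : ℕ) ≠ i := fun h => Finset.ne_of_mem_erase hj (Fin.ext h)
          omega) h1
        have hPS : P (insert ⟨i, hin⟩ (G.set p)) := by
          rw [hpe]
          refine hP' _ _ (h1.imp_right hαθ.trans) (Finset.notMem_erase _ _) ?_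
          rw [hSe]; exact hSa'
        obtain ⟨q, hq, h⟩ := hinv.complete p hp hPS
        exact ⟨q, hq, by rw [h, hpe, hSe]⟩
      · obtain ⟨q, hq, h⟩ := hcomp S (fun j hj => by
          have h1 := hS j hj
          have h2 : (j : ℕ) ≠ i := fun h => hiS (by
            have : j = ⟨i, hin⟩ := Fin.ext h
            rwa [← this])
          omega) hSa
        exact ⟨q, hq.trans_le hinv.le, (hinv.old q hq).trans h⟩

end

section

/-! ### Multiplicative weights for the absolute loss -/

/-- Weights of the experts, accumulated normalized weights, and accumulated loss. -/
structure MW where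
  /-- the weights -/
  w : ℕ → ℝ
  /-- the sums of the normalized weights -/
  avg : ℕ → ℝ
  /-- the loss so far -/
  loss : ℝ

namespace MW

/-- The total weight of the experts `0, …, Q - 1` and of an expert of constant weight `1`. -/
def total (Q : ℕ) (s : MW) : ℝ := 1 + ∑ q ∈ Finset.range Q, s.w q

/-- The prediction; the additional expert always predicts zero. -/
def pred {α : Type*} (Q : ℕ) (V : ℕ → α → ℝ) (s : MW) (x : α) : ℝ :=
  (∑ q ∈ Finset.range Q, s.w q * V q x) / s.total Q

open Classical in
/-- The signed learning rate. -/
def dir {α : Type*} (η : ℝ) (Q : ℕ) (V : ℕ → α → ℝ) (c : α → ℝ) (s : MW) (x : α) : ℝ :=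
  if s.pred Q V x ≤ c x then -η else η

/-- One step of the multiplicative weights method. -/
def step {α : Type*} (η : ℝ) (Q : ℕ) (V : ℕ → α → ℝ) (c : α → ℝ) (s : MW) (x : α) : MW where
  w q := s.w q * (1 - s.dir η Q V c x * V q x)
  avg q := s.avg q + s.w q / s.total Q
  loss := s.loss + |s.pred Q V x - c x|

/-- The initial state. -/
def init : MW := ⟨fun _ => 1, fun _ => 0, 0⟩

variable {α : Type*} {η : ℝ} {Q : ℕ} {V : ℕ → α → ℝ} {c : α → ℝ} {s : MW}

theorem total_pos (hs : ∀ q, 0 < s.w q) : 0 < s.total Q :=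
  add_pos_of_pos_of_nonneg one_pos (Finset.sum_nonneg fun q _ => (hs q).le)

theorem one_le_total (hs : ∀ q, 0 < s.w q) : 1 ≤ s.total Q :=
  le_add_of_nonneg_right (Finset.sum_nonneg fun q _ => (hs q).le)

theorem pred_mem (hs : ∀ q, 0 < s.w q) (hV : ∀ q x, 0 ≤ V q x ∧ V q x ≤ 1) (x : α) :
    0 ≤ s.pred Q V x ∧ s.pred Q V x ≤ 1 := by
  constructor
  · exact div_nonneg (Finset.sum_nonneg fun q _ => mul_nonneg (hs q).le (hV q x).1)
      (total_pos hs).le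
  · rw [pred, div_le_one (total_pos hs)]
    refine le_trans (Finset.sum_le_sum fun q _ => ?_) (le_add_of_nonneg_left zero_le_one)
    exact mul_le_of_le_one_right (hs q).le (hV q x).2

theorem abs_dir (hη : 0 ≤ η) (x : α) : |s.dir η Q V c x| = η := by
  unfold dir; split_ifs <;> simp [abs_of_nonneg hη]

theorem abs_dir_mul_le (hη : 0 ≤ η) (hV : ∀ q x, 0 ≤ V q x ∧ V q x ≤ 1) (q : ℕ) (x : α) :
    |s.dir η Q V c x * V q x| ≤ η := by
  rw [abs_mul, abs_dir hη, abs_of_nonneg (hV q x).1]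
  exact mul_le_of_le_one_right hη (hV q x).2

theorem step_w_pos (hη : 0 ≤ η) (hη2 : η ≤ 1 / 2) (hV : ∀ q x, 0 ≤ V q x ∧ V q x ≤ 1)
    (hs : ∀ q, 0 < s.w q) (x : α) (q : ℕ) : 0 < (s.step η Q V c x).w q := by
  refine mul_pos (hs q) ?_
  have := (abs_le.1 (abs_dir_mul_le (s := s) (Q := Q) (c := c) hη hV q x)).2
  linarith

/-- The potential relative to a sub-convex combination of the experts. -/
def potential {ι : Type*} (J : Finset ι) (u : ι → ℝ) (e : ι → ℕ) (Q : ℕ) (s : MW) : ℝ :=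
  Real.log (s.total Q) - ∑ j ∈ J, u j * Real.log (s.w (e j))

/-- Every weight is at most the total, and the zero expert keeps the total at least 1. The latter is
what allows coefficients u with sum below 1. -/
theorem potential_nonneg {ι : Type*} {J : Finset ι} {u : ι → ℝ} {e : ι → ℕ}
    (hu : ∀ j ∈ J, 0 ≤ u j) (hu1 : ∑ j ∈ J, u j ≤ 1) (he : ∀ j ∈ J, e j < Q)
    (hs : ∀ q, 0 < s.w q) : 0 ≤ s.potential J u e Q := by
  refine sub_nonneg.2 ?_
  calc ∑ j ∈ J, u j * Real.log (s.w (e j)) ≤ ∑ j ∈ J, u j * Real.log (s.total Q) := by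
        refine Finset.sum_le_sum fun j hj => mul_le_mul_of_nonneg_left ?_ (hu j hj)
        refine Real.log_le_log (hs _) ?_
        refine le_trans ?_ (le_add_of_nonneg_left zero_le_one)
        exact Finset.single_le_sum (f := s.w) (fun q _ => (hs q).le)
          (Finset.mem_range.2 (he j hj))
    _ = (∑ j ∈ J, u j) * Real.log (s.total Q) := by rw [Finset.sum_mul]
    _ ≤ Real.log (s.total Q) :=
        mul_le_of_le_one_left (Real.log_nonneg (one_le_total hs)) hu1

theorem log_one_sub_ge {y η : ℝ} (hη : η ≤ 1 / 2) (hy : |y| ≤ η) :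
    -y - 2 * η ^ 2 ≤ Real.log (1 - y) := by
  obtain ⟨h1, h2⟩ := abs_le.1 hy
  have hpos : 0 < 1 - y := by linarith
  refine le_trans ?_ (Real.one_sub_inv_le_log_of_pos hpos)
  have h3 : 1 - (1 - y)⁻¹ = -y - y ^ 2 / (1 - y) := by field_simp; ring
  have h4 : y ^ 2 ≤ η ^ 2 := sq_le_sq' h1 h2
  have h5 : y ^ 2 / (1 - y) ≤ 2 * η ^ 2 := by
    rw [div_le_iff₀ hpos]
    nlinarith [sq_nonneg η]
  linarith

/-- The signed rate is η times a subgradient of the absolute loss at the prediction, so the excess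
loss is bounded by a linear expression. Since the prediction is a weighted average, the total is
multiplied by exactly 1 - g · prediction; now log(1 - y) ≤ -y for the total and log(1 - y) ≥ -y -
2η² for the comparators turn that expression into a drop of the potential. -/
theorem step_potential {ι : Type*} {J : Finset ι} {u : ι → ℝ} {e : ι → ℕ}
    (hu : ∀ j ∈ J, 0 ≤ u j) (hu1 : ∑ j ∈ J, u j ≤ 1)
    (hη : 0 ≤ η) (hη2 : η ≤ 1 / 2) (hV : ∀ q x, 0 ≤ V q x ∧ V q x ≤ 1)
    (hs : ∀ q, 0 < s.w q) (x : α) :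
    η * |s.pred Q V x - c x| + (s.step η Q V c x).potential J u e Q ≤
      η * |∑ j ∈ J, u j * V (e j) x - c x| + s.potential J u e Q + 2 * η ^ 2 := by
  set g := s.dir η Q V c x with hg
  have htot : (s.step η Q V c x).total Q = s.total Q * (1 - g * s.pred Q V x) := by
    have h1 : s.total Q * s.pred Q V x = ∑ q ∈ Finset.range Q, s.w q * V q x := by
      rw [pred, mul_div_cancel₀ _ (total_pos hs).ne']
    calc (s.step η Q V c x).total Q
        = s.total Q - g * ∑ q ∈ Finset.range Q, s.w q * V q x := by
          simp only [total, step, Finset.mul_sum, mul_sub, mul_one, Finset.sum_sub_distrib,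
            ← add_sub_assoc]
          congr 1
          exact Finset.sum_congr rfl fun q _ => by rw [hg]; ring
      _ = _ := by rw [← h1]; ring
  have hp := pred_mem (Q := Q) hs hV x
  have hgabs : |g| = η := abs_dir hη x
  have hgp : |g * s.pred Q V x| ≤ η := by
    rw [abs_mul, hgabs, abs_of_nonneg hp.1]; exact mul_le_of_le_one_right hη hp.2
  have hpos : 0 < 1 - g * s.pred Q V x := by linarith [(abs_le.1 hgp).2]
  have hlogt : Real.log ((s.step η Q V c x).total Q) ≤ Real.log (s.total Q) - g * s.pred Q V x := by
    rw [htot, Real.log_mul (total_pos hs).ne' hpos.ne']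
    linarith [Real.log_le_sub_one_of_pos hpos]
  have hlogw : ∑ j ∈ J, u j * Real.log (s.w (e j)) - g * (∑ j ∈ J, u j * V (e j) x) -
      2 * η ^ 2 ≤ ∑ j ∈ J, u j * Real.log ((s.step η Q V c x).w (e j)) := by
    calc _ ≤ ∑ j ∈ J, u j * Real.log (s.w (e j)) - g * (∑ j ∈ J, u j * V (e j) x) -
          (∑ j ∈ J, u j) * (2 * η ^ 2) := by
          have : (∑ j ∈ J, u j) * (2 * η ^ 2) ≤ 2 * η ^ 2 :=
            mul_le_of_le_one_left (by positivity) hu1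
          linarith
      _ = ∑ j ∈ J, u j * (Real.log (s.w (e j)) + (-(g * V (e j) x) - 2 * η ^ 2)) := by
          rw [Finset.mul_sum, Finset.sum_mul, ← Finset.sum_sub_distrib, ← Finset.sum_sub_distrib]
          exact Finset.sum_congr rfl fun j _ => by ring
      _ ≤ _ := by
          refine Finset.sum_le_sum fun j hj => mul_le_mul_of_nonneg_left ?_ (hu j hj)
          have hb := abs_dir_mul_le (s := s) (Q := Q) (c := c) hη hV (e j) x
          have hpos' : 0 < 1 - g * V (e j) x := by linarith [(abs_le.1 hb).2]
          rw [step, Real.log_mul (hs _).ne' hpos'.ne']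
          gcongr
          exact log_one_sub_ge hη2 hb
  have hdir : η * |s.pred Q V x - c x| - η * |∑ j ∈ J, u j * V (e j) x - c x| ≤
      g * s.pred Q V x - g * ∑ j ∈ J, u j * V (e j) x := by
    have hb := neg_abs_le (∑ j ∈ J, u j * V (e j) x - c x)
    have hb' := le_abs_self (∑ j ∈ J, u j * V (e j) x - c x)
    rw [hg, dir]
    split_ifs with h
    · rw [abs_of_nonpos (by linarith : s.pred Q V x - c x ≤ 0)]
      nlinarith
    · rw [abs_of_pos (by linarith : 0 < s.pred Q V x - c x)]
      nlinarith
  unfold potential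
  linarith

/-- The regret bound. -/
theorem regret {ι : Type*} {J : Finset ι} {u : ι → ℝ} {e : ι → ℕ}
    (hu : ∀ j ∈ J, 0 ≤ u j) (hu1 : ∑ j ∈ J, u j ≤ 1) (he : ∀ j ∈ J, e j < Q)
    (hη : 0 ≤ η) (hη2 : η ≤ 1 / 2) (hV : ∀ q x, 0 ≤ V q x ∧ V q x ≤ 1)
    (l : List α) (hs : ∀ q, 0 < s.w q) :
    η * ((l.foldl (step η Q V c) s).loss - s.loss) ≤
      η * (l.map fun x => |∑ j ∈ J, u j * V (e j) x - c x|).sum + s.potential J u e Q +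
        2 * η ^ 2 * l.length := by
  induction l generalizing s with
  | nil => simpa using potential_nonneg hu hu1 he hs
  | cons x l ih =>
    have h1 := ih (s := s.step η Q V c x) (step_w_pos hη hη2 hV hs x)
    have h2 := step_potential (c := c) (e := e) (Q := Q) hu hu1 hη hη2 hV hs x
    have h3 : (s.step η Q V c x).loss = s.loss + |s.pred Q V x - c x| := rfl
    rw [h3] at h1
    simp only [List.foldl_cons, List.map_cons, List.sum_cons, List.length_cons]
    push_cast
    linarith

theorem regret_init {ι : Type*} {J : Finset ι} {u : ι → ℝ} {e : ι → ℕ}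
    (hu : ∀ j ∈ J, 0 ≤ u j) (hu1 : ∑ j ∈ J, u j ≤ 1) (he : ∀ j ∈ J, e j < Q)
    (hη : 0 ≤ η) (hη2 : η ≤ 1 / 2) (hV : ∀ q x, 0 ≤ V q x ∧ V q x ≤ 1) (l : List α) :
    η * (l.foldl (step η Q V c) init).loss ≤
      η * (l.map fun x => |∑ j ∈ J, u j * V (e j) x - c x|).sum + Real.log (Q + 1) +
        2 * η ^ 2 * l.length := by
  have := regret (c := c) (s := init) hu hu1 he hη hη2 hV l fun q => one_pos
  have hp : init.potential J u e Q = Real.log (Q + 1) := by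
    simp [potential, init, total, add_comm]
  rw [hp] at this
  simpa [init] using this

/-- The accumulated normalized weights are the coefficients of a sub-convex combination. -/
theorem foldl_avg (hη : 0 ≤ η) (hη2 : η ≤ 1 / 2) (hV : ∀ q x, 0 ≤ V q x ∧ V q x ≤ 1)
    (l : List α) (hs : ∀ q, 0 < s.w q) :
    (∀ q, s.avg q ≤ (l.foldl (step η Q V c) s).avg q) ∧
      ∑ q ∈ Finset.range Q, (l.foldl (step η Q V c) s).avg q ≤
        ∑ q ∈ Finset.range Q, s.avg q + l.length := by
  induction l generalizing s with
  | nil => simp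
  | cons x l ih =>
    obtain ⟨h1, h2⟩ := ih (step_w_pos (Q := Q) (c := c) hη hη2 hV hs x)
    simp only [List.foldl_cons, List.length_cons]
    refine ⟨fun q => le_trans ?_ (h1 q), h2.trans ?_⟩
    · exact le_add_of_nonneg_right (div_nonneg (hs q).le (total_pos hs).le)
    · have : ∑ q ∈ Finset.range Q, s.w q / s.total Q ≤ 1 := by
        rw [← Finset.sum_div, div_le_one (total_pos hs)]
        exact le_add_of_nonneg_left zero_le_one
      simp only [step, Finset.sum_add_distrib]
      push_cast
      linarith

theorem abs_pred_sub_mem (hs : ∀ q, 0 < s.w q) (hV : ∀ q x, 0 ≤ V q x ∧ V q x ≤ 1)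
    (hc : ∀ x, 0 ≤ c x ∧ c x ≤ 1) (x : α) : |s.pred Q V x - c x| ≤ 1 := by
  have h1 := pred_mem (Q := Q) hs hV x
  have h2 := hc x
  rw [abs_le]; constructor <;> linarith [h1.1, h1.2, h2.1, h2.2]

open Classical in
/-- The difference between expected and actual loss in one step. -/
def lossGap [Fintype α] (Q : ℕ) (V : ℕ → α → ℝ) (c : α → ℝ) (s : MW) (x : α) : ℝ :=
  if ∀ q, 0 < s.w q then (𝔼 y, |s.pred Q V y - c y|) - |s.pred Q V x - c x| else 0

variable [Fintype α]

/-- The concentration bound quantifies over all states, not only reachable ones; cutting `lossGap`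
off when some weight is not positive makes this bound and the zero mean hold everywhere. -/
theorem abs_lossGap_le [Nonempty α] (hV : ∀ q x, 0 ≤ V q x ∧ V q x ≤ 1)
    (hc : ∀ x, 0 ≤ c x ∧ c x ≤ 1) (s : MW) (x : α) : |s.lossGap Q V c x| ≤ 1 := by
  unfold lossGap
  split_ifs with hs
  · have h1 : 𝔼 y, |s.pred Q V y - c y| ≤ 1 := by
      refine (Finset.expect_le_expect (g := fun _ => (1 : ℝ)) fun y _ =>
        abs_pred_sub_mem hs hV hc y).trans (by simp)
    have h2 : 0 ≤ 𝔼 y, |s.pred Q V y - c y| := Finset.expect_nonneg fun y _ => abs_nonneg _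
    have h3 := abs_pred_sub_mem (Q := Q) hs hV hc x
    have h4 := abs_nonneg (s.pred Q V x - c x)
    rw [abs_le]; constructor <;> linarith
  · simp

theorem expect_lossGap [Nonempty α] (s : MW) : 𝔼 x, s.lossGap Q V c x ≤ 0 := by
  unfold lossGap
  split_ifs with hs
  · rw [Finset.expect_sub_distrib]; simp
  · simp

/-- The expected loss of the averaged hypothesis is at most the average of the actual losses, up to
the gaps. -/
theorem expect_avg_le (hη : 0 ≤ η) (hη2 : η ≤ 1 / 2) (hV : ∀ q x, 0 ≤ V q x ∧ V q x ≤ 1)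
    (l : List α) (hs : ∀ q, 0 < s.w q) :
    𝔼 x, |∑ q ∈ Finset.range Q, ((l.foldl (step η Q V c) s).avg q - s.avg q) * V q x -
        l.length * c x| ≤
      pathSum (step η Q V c) (lossGap Q V c) s l + ((l.foldl (step η Q V c) s).loss - s.loss) := by
  induction l generalizing s with
  | nil => simp [pathSum]
  | cons x l ih =>
    have h1 := ih (step_w_pos (Q := Q) (c := c) hη hη2 hV hs x)
    simp only [List.foldl_cons, List.length_cons, pathSum]
    set s1 := s.step η Q V c x with hs1
    set s' := l.foldl (step η Q V c) s1 with hs'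
    -- The increment of the accumulated normalized weights in this step is exactly the coefficient
    -- vector of the prediction, so the current loss splits off by the triangle inequality.
    have h2 : ∀ y, |∑ q ∈ Finset.range Q, (s'.avg q - s.avg q) * V q y -
        ((l.length + 1 : ℕ) : ℝ) * c y| ≤
        |s.pred Q V y - c y| + |∑ q ∈ Finset.range Q, (s'.avg q - s1.avg q) * V q y -
          l.length * c y| := by
      intro y
      refine le_trans (le_of_eq (congrArg _ ?_)) (abs_add_le _ _)
      have : s.pred Q V y = ∑ q ∈ Finset.range Q, (s1.avg q - s.avg q) * V q y := by
        rw [pred, Finset.sum_div]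
        refine Finset.sum_congr rfl fun q _ => ?_
        simp only [hs1, step]; ring
      rw [this]
      have h3 : ∑ q ∈ Finset.range Q, (s'.avg q - s.avg q) * V q y =
          ∑ q ∈ Finset.range Q, (s1.avg q - s.avg q) * V q y +
          ∑ q ∈ Finset.range Q, (s'.avg q - s1.avg q) * V q y := by
        rw [← Finset.sum_add_distrib]
        exact Finset.sum_congr rfl fun q _ => by ring
      rw [h3]; push_cast; ring
    have h4 := Finset.expect_le_expect fun y (_ : y ∈ Finset.univ) => h2 y
    rw [Finset.expect_add_distrib] at h4
    have h5 : s.lossGap Q V c x = (𝔼 y, |s.pred Q V y - c y|) - |s.pred Q V x - c x| := if_pos hs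
    have h6 : s1.loss = s.loss + |s.pred Q V x - c x| := rfl
    linarith

end MW

end

section

/-! ### One round of the learning algorithm -/

variable {n : ℕ}

/-- The empirical test for a large coefficient. -/
def coefTest (τ : ℝ) (c : Cube n → ℝ) (l : List (Cube n)) (T : Finset (Fin n)) : Prop :=
  3 / (4 * τ) * l.length ≤ (l.map fun x => c x * -chi T x).sum

/-- The family found from the examples `l`. -/
def roundFam (τ : ℝ) (c : Cube n → ℝ) (l : List (Cube n)) : Fam n :=
  family (coefTest τ c l) (2 * τ + 2) n

/-- The final state of the multiplicative weights method with the examples `l` on the family `G`. -/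
def roundMW (ε : ℝ) (c : Cube n → ℝ) (G : Fam n) (l : List (Cube n)) : MW :=
  l.foldl (MW.step (ε / 16) G.len (fun q => OR (G.set q)) c) MW.init

/-- The combination of the disjunctions in `G` with coefficients `a q / m`. -/
def famHyp (G : Fam n) (a : ℕ → ℝ) (m : ℕ) (x : Cube n) : ℝ :=
  ∑ q ∈ Finset.range G.len, a q / m * OR (G.set q) x

/-- The loss in a round with examples `l`, the first `m` of which serve to find the family. -/
def roundLoss (ε τ : ℝ) (c : Cube n → ℝ) (m : ℕ) (l : List (Cube n)) : ℝ :=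
  (roundMW ε c (roundFam τ c (l.take m)) (l.drop m)).loss

/-- The hypothesis of a round with examples `l`. -/
def roundHyp (ε τ : ℝ) (c : Cube n → ℝ) (m : ℕ) (l : List (Cube n)) : Cube n → ℝ :=
  famHyp (roundFam τ c (l.take m)) (roundMW ε c (roundFam τ c (l.take m)) (l.drop m)).avg m

theorem famHyp_mem_CV {G : Fam n} {a : ℕ → ℝ} {m : ℕ} (ha : ∀ q, 0 ≤ a q)
    (hs : ∑ q ∈ Finset.range G.len, a q ≤ m) :
    famHyp G a m ∈ CV n ∧ size (famHyp G a m) ≤ G.len := by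
  have hcov : IsCoverageOn G.len (famHyp G a m) :=
    ⟨fun u => a u / m, fun u => G.set u, fun u => div_nonneg (ha _) (Nat.cast_nonneg _),
      fun x => by rw [famHyp, Finset.sum_range]⟩
  refine ⟨⟨⟨_, hcov⟩, fun x => ⟨Finset.sum_nonneg fun q _ =>
    mul_nonneg (div_nonneg (ha _) (Nat.cast_nonneg _)) (OR_nonneg _ _), ?_⟩⟩, Nat.sInf_le hcov⟩
  calc famHyp G a m x ≤ ∑ q ∈ Finset.range G.len, a q / m :=
        Finset.sum_le_sum fun q _ => mul_le_of_le_one_right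
          (div_nonneg (ha _) (Nat.cast_nonneg _)) (OR_le_one _ _)
    _ = (∑ q ∈ Finset.range G.len, a q) / m := by rw [Finset.sum_div]
    _ ≤ 1 := div_le_one_of_le₀ hs (Nat.cast_nonneg _)

theorem l1dist_eq (f g : Cube n → ℝ) : l1dist f g = 𝔼 x, |f x - g x| := by
  rw [l1dist, Fintype.expect_eq_sum_div_card]

variable {ε s τ : ℝ} {c : Cube n → ℝ} {m ℓ : ℕ}

theorem OR_mem (S : ℕ → Finset (Fin n)) (q : ℕ) (x : Cube n) : 0 ≤ OR (S q) x ∧ OR (S q) x ≤ 1 :=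
  ⟨OR_nonneg _ _, OR_le_one _ _⟩

/-- No assumption on the quality of the sample is needed: the cap bounds the number of sets, and
each of the m steps adds normalized weights of sum at most 1. -/
theorem roundHyp_mem_CV (hε : 0 < ε) (hε1 : ε < 1) (hτ : 0 ≤ τ) (l : List (Cube n))
    (hl : l.length = m + m) :
    roundHyp ε τ c m l ∈ CV n ∧ (size (roundHyp ε τ c m l) : ℝ) ≤ 2 * τ + 3 := by
  set G := roundFam τ c (l.take m) with hG
  have h := MW.foldl_avg (Q := G.len) (V := fun q => OR (G.set q)) (c := c) (s := MW.init)
    (η := ε / 16) (by positivity) (by linarith) (OR_mem _) (l.drop m) fun q => one_pos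
  have h1 := famHyp_mem_CV (G := G) (a := (roundMW ε c G (l.drop m)).avg) (m := m)
    (fun q => h.1 q) (by
      have h0 : ∑ q ∈ Finset.range G.len, MW.init.avg q = 0 := by simp [MW.init]
      have hld : (l.drop m).length = m := by simp [hl]
      have h2 := h.2
      rw [h0, zero_add, hld] at h2
      exact h2)
  refine ⟨h1.1, (Nat.cast_le.2 h1.2).trans ?_⟩
  have := (family_valid (coefTest τ c (l.take m)) (cap := 2 * τ + 2) (by linarith) n).len_le
  exact this.trans (by linarith)

/-- An accepted hypothesis is accurate, except with small probability. -/
theorem listProb_unsound_le (hc : c ∈ CV n) (hε : 0 < ε) (hε1 : ε < 1) (hm : 0 < m) :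
    listProb (m + m) (fun l => roundLoss ε τ c m l ≤ 3 / 4 * ε * m ∧
      ε < l1dist (roundHyp ε τ c m l) c) ≤ Real.exp (-((ε / 4) ^ 2 * m / 4)) := by
  have hcc := hc.2
  -- Once the first m examples are fixed, so is the family, and the other m examples are fresh.
  -- Acceptance with a risk above ε forces a gap of more than εm - (3/4)εm between expected and
  -- actual losses.
  have key : ∀ l1 : List (Cube n), listProb m (fun l2 => ε / 4 * m ≤
      pathSum (MW.step (ε / 16) (roundFam τ c l1).len (fun q => OR ((roundFam τ c l1).set q)) c)
        (MW.lossGap (roundFam τ c l1).len (fun q => OR ((roundFam τ c l1).set q)) c) MW.init l2) ≤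
      Real.exp (-((ε / 4) ^ 2 * m / 4)) := fun l1 =>
    listProb_pathSum_ge_le _ _ (MW.abs_lossGap_le (OR_mem _) hcc)
        MW.expect_lossGap (by positivity) (by linarith) m MW.init
  refine le_trans (listProb_mono (m + m) ?_) (listProb_take_drop_le _ m m _ key)
  rintro l hl ⟨h1, h2⟩
  set G := roundFam τ c (l.take m) with hG
  have hm' : (0 : ℝ) < m := by exact_mod_cast hm
  have h3 := MW.expect_avg_le (Q := G.len) (V := fun q => OR (G.set q)) (c := c) (s := MW.init)
    (η := ε / 16) (by positivity) (by linarith) (OR_mem _) (l.drop m) fun q => one_pos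
  have h4 : 𝔼 x, |∑ q ∈ Finset.range G.len, (((l.drop m).foldl (MW.step (ε / 16) G.len
      (fun q => OR (G.set q)) c) MW.init).avg q - MW.init.avg q) * OR (G.set q) x -
        (l.drop m).length * c x| = m * l1dist (roundHyp ε τ c m l) c := by
    rw [l1dist_eq, Finset.mul_expect]
    refine Finset.expect_congr rfl fun x _ => ?_
    rw [← abs_of_pos hm', ← abs_mul, mul_sub, roundHyp, famHyp, Finset.mul_sum]
    congr 2
    · refine Finset.sum_congr rfl fun q _ => ?_
      simp only [MW.init, sub_zero]
      rw [← mul_assoc, mul_div_cancel₀ _ hm'.ne']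
      rfl
    · simp [hl]
  rw [h4] at h3
  have h5 : ((l.drop m).foldl (MW.step (ε / 16) G.len (fun q => OR (G.set q)) c) MW.init).loss -
      MW.init.loss = roundLoss ε τ c m l := by simp [MW.init, roundLoss, roundMW, hG]
  rw [h5] at h3
  have h6 := mul_lt_mul_of_pos_left h2 hm'
  linarith

/-- The sets whose coefficients are estimated if all estimates are accurate. -/
def queries (c : Cube n → ℝ) (α : ℝ) : Finset (Finset (Fin n)) :=
  (insert ∅ (Finset.univ.filter fun T => T.Nonempty ∧ α ≤ coef c T) ×ˢ Finset.univ).image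
    fun p => insert p.2 p.1

theorem le_two_mul_of_mul_le {x τ : ℝ} (hτ : 0 < τ) (h : x * (1 / τ / 2) ≤ 1) : x ≤ 2 * τ := by
  have h1 : x * (1 / τ / 2) * (2 * τ) = x := by field_simp
  nlinarith

/-- The search is adaptive, but as long as its estimates are accurate it only asks for one-variable
extensions of ∅ or of sets with a coefficient of at least 1/(2τ). This list depends on c alone, so a
union bound over it applies. -/
theorem card_queries_le (hc : c ∈ CV n) (hτ : 0 < τ) :
    ((queries c (1 / τ / 2)).card : ℝ) ≤ (1 + 2 * τ) * n := by
  obtain ⟨v, hv, -⟩ := exists_isRep hc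
  have h1 := hv.card_coef_ge (α := 1 / τ / 2)
    (Finset.univ.filter fun T => T.Nonempty ∧ 1 / τ / 2 ≤ coef c T)
    fun T hT => (Finset.mem_filter.1 hT).2
  have h2 : ((Finset.univ.filter fun T => T.Nonempty ∧ 1 / τ / 2 ≤ coef c T).card : ℝ) ≤
      2 * τ := le_two_mul_of_mul_le hτ h1
  calc ((queries c (1 / τ / 2)).card : ℝ)
      ≤ (((Finset.univ.filter fun T => T.Nonempty ∧ 1 / τ / 2 ≤ coef c T).card + 1) * n : ℕ) := by
        refine Nat.cast_le.2 (Finset.card_image_le.trans ?_)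
        rw [Finset.card_product, Finset.card_univ, Fintype.card_fin]
        exact Nat.mul_le_mul_right _ (Finset.card_insert_le _ _)
    _ ≤ (1 + 2 * τ) * n := by
        push_cast
        exact mul_le_mul_of_nonneg_right (by linarith) (Nat.cast_nonneg n)

/-- The estimate of some coefficient is inaccurate. -/
def BadEstimate (c : Cube n → ℝ) (τ : ℝ) (l : List (Cube n)) : Prop :=
  ∃ T ∈ queries c (1 / τ / 2), 1 / τ / 4 * l.length ≤
    |(l.map fun x => c x * -chi T x).sum - l.length * coef c T|

/-- The centered terms lie in [-2, 2]; halving them gives terms bounded by 1 and the deviation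
1/(8τ). The factor 2 accounts for the two tails. -/
theorem listProb_bad_coef_le (hc : c ∈ CV n) (hτ : 1 ≤ τ) {T : Finset (Fin n)}
    (m : ℕ) :
    listProb m (fun l => 1 / τ / 4 * l.length ≤
      |(l.map fun x => c x * -chi T x).sum - l.length * coef c T|) ≤
      2 * Real.exp (-((1 / τ / 8) ^ 2 * m / 4)) := by
  have hτ0 : 0 < τ := by linarith
  have hτ1 : 1 / τ ≤ 1 := by rw [div_le_one hτ0]; exact hτ
  have hτ2 : 0 < 1 / τ := by positivity
  have hbd : ∀ x, |c x * -chi T x| ≤ 1 := fun x => by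
    rw [abs_mul, abs_neg, abs_chi, mul_one, abs_of_nonneg (hc.2 x).1]; exact (hc.2 x).2
  have hmean : 𝔼 x, c x * -chi T x = coef c T := by
    simp only [mul_neg, Finset.expect_neg_distrib]; rfl
  have hcoef : |coef c T| ≤ 1 := by
    rw [← hmean]
    refine (Finset.abs_expect_le _ _).trans ?_
    exact (Finset.expect_le_expect (g := fun _ => (1 : ℝ)) fun x _ => hbd x).trans (by simp)
  have hsum : ∀ (l : List (Cube n)), (l.map fun x => (c x * -chi T x - coef c T) / 2).sum =
      ((l.map fun x => c x * -chi T x).sum - l.length * coef c T) / 2 := by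
    intro l
    induction l with
    | nil => simp
    | cons x l ih =>
      rw [List.map_cons, List.sum_cons, ih, List.map_cons, List.sum_cons, List.length_cons]
      push_cast; ring
  have hsum' : ∀ (l : List (Cube n)), (l.map fun x => -((c x * -chi T x - coef c T) / 2)).sum =
      -(((l.map fun x => c x * -chi T x).sum - l.length * coef c T) / 2) := by
    intro l
    rw [← hsum]
    induction l with
    | nil => simp
    | cons x l ih =>
      rw [List.map_cons, List.sum_cons, ih, List.map_cons, List.sum_cons]
      ring
  have hf : ∀ x, |(c x * -chi T x - coef c T) / 2| ≤ 1 := fun x => by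
    have h1 := abs_le.1 (hbd x)
    have h2 := abs_le.1 hcoef
    rw [abs_le]; constructor <;> linarith
  have hmean0 : 𝔼 x, (c x * -chi T x - coef c T) / 2 = 0 := by
    rw [← Finset.expect_div, Finset.expect_sub_distrib, hmean]; simp
  have h1 := listProb_sum_ge_le (fun x => (c x * -chi T x - coef c T) / 2) hf hmean0.le
    (a := 1 / τ / 8) (by positivity) (by linarith) m
  have h2 := listProb_sum_ge_le (fun x => -((c x * -chi T x - coef c T) / 2))
    (fun x => by rw [abs_neg]; exact hf x) (by rw [Finset.expect_neg_distrib, hmean0]; simp)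
    (a := 1 / τ / 8) (by positivity) (by linarith) m
  rw [two_mul]
  refine le_trans (le_trans (listProb_mono m fun l hl h => ?_) (listProb_or _ _ m))
    (add_le_add h1 h2)
  rw [hsum, hsum']
  rw [hl] at h ⊢
  rcases le_abs.1 h with h | h
  · left; linarith
  · right; linarith

/-- The deterministic part of completeness: accurate estimates put every comparator disjunction into
the family, and the regret bound then transfers the empirical loss of the comparator to the
algorithm. The test threshold 3/(4τ) with error 1/(4τ) separates coefficients of at least 1/τ from
those below 1/(2τ). -/
theorem roundLoss_le_of_good (hc : c ∈ CV n) (hε : 0 < ε) (hε1 : ε < 1) (hτ : 1 ≤ τ)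
    {κ : ℝ} {F : Finset (Finset (Fin n))} {v : Finset (Fin n) → ℝ} (hκ : 0 ≤ κ)
    (hv : ∀ S, 0 ≤ v S) (hκv : κ + ∑ S ∈ F, v S ≤ 1)
    (hF : ∀ S ∈ F, S.Nonempty ∧ 1 / τ ≤ coef c S) {l : List (Cube n)} (hl : l.length = m + m)
    (hm : 0 < m)
    (hest : ¬ BadEstimate c τ (l.take m))
    (hemp : ((l.drop m).map fun x => |κ + ∑ S ∈ F, v S * OR S x - c x|).sum ≤ 9 / 16 * ε * m)
    (hlog : Real.log (2 * τ + 4) ≤ ε ^ 2 / 256 * m) :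
    roundLoss ε τ c m l ≤ 3 / 4 * ε * m := by
  classical
  obtain ⟨w, hw, -⟩ := exists_isRep hc
  have hτ0 : 0 < τ := by linarith
  have hθ : 0 < 1 / τ := by positivity
  have hm' : (0 : ℝ) < m := by exact_mod_cast hm
  have hlt : (l.take m).length = m := by simp [hl]
  have hld : (l.drop m).length = m := by simp [hl]
  have hgood : ∀ T i, (T = ∅ ∨ 1 / τ / 2 ≤ coef c T) →
      |((l.take m).map fun x => c x * -chi (insert i T) x).sum - m * coef c (insert i T)| <
        1 / τ / 4 * m := by
    intro T i hT
    by_contra hcon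
    refine hest ⟨insert i T, Finset.mem_image.2 ⟨(T, i), Finset.mem_product.2
      ⟨Finset.mem_insert.2 ?_, Finset.mem_univ _⟩, rfl⟩, by rw [hlt]; exact not_lt.1 hcon⟩
    rcases T.eq_empty_or_nonempty with h | h
    · exact Or.inl h
    · exact Or.inr (Finset.mem_filter.2 ⟨Finset.mem_univ _, h, hT.resolve_left h.ne_empty⟩)
  have h34 : 3 / (4 * τ) = 3 / 4 * (1 / τ) := by field_simp
  set G := roundFam τ c (l.take m) with hG
  have hfind : ∀ S ∈ F, ∃ q < G.len, G.set q = S := by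
    intro S hS
    refine exists_family_set_eq (a := coef c) (α := 1 / τ / 2) (θ := 1 / τ) (by linarith)
      (by linarith) ?_ ?_ (fun T T' hT hTT => hw.coef_anti hT hTT) ?_ (hF S hS).2
    · intro T i hT _ hP
      have h1 := (abs_lt.1 (hgood T i hT)).2
      rw [coefTest, hlt, h34] at hP
      have : 1 / τ / 2 * m ≤ coef c (insert i T) * m := by linarith
      exact le_of_mul_le_mul_right this hm'
    · intro T i hT _ ha
      have h1 := (abs_lt.1 (hgood T i hT)).1
      rw [coefTest, hlt, h34]
      have := mul_le_mul_of_nonneg_right ha hm'.le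
      linarith
    · intro 𝒯 h𝒯
      have h1 := hw.card_coef_ge 𝒯 h𝒯
      linarith [le_two_mul_of_mul_le hτ0 h1]
  choose! e he using hfind
  have hvalid : G.Valid (2 * τ + 2) := family_valid _ (by linarith) n
  -- The index `none` carries the constant κ and points to entry 0 of the family, the empty set,
  -- whose disjunction is constantly 1.
  have hreg := MW.regret_init (Q := G.len) (V := fun q => OR (G.set q)) (c := c) (η := ε / 16)
    (J := Finset.insertNone F) (u := fun j => j.elim κ v) (e := fun j => j.elim 0 e)
    (by
      intro j _
      cases j
      · exact hκ
      · exact hv _)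
    (by simpa using hκv)
    (by
      intro j hj
      cases j with
      | none => exact hvalid.pos
      | some S => exact (he S (by simpa using hj)).1)
    (by positivity) (by linarith) (OR_mem _) (l.drop m)
  have hcomb : ∀ x, ∑ j ∈ Finset.insertNone F, (j.elim κ v : ℝ) * OR (G.set (j.elim 0 e)) x =
      κ + ∑ S ∈ F, v S * OR S x := by
    intro x
    rw [Finset.sum_insertNone]
    simp only [Option.elim, hvalid.zero, OR_empty, mul_one]
    congr 1
    exact Finset.sum_congr rfl fun S hS => by rw [(he S hS).2]
  simp only [hcomb, hld] at hreg
  have hloss : ((l.drop m).foldl (MW.step (ε / 16) G.len (fun q => OR (G.set q)) c) MW.init).loss =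
      roundLoss ε τ c m l := rfl
  rw [hloss] at hreg
  have hlen : Real.log (G.len + 1) ≤ Real.log (2 * τ + 4) :=
    Real.log_le_log (by positivity) (by linarith [hvalid.len_le])
  -- With η = ε/16: the comparator loses at most (9/16)εm, log(2τ+4)/η is at most (1/16)εm, and 2ηm
  -- is (2/16)εm; together (3/4)εm.
  have h1 : ε / 16 * roundLoss ε τ c m l ≤ ε / 16 * (3 / 4 * ε * m) := by
    have := mul_le_mul_of_nonneg_left hemp (by positivity : 0 ≤ ε / 16)
    nlinarith
  exact le_of_mul_le_mul_left h1 (by positivity)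

theorem exp_neg_three_mul_le {y : ℝ} (hy : 0 < y) (hℓ : y ≤ 2 ^ ℓ) :
    Real.exp (-(3 * ℓ)) ≤ 1 / y ^ 3 := by
  have h2 : (2 : ℝ) ^ ℓ ≤ Real.exp ℓ := by
    have := Real.add_one_le_exp (1 : ℝ)
    calc (2 : ℝ) ^ ℓ ≤ Real.exp 1 ^ ℓ := by gcongr; linarith
      _ = Real.exp ℓ := by rw [← Real.exp_nat_mul, mul_one]
  rw [Real.exp_neg, one_div]
  have h3 : Real.exp (3 * ℓ) = Real.exp ℓ ^ 3 := by rw [← Real.exp_nat_mul]; norm_num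
  rw [h3]
  gcongr
  exact hℓ.trans h2

/-- The sample size is large enough for a round with the guess `s`. -/
structure RoundParams (n : ℕ) (ε s τ : ℝ) (ℓ m : ℕ) : Prop where
  one_le_s : 1 ≤ s
  tau_eq : τ = 72 * s / ε ^ 2
  le_two_pow : (n + 2) * τ ≤ 2 ^ ℓ
  le_m : 768 * ℓ * τ ^ 2 ≤ m

namespace RoundParams

theorem seventy_two_mul_s_le (h : RoundParams n ε s τ ℓ m) (hε : 0 < ε) (hε1 : ε < 1) :
    72 * s ≤ τ := by
  rw [h.tau_eq, le_div_iff₀ (by positivity)]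
  have : ε ^ 2 ≤ 1 := pow_le_one₀ hε.le hε1.le
  nlinarith [h.one_le_s]

theorem seventy_two_le (h : RoundParams n ε s τ ℓ m) (hε : 0 < ε) (hε1 : ε < 1) : 72 ≤ τ := by
  linarith [h.seventy_two_mul_s_le hε hε1, h.one_le_s]

theorem sq_mul_le (h : RoundParams n ε s τ ℓ m) (hε : 0 < ε) (hε1 : ε < 1) :
    3072 * ℓ ≤ ε ^ 2 * m := by
  have h1 : 72 ≤ ε * τ := by
    have : ε * τ = 72 * s / ε := by rw [h.tau_eq]; field_simp
    rw [this, le_div_iff₀ hε]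
    nlinarith [h.one_le_s]
  have h2 : (72 : ℝ) ^ 2 ≤ (ε * τ) ^ 2 := by gcongr
  calc (3072 : ℝ) * ℓ ≤ 768 * ℓ * (ε * τ) ^ 2 := by nlinarith [(Nat.cast_nonneg ℓ : (0 : ℝ) ≤ ℓ)]
    _ = ε ^ 2 * (768 * ℓ * τ ^ 2) := by ring
    _ ≤ ε ^ 2 * m := by gcongr; exact h.le_m

theorem ell_pos (h : RoundParams n ε s τ ℓ m) (hε : 0 < ε) (hε1 : ε < 1) : 0 < ℓ := by
  rcases Nat.eq_zero_or_pos ℓ with h0 | h0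
  · have := h.le_two_pow
    have h1 := h.seventy_two_le hε hε1
    rw [h0, pow_zero] at this
    have : (0 : ℝ) ≤ n := Nat.cast_nonneg n
    nlinarith
  · exact h0

theorem m_pos (h : RoundParams n ε s τ ℓ m) (hε : 0 < ε) (hε1 : ε < 1) : 0 < m := by
  have h1 := h.seventy_two_le hε hε1
  have h2 : (0 : ℝ) < ℓ := by exact_mod_cast h.ell_pos hε hε1
  have : (0 : ℝ) < m := lt_of_lt_of_le (by positivity) h.le_m
  exact_mod_cast this

theorem two_mul_le (h : RoundParams n ε s τ ℓ m) (hε : 0 < ε) (hε1 : ε < 1) : 2 * τ ≤ 2 ^ ℓ := by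
  refine le_trans ?_ h.le_two_pow
  have h1 := h.seventy_two_le hε hε1
  have : (0 : ℝ) ≤ n := Nat.cast_nonneg n
  nlinarith

/-- A failure probability proportional to 1/s, so that the sum over doubled guesses converges. -/
theorem exp_le (h : RoundParams n ε s τ ℓ m) (hε : 0 < ε) (hε1 : ε < 1) :
    Real.exp (-(3 * ℓ)) ≤ 1 / (144 * s) := by
  have h1 := h.seventy_two_le hε hε1
  refine (exp_neg_three_mul_le (by positivity) (h.two_mul_le hε hε1)).trans ?_
  have h2 := h.seventy_two_mul_s_le hε hε1
  have hs := h.one_le_s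
  refine one_div_le_one_div_of_le (by positivity) ?_
  calc 144 * s ≤ 2 * τ := by linarith
    _ ≤ (2 * τ) ^ 3 := le_self_pow₀ (by linarith) (by norm_num)

theorem listProb_unsound_le (h : RoundParams n ε s τ ℓ m) (hc : c ∈ CV n) (hε : 0 < ε)
    (hε1 : ε < 1) :
    listProb (m + m) (fun l => roundLoss ε τ c m l ≤ 3 / 4 * ε * m ∧
      ε < l1dist (roundHyp ε τ c m l) c) ≤ 1 / (144 * s) := by
  refine (CoverageLearning.listProb_unsound_le hc hε hε1 (h.m_pos hε hε1)).trans
    (le_trans (Real.exp_le_exp.2 ?_) (h.exp_le hε hε1))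
  have := h.sq_mul_le hε hε1
  have h0 : (0 : ℝ) ≤ ℓ := Nat.cast_nonneg ℓ
  nlinarith

theorem log_le (h : RoundParams n ε s τ ℓ m) (hε : 0 < ε) (hε1 : ε < 1) :
    Real.log (2 * τ + 4) ≤ ε ^ 2 / 256 * m := by
  have h1 := h.seventy_two_le hε hε1
  have h2 := h.two_mul_le hε hε1
  have h3 := h.sq_mul_le hε hε1
  have h0 : (0 : ℝ) ≤ ℓ := Nat.cast_nonneg ℓ
  have hlog : Real.log (2 * τ + 4) ≤ Real.log (((2 : ℝ) ^ ℓ) ^ 2) := by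
    refine Real.log_le_log (by positivity) ?_
    calc 2 * τ + 4 ≤ (2 * τ) ^ 2 := by nlinarith
      _ ≤ _ := by gcongr
  rw [Real.log_pow, Real.log_pow] at hlog
  have hl2 : Real.log 2 ≤ 1 := by linarith [Real.log_le_sub_one_of_pos (by norm_num : (0:ℝ) < 2)]
  push_cast at hlog
  have : (ℓ : ℝ) * Real.log 2 ≤ ℓ * 1 := by gcongr
  linarith

/-- A round with a sufficiently large guess accepts, except with small probability. -/
theorem listProb_reject_le (h : RoundParams n ε s τ ℓ m) (hc : c ∈ CV n) (hε : 0 < ε)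
    (hε1 : ε < 1) (hs : sEps c ε ≤ s) :
    listProb (m + m) (fun l => ¬ roundLoss ε τ c m l ≤ 3 / 4 * ε * m) ≤ 1 / 100 := by
  obtain ⟨κ, F, v, hκ, hv, hκv, hF, hd⟩ := exists_comparator hc hε hε1 hs
  have hτ := h.seventy_two_le hε hε1
  have hτθ : ε ^ 2 / (72 * s) = 1 / τ := by rw [h.tau_eq, one_div_div]
  rw [hτθ] at hF
  have hmpos := h.m_pos hε hε1
  have hm' : (0 : ℝ) < m := by exact_mod_cast hmpos
  set f : Cube n → ℝ := fun x => |κ + ∑ S ∈ F, v S * OR S x - c x| with hf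
  have hf1 : ∀ x, 0 ≤ f x ∧ f x ≤ 1 := by
    intro x
    refine ⟨abs_nonneg _, ?_⟩
    have h0 : 0 ≤ ∑ S ∈ F, v S * OR S x :=
      Finset.sum_nonneg fun S _ => mul_nonneg (hv S) (OR_nonneg _ _)
    have h1 : ∑ S ∈ F, v S * OR S x ≤ ∑ S ∈ F, v S :=
      Finset.sum_le_sum fun S _ => mul_le_of_le_one_right (hv S) (OR_le_one _ _)
    have h2 := hc.2 x
    simp only [hf, abs_le]
    constructor <;> linarith [h2.1, h2.2]
  have hrisk0 : 0 ≤ 𝔼 x, f x := Finset.expect_nonneg fun x _ => (hf1 x).1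
  have hrisk : 𝔼 x, f x ≤ ε / 2 := hd
  have hsum : ∀ l : List (Cube n), (l.map fun x => f x - 𝔼 y, f y).sum =
      (l.map f).sum - l.length * 𝔼 y, f y := by
    intro l
    induction l with
    | nil => simp
    | cons x l ih =>
      rw [List.map_cons, List.sum_cons, ih, List.map_cons, List.sum_cons, List.length_cons]
      push_cast; ring
  -- The comparator has risk at most ε/2; a deviation of ε/16 leads to the empirical bound 9/16 · ε.
  have hB := listProb_sum_ge_le (fun x => f x - 𝔼 y, f y) (fun x => by
      have := hf1 x
      rw [abs_le]; constructor <;> linarith)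
    (by rw [Finset.expect_sub_distrib]; simp) (a := ε / 16) (by positivity) (by linarith) m
  have hy : (0 : ℝ) < (n + 2) * τ := by positivity
  have hexp := exp_neg_three_mul_le hy h.le_two_pow
  have hn : (0 : ℝ) ≤ n := Nat.cast_nonneg n
  have hℓ0 : (0 : ℝ) ≤ ℓ := Nat.cast_nonneg ℓ
  have hB' : Real.exp (-((ε / 16) ^ 2 * m / 4)) ≤ 1 / ((n + 2) * τ) ^ 3 := by
    refine le_trans (Real.exp_le_exp.2 ?_) hexp
    have := h.sq_mul_le hε hε1
    nlinarith
  -- Union bound over the queries: at most (1 + 2τ)n of them against the cube of (n + 2)τ.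
  have hA : listProb m (BadEstimate c τ) ≤ (1 + 2 * τ) * n * (2 * (1 / ((n + 2) * τ) ^ 3)) := by
    refine (listProb_exists (queries c (1 / τ / 2)) _ m).trans ?_
    calc _ ≤ ∑ T ∈ queries c (1 / τ / 2), 2 * (1 / (((n : ℝ) + 2) * τ) ^ 3) := by
          refine Finset.sum_le_sum fun T _ =>
            (listProb_bad_coef_le hc (by linarith) m).trans ?_
          refine mul_le_mul_of_nonneg_left (le_trans (Real.exp_le_exp.2 ?_) hexp) zero_le_two
          -- The origin of 768 = 3 · 4 · 8² in the sample size.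
          have h1 : 3 * ℓ ≤ (1 / τ / 8) ^ 2 * (768 * ℓ * τ ^ 2) / 4 := by
            apply le_of_eq; field_simp; ring
          have h2 : (1 / τ / 8) ^ 2 * (768 * ℓ * τ ^ 2) ≤ (1 / τ / 8) ^ 2 * m := by
            gcongr; exact h.le_m
          linarith
      _ = (queries c (1 / τ / 2)).card * (2 * (1 / (((n : ℝ) + 2) * τ) ^ 3)) := by
          rw [Finset.sum_const, nsmul_eq_mul]
      _ ≤ _ := by
          gcongr
          exact card_queries_le hc (by linarith)
  have hfin : (1 + 2 * τ) * n * (2 * (1 / ((n + 2) * τ) ^ 3)) + 1 / ((n + 2) * τ) ^ 3 ≤ 1 / 100 := by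
    have h1 : (1 + 2 * τ) * n * (2 * (1 / ((n + 2) * τ) ^ 3)) + 1 / ((n + 2) * τ) ^ 3 =
        ((1 + 2 * τ) * n * 2 + 1) / ((n + 2) * τ) ^ 3 := by field_simp
    rw [h1, div_le_div_iff₀ (by positivity) (by norm_num)]
    have h2 : ((n : ℝ) + 2) * τ ≤ ((n + 2) * τ) := le_rfl
    have h3 : (144 : ℝ) ≤ (n + 2) * τ := by nlinarith
    have h4 : (1 + 2 * τ) * n * 2 + 1 ≤ 6 * ((n + 2) * τ) := by nlinarith
    nlinarith [mul_le_mul h3 h3 (by norm_num) (by positivity)]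
  refine le_trans (le_trans (listProb_mono (m + m) (E' := fun l =>
    BadEstimate c τ (l.take m) ∨ (fun _ l2 => ε / 16 * m ≤ (l2.map fun x => f x - 𝔼 y, f y).sum)
      (l.take m) (l.drop m)) ?_) (listProb_or _ _ _)) (le_trans (add_le_add ?_ ?_) hfin)
  · intro l hl hrej
    by_contra hcon
    rw [not_or] at hcon
    refine hrej (roundLoss_le_of_good hc hε hε1 (by linarith) hκ hv hκv hF hl hmpos hcon.1 ?_
      (h.log_le hε hε1))
    have h2 := not_le.1 hcon.2
    rw [hsum] at h2
    have hld : (l.drop m).length = m := by simp [hl]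
    rw [hld] at h2
    have := mul_le_mul_of_nonneg_left hrisk hm'.le
    change ((l.drop m).map f).sum ≤ _
    linarith
  · rw [listProb_take]; exact hA
  · exact listProb_take_drop_le (fun _ l2 => ε / 16 * m ≤ (l2.map fun x => f x - 𝔼 y, f y).sum)
      m m _ fun _ => hB.trans hB'

end RoundParams

end

section

/-! ### Program logic -/

/-- Some run of `p` from `σ` ends in a configuration that satisfies `Q`. -/
def wp {n : ℕ} (c : Cube n → ℝ) (ω : ℕ → Cube n) (p : Prog) (Q : Config → Prop) (σ : Config) :
    Prop :=
  ∃ τ, Exec c ω p σ τ ∧ Q τ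

theorem write_apply {α : Type} (m : ℕ → ℕ → α) (a i : ℕ) (v : α) (b j : ℕ) :
    write m a i v b j = if b = a ∧ j = i then v else m b j := by
  unfold write
  by_cases hb : b = a
  · subst hb
    by_cases hj : j = i
    · subst hj; simp
    · simp [hj]
  · simp [hb]

section Operations

/-- The configuration after an assignment to an array of natural numbers. -/
def Config.setNat (σ : Config) (a i v k : ℕ) : Config :=
  { σ with nat := write σ.nat a i v }.tick k

/-- The configuration after an assignment to an array of real numbers. -/
def Config.setReal (σ : Config) (a i : ℕ) (v : ℝ) (k : ℕ) : Config :=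
  { σ with real := write σ.real a i v }.tick k

/-- The configuration after a request for an example. -/
def Config.takeExample {n : ℕ} (σ : Config) (c : Cube n → ℝ) (ω : ℕ → Cube n) : Config :=
  { σ with
    ex := bits (ω σ.drawn)
    label := c (ω σ.drawn)
    drawn := σ.drawn + 1 }.tick (n + 1)

/-- The configuration after a variable was written. -/
def Config.addVar (σ : Config) (v k : ℕ) : Config := { σ with term := v :: σ.term }.tick k

/-- The configuration after a disjunction was completed. -/
def Config.addTerm (σ : Config) (r : ℝ) (k : ℕ) : Config :=
  { σ with term := [], out := (σ.term, r) :: σ.out }.tick k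

variable (σ : Config) (a i v k : ℕ) (r : ℝ)

@[simp] theorem Config.nat_tick : (σ.tick k).nat = σ.nat := rfl
@[simp] theorem Config.real_tick : (σ.tick k).real = σ.real := rfl
@[simp] theorem Config.ex_tick : (σ.tick k).ex = σ.ex := rfl
@[simp] theorem Config.label_tick : (σ.tick k).label = σ.label := rfl
@[simp] theorem Config.term_tick : (σ.tick k).term = σ.term := rfl
@[simp] theorem Config.out_tick : (σ.tick k).out = σ.out := rfl
@[simp] theorem Config.drawn_tick : (σ.tick k).drawn = σ.drawn := rfl
@[simp] theorem Config.time_tick : (σ.tick k).time = σ.time + k := rfl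

@[simp] theorem Config.nat_setNat (b j : ℕ) :
    (σ.setNat a i v k).nat b j = if b = a ∧ j = i then v else σ.nat b j := write_apply _ _ _ _ _ _
@[simp] theorem Config.real_setNat : (σ.setNat a i v k).real = σ.real := rfl
@[simp] theorem Config.ex_setNat : (σ.setNat a i v k).ex = σ.ex := rfl
@[simp] theorem Config.label_setNat : (σ.setNat a i v k).label = σ.label := rfl
@[simp] theorem Config.term_setNat : (σ.setNat a i v k).term = σ.term := rfl
@[simp] theorem Config.out_setNat : (σ.setNat a i v k).out = σ.out := rfl
@[simp] theorem Config.drawn_setNat : (σ.setNat a i v k).drawn = σ.drawn := rfl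
@[simp] theorem Config.time_setNat : (σ.setNat a i v k).time = σ.time + k := rfl

@[simp] theorem Config.real_setReal (b j : ℕ) :
    (σ.setReal a i r k).real b j = if b = a ∧ j = i then r else σ.real b j := write_apply _ _ _ _ _ _
@[simp] theorem Config.nat_setReal : (σ.setReal a i r k).nat = σ.nat := rfl
@[simp] theorem Config.ex_setReal : (σ.setReal a i r k).ex = σ.ex := rfl
@[simp] theorem Config.label_setReal : (σ.setReal a i r k).label = σ.label := rfl
@[simp] theorem Config.term_setReal : (σ.setReal a i r k).term = σ.term := rfl
@[simp] theorem Config.out_setReal : (σ.setReal a i r k).out = σ.out := rfl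
@[simp] theorem Config.drawn_setReal : (σ.setReal a i r k).drawn = σ.drawn := rfl
@[simp] theorem Config.time_setReal : (σ.setReal a i r k).time = σ.time + k := rfl

section Example

variable {n : ℕ} (c : Cube n → ℝ) (ω : ℕ → Cube n)

@[simp] theorem Config.nat_takeExample : (σ.takeExample c ω).nat = σ.nat := rfl
@[simp] theorem Config.real_takeExample : (σ.takeExample c ω).real = σ.real := rfl
@[simp] theorem Config.term_takeExample : (σ.takeExample c ω).term = σ.term := rfl
@[simp] theorem Config.out_takeExample : (σ.takeExample c ω).out = σ.out := rfl
@[simp] theorem Config.ex_takeExample : (σ.takeExample c ω).ex = bits (ω σ.drawn) := rfl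
@[simp] theorem Config.label_takeExample : (σ.takeExample c ω).label = c (ω σ.drawn) := rfl
@[simp] theorem Config.drawn_takeExample : (σ.takeExample c ω).drawn = σ.drawn + 1 := rfl
@[simp] theorem Config.time_takeExample : (σ.takeExample c ω).time = σ.time + (n + 1) := rfl

end Example

@[simp] theorem Config.nat_addVar : (σ.addVar v k).nat = σ.nat := rfl
@[simp] theorem Config.real_addVar : (σ.addVar v k).real = σ.real := rfl
@[simp] theorem Config.ex_addVar : (σ.addVar v k).ex = σ.ex := rfl
@[simp] theorem Config.label_addVar : (σ.addVar v k).label = σ.label := rfl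
@[simp] theorem Config.out_addVar : (σ.addVar v k).out = σ.out := rfl
@[simp] theorem Config.drawn_addVar : (σ.addVar v k).drawn = σ.drawn := rfl
@[simp] theorem Config.term_addVar : (σ.addVar v k).term = v :: σ.term := rfl
@[simp] theorem Config.time_addVar : (σ.addVar v k).time = σ.time + k := rfl

@[simp] theorem Config.nat_addTerm : (σ.addTerm r k).nat = σ.nat := rfl
@[simp] theorem Config.real_addTerm : (σ.addTerm r k).real = σ.real := rfl
@[simp] theorem Config.ex_addTerm : (σ.addTerm r k).ex = σ.ex := rfl
@[simp] theorem Config.label_addTerm : (σ.addTerm r k).label = σ.label := rfl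
@[simp] theorem Config.drawn_addTerm : (σ.addTerm r k).drawn = σ.drawn := rfl
@[simp] theorem Config.term_addTerm : (σ.addTerm r k).term = [] := rfl
@[simp] theorem Config.out_addTerm : (σ.addTerm r k).out = (σ.term, r) :: σ.out := rfl
@[simp] theorem Config.time_addTerm : (σ.addTerm r k).time = σ.time + k := rfl

end Operations

section Evaluation

variable (σ : Config) (k : ℕ)

@[simp] theorem NExp.eval_tick (e : NExp) : e.eval (σ.tick k) = e.eval σ := by
  induction e <;> simp_all [NExp.eval]

@[simp] theorem RExp.eval_tick (r : RExp) : r.eval (σ.tick k) = r.eval σ := by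
  induction r with
  | ofNat e => simp only [RExp.eval, NExp.eval_tick]
  | load a e => simp only [RExp.eval, NExp.eval_tick]; rfl
  | label => rfl
  | _ => simp_all only [RExp.eval]

@[simp] theorem Test.holds_tick (t : Test) : t.Holds (σ.tick k) ↔ t.Holds σ := by
  induction t <;> simp_all [Test.Holds]

end Evaluation

section Rules

variable {n : ℕ} {c : Cube n → ℝ} {ω : ℕ → Cube n} {Q : Config → Prop} {σ : Config}

theorem wp_mono {p : Prog} {Q' : Config → Prop} (h : wp c ω p Q σ) (hQ : ∀ τ, Q τ → Q' τ) :
    wp c ω p Q' σ := by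
  obtain ⟨τ, h1, h2⟩ := h
  exact ⟨τ, h1, hQ τ h2⟩

theorem wp_skip : wp c ω .skip Q σ ↔ Q (σ.tick 1) :=
  ⟨fun ⟨_, h, hQ⟩ => by cases h; exact hQ, fun h => ⟨_, .skip σ, h⟩⟩

theorem wp_setN {a : ℕ} {i e : NExp} : wp c ω (.setN a i e) Q σ ↔
    Q (σ.setNat a (i.eval σ) (e.eval σ) (i.cost + e.cost + 1)) :=
  ⟨fun ⟨_, h, hQ⟩ => by cases h; exact hQ, fun h => ⟨_, .setN a i e σ, h⟩⟩

theorem wp_setR {a : ℕ} {i : NExp} {r : RExp} : wp c ω (.setR a i r) Q σ ↔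
    Q (σ.setReal a (i.eval σ) (r.eval σ) (i.cost + r.cost + 1)) :=
  ⟨fun ⟨_, h, hQ⟩ => by cases h; exact hQ, fun h => ⟨_, .setR a i r σ, h⟩⟩

theorem wp_draw : wp c ω .draw Q σ ↔ Q (σ.takeExample c ω) :=
  ⟨fun ⟨_, h, hQ⟩ => by cases h; exact hQ, fun h => ⟨_, .draw σ, h⟩⟩

theorem wp_pushVar {e : NExp} : wp c ω (.pushVar e) Q σ ↔
    Q (σ.addVar (e.eval σ) (e.cost + 1)) :=
  ⟨fun ⟨_, h, hQ⟩ => by cases h; exact hQ, fun h => ⟨_, .pushVar e σ, h⟩⟩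

theorem wp_pushTerm {r : RExp} : wp c ω (.pushTerm r) Q σ ↔
    Q (σ.addTerm (r.eval σ) (r.cost + 1)) :=
  ⟨fun ⟨_, h, hQ⟩ => by cases h; exact hQ, fun h => ⟨_, .pushTerm r σ, h⟩⟩

theorem wp_seq {p q : Prog} : wp c ω (.seq p q) Q σ ↔ wp c ω p (wp c ω q Q) σ :=
  ⟨fun ⟨_, h, hQ⟩ => by cases h with | seq _ _ _ τ _ h1 h2 => exact ⟨τ, h1, _, h2, hQ⟩,
    fun ⟨_, h1, _, h2, hQ⟩ => ⟨_, .seq _ _ _ _ _ h1 h2, hQ⟩⟩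

theorem wp_ite {t : Test} {p q : Prog} : wp c ω (.ite t p q) Q σ ↔
    (t.Holds σ → wp c ω p Q (σ.tick (t.cost + 1))) ∧
      (¬ t.Holds σ → wp c ω q Q (σ.tick (t.cost + 1))) := by
  constructor
  · rintro ⟨τ, h, hQ⟩
    cases h with
    | ite_true _ _ _ _ _ ht h => exact ⟨fun _ => ⟨τ, h, hQ⟩, fun h' => absurd ht h'⟩
    | ite_false _ _ _ _ _ ht h => exact ⟨fun h' => absurd h' ht, fun _ => ⟨τ, h, hQ⟩⟩
  · rintro ⟨h1, h2⟩
    by_cases ht : t.Holds σ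
    · obtain ⟨τ, h, hQ⟩ := h1 ht
      exact ⟨τ, .ite_true _ _ _ _ _ ht h, hQ⟩
    · obtain ⟨τ, h, hQ⟩ := h2 ht
      exact ⟨τ, .ite_false _ _ _ _ _ ht h, hQ⟩

end Rules

/-- `p` writes to the array `nat a`. -/
def Prog.writesNat (a : ℕ) : Prog → Bool
  | .setN b _ _ => a == b
  | .seq p q => p.writesNat a || q.writesNat a
  | .ite _ p q => p.writesNat a || q.writesNat a
  | .while _ p => p.writesNat a
  | _ => false

/-- `p` writes to the array `real a`. -/
def Prog.writesReal (a : ℕ) : Prog → Bool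
  | .setR b _ _ => a == b
  | .seq p q => p.writesReal a || q.writesReal a
  | .ite _ p q => p.writesReal a || q.writesReal a
  | .while _ p => p.writesReal a
  | _ => false

/-- `p` requests examples. -/
def Prog.draws : Prog → Bool
  | .draw => true
  | .seq p q => p.draws || q.draws
  | .ite _ p q => p.draws || q.draws
  | .while _ p => p.draws
  | _ => false

/-- `p` writes output. -/
def Prog.pushes : Prog → Bool
  | .pushVar _ => true
  | .pushTerm _ => true
  | .seq p q => p.pushes || q.pushes
  | .ite _ p q => p.pushes || q.pushes
  | .while _ p => p.pushes
  | _ => false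

/-- The parts of the configuration that `p` cannot change agree. -/
structure Frame (p : Prog) (σ τ : Config) : Prop where
  nat : ∀ a, p.writesNat a = false → τ.nat a = σ.nat a
  real : ∀ a, p.writesReal a = false → τ.real a = σ.real a
  ex : p.draws = false → τ.ex = σ.ex ∧ τ.label = σ.label ∧ τ.drawn = σ.drawn
  out : p.pushes = false → τ.term = σ.term ∧ τ.out = σ.out

theorem Frame.refl (p : Prog) (σ : Config) : Frame p σ σ :=
  ⟨fun _ _ => rfl, fun _ _ => rfl, fun _ => ⟨rfl, rfl, rfl⟩, fun _ => ⟨rfl, rfl⟩⟩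

theorem Frame.trans {p : Prog} {σ τ υ : Config} (h : Frame p σ τ) (h' : Frame p τ υ) :
    Frame p σ υ where
  nat a ha := (h'.nat a ha).trans (h.nat a ha)
  real a ha := (h'.real a ha).trans (h.real a ha)
  ex hd := ⟨(h'.ex hd).1.trans (h.ex hd).1, (h'.ex hd).2.1.trans (h.ex hd).2.1,
    (h'.ex hd).2.2.trans (h.ex hd).2.2⟩
  out hd := ⟨(h'.out hd).1.trans (h.out hd).1, (h'.out hd).2.trans (h.out hd).2⟩

theorem Frame.mono {p q : Prog} {σ τ : Config} (h : Frame p σ τ)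
    (hN : ∀ a, q.writesNat a = false → p.writesNat a = false)
    (hR : ∀ a, q.writesReal a = false → p.writesReal a = false)
    (hd : q.draws = false → p.draws = false) (ho : q.pushes = false → p.pushes = false) :
    Frame q σ τ where
  nat a ha := h.nat a (hN a ha)
  real a ha := h.real a (hR a ha)
  ex h' := h.ex (hd h')
  out h' := h.out (ho h')

theorem Frame.of_tick {p : Prog} {σ τ : Config} {k : ℕ} (h : Frame p (σ.tick k) τ) :
    Frame p σ τ := ⟨h.nat, h.real, h.ex, h.out⟩

/-- Which arrays can change is read off the syntax, so loop invariants only have to mention what the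
loop modifies; side conditions then hold by `rfl`. -/
theorem Exec.frame {n : ℕ} {c : Cube n → ℝ} {ω : ℕ → Cube n} {p : Prog} {σ τ : Config}
    (h : Exec c ω p σ τ) : Frame p σ τ := by
  induction h with
  | skip σ => exact ⟨fun _ _ => rfl, fun _ _ => rfl, fun _ => ⟨rfl, rfl, rfl⟩,
      fun _ => ⟨rfl, rfl⟩⟩
  | setN a i e σ =>
    refine ⟨fun b hb => ?_, fun _ _ => rfl, fun _ => ⟨rfl, rfl, rfl⟩, fun _ => ⟨rfl, rfl⟩⟩
    have hb : b ≠ a := by simpa [Prog.writesNat] using hb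
    simp [Config.tick, write, Function.update_of_ne hb]
  | setR a i r σ =>
    refine ⟨fun _ _ => rfl, fun b hb => ?_, fun _ => ⟨rfl, rfl, rfl⟩, fun _ => ⟨rfl, rfl⟩⟩
    have hb : b ≠ a := by simpa [Prog.writesReal] using hb
    simp [Config.tick, write, Function.update_of_ne hb]
  | draw σ => exact ⟨fun _ _ => rfl, fun _ _ => rfl, fun h => by simp [Prog.draws] at h,
      fun _ => ⟨rfl, rfl⟩⟩
  | pushVar e σ => exact ⟨fun _ _ => rfl, fun _ _ => rfl, fun _ => ⟨rfl, rfl, rfl⟩,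
      fun h => by simp [Prog.pushes] at h⟩
  | pushTerm r σ => exact ⟨fun _ _ => rfl, fun _ _ => rfl, fun _ => ⟨rfl, rfl, rfl⟩,
      fun h => by simp [Prog.pushes] at h⟩
  | seq p q σ τ υ _ _ h1 h2 =>
    refine (h1.mono ?_ ?_ ?_ ?_).trans (h2.mono ?_ ?_ ?_ ?_) <;>
      simp +contextual [Prog.writesNat, Prog.writesReal, Prog.draws, Prog.pushes]
  | ite_true t p q σ τ _ _ h1 =>
    refine h1.of_tick.mono ?_ ?_ ?_ ?_ <;>
      simp +contextual [Prog.writesNat, Prog.writesReal, Prog.draws, Prog.pushes]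
  | ite_false t p q σ τ _ _ h1 =>
    refine h1.of_tick.mono ?_ ?_ ?_ ?_ <;>
      simp +contextual [Prog.writesNat, Prog.writesReal, Prog.draws, Prog.pushes]
  | while_true t p σ τ υ _ _ _ h1 h2 =>
    refine Frame.trans (h1.of_tick.mono ?_ ?_ ?_ ?_) h2 <;>
      simp [Prog.writesNat, Prog.writesReal, Prog.draws, Prog.pushes]
  | while_false t p σ _ => exact ⟨fun _ _ => rfl, fun _ _ => rfl, fun _ => ⟨rfl, rfl, rfl⟩,
      fun _ => ⟨rfl, rfl⟩⟩

section Loops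

variable {n : ℕ} {c : Cube n → ℝ} {ω : ℕ → Cube n} {σ : Config}

theorem wp_frame {p : Prog} {Q : Config → Prop} (h : wp c ω p Q σ) :
    wp c ω p (fun τ => Q τ ∧ Frame p σ τ) σ := by
  obtain ⟨τ, h1, h2⟩ := h
  exact ⟨τ, h1, h2, h1.frame⟩

/-- The rule for loops, with an invariant `I` and a decreasing measure `μ`. -/
theorem wp_while {t : Test} {p : Prog} (I : Config → Prop) (μ : Config → ℕ) (B : ℕ) (h0 : I σ)
    (step : ∀ σ', Frame p σ σ' → I σ' → t.Holds σ' →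
      wp c ω p (fun τ => I τ ∧ μ τ < μ σ' ∧ τ.time ≤ σ'.time + B) σ')
    (hI : ∀ σ k, I σ → I (σ.tick k) := by exact fun _ _ h => h)
    (hμ : ∀ σ k, μ (σ.tick k) = μ σ := by exact fun _ _ => rfl) :
    wp c ω (.while t p) (fun τ => I τ ∧ ¬ t.Holds τ ∧ Frame p σ τ ∧
      τ.time ≤ σ.time + μ σ * (B + t.cost + 1) + (t.cost + 1)) σ := by
  suffices h : ∀ N σ', μ σ' ≤ N → Frame p σ σ' → I σ' → ∃ τ, Exec c ω (.while t p) σ' τ ∧ I τ ∧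
      ¬ t.Holds τ ∧ τ.time ≤ σ'.time + N * (B + t.cost + 1) + (t.cost + 1) by
    obtain ⟨τ, h1, h2, h3, h4⟩ := h (μ σ) σ le_rfl (Frame.refl _ _) h0
    exact ⟨τ, h1, h2, h3, ⟨h1.frame.nat, h1.frame.real, h1.frame.ex, h1.frame.out⟩, h4⟩
  have htick : ∀ (σ₁ σ' : Config) k, Frame p σ₁ σ' → Frame p σ₁ (σ'.tick k) :=
    fun _ _ _ h => ⟨h.nat, h.real, h.ex, h.out⟩
  intro N
  induction N with
  | zero =>
    intro σ' hN hF hIσ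
    by_cases ht : t.Holds σ'
    · obtain ⟨τ, -, -, hlt, -⟩ := step σ' hF hIσ ht
      omega
    · exact ⟨_, .while_false t p σ' ht, hI _ _ hIσ, by simpa using ht, by simp [Config.tick]⟩
  | succ N ih =>
    intro σ' hN hF hIσ
    by_cases ht : t.Holds σ'
    · obtain ⟨τ, h1, h2, hlt, htime⟩ := step (σ'.tick (t.cost + 1)) (htick _ _ _ hF) (hI _ _ hIσ)
        (by simpa using ht)
      rw [hμ] at hlt
      obtain ⟨υ, h4, h5, h6, h7⟩ := ih τ (by omega) (hF.trans h1.frame.of_tick) h2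
      refine ⟨υ, .while_true t p σ' τ υ ht h1 h4, h5, h6, h7.trans ?_⟩
      have : (σ'.tick (t.cost + 1)).time = σ'.time + (t.cost + 1) := rfl
      rw [this] at htime
      rw [Nat.succ_mul]
      omega
    · refine ⟨_, .while_false t p σ' ht, hI _ _ hIσ, by simpa using ht, ?_⟩
      simp only [Config.tick]
      omega

end Loops

end

section

/-! ### The program -/

/-- Cell `0` of the array `nat a`. -/
abbrev NV (a : ℕ) : NExp := .load a (.const 0)

/-- Cell `0` of the array `real a`. -/
abbrev RV (a : ℕ) : RExp := .load a (.const 0)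

/-- A natural number as a real constant. -/
abbrev RC (k : ℕ) : RExp := .ofNat (.const k)

/-- Assignment to cell `0` of the array `nat a`. -/
abbrev setNV (a : ℕ) (e : NExp) : Prog := .setN a (.const 0) e

/-- Assignment to cell `0` of the array `real a`. -/
abbrev setRV (a : ℕ) (r : RExp) : Prog := .setR a (.const 0) r

/-- Increment of cell `0` of the array `nat a`. -/
abbrev incr (a : ℕ) : Prog := setNV a (.add (NV a) (.const 1))

/-- The test `e < f`. -/
abbrev ltTest (e f : NExp) : Test := .not (.nle f e)

/-- Store the bits of the current example, as signs, in one row of the sample matrix. -/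
def storeBits : Prog :=
  .while (ltTest (NV 3) (NV 0))
    (.setR 7 (NV 4) (.sub (RC 1) (.ofNat (.add (.ex (NV 3)) (.ex (NV 3))))) ;;
      setNV 4 (.add (NV 4) (NV 1)) ;; incr 3)

/-- Draw the examples that serve for the estimates. -/
def storeSample : Prog :=
  setNV 2 (.const 0) ;;
  .while (ltTest (NV 2) (NV 1))
    (.draw ;; .setR 8 (NV 2) .label ;; .setR 9 (NV 2) (.sub (RC 0) (RC 1)) ;;
      setNV 4 (NV 2) ;; setNV 3 (.const 0) ;; storeBits ;; incr 2)

variable {n : ℕ} {c : Cube n → ℝ} {ω : ℕ → Cube n}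

/-- Memory layout. Natural numbers: 0 holds n (and in cell 1 the size), 1 the sample size m, 5 the
number of sets, 11 and 12 the parent and the last variable of each set, 15 the stop flag, 16 the
number of the round. Reals: 0 holds ε, 1 the guess, 2 its cap, 4 τ, 7 the signs (entry i * m + j for
coordinate i of example j), 8 the labels, 9 the rows of negated characters, 11 the weights, 12 the
accumulated normalized weights, 13 and 14 the values of nor and OR, 15 to 18 the total weight,
prediction, signed rate and loss. Natural numbers cannot be multiplied on the machine, so offsets
like i * m + j live in cells of their own and are advanced by adding m. -/
theorem wp_storeBits {σ : Config} {m j : ℕ} (hn : σ.nat 0 0 = n) (hm : σ.nat 1 0 = m) (hj : j < m)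
    (h3 : σ.nat 3 0 = 0) (h4 : σ.nat 4 0 = j) :
    wp c ω storeBits (fun τ =>
      (∀ i < n, τ.real 7 (i * m + j) = 1 - ((σ.ex i + σ.ex i : ℕ) : ℝ)) ∧
      (∀ a, (∀ i < n, a ≠ i * m + j) → τ.real 7 a = σ.real 7 a) ∧ Frame storeBits σ τ ∧
      τ.time ≤ σ.time + 50 * (n + 1)) σ := by
  refine wp_mono (wp_while (fun σ' => σ'.nat 3 0 ≤ n ∧ σ'.nat 4 0 = σ'.nat 3 0 * m + j ∧
      (∀ i < σ'.nat 3 0, σ'.real 7 (i * m + j) = 1 - ((σ.ex i + σ.ex i : ℕ) : ℝ)) ∧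
      (∀ a, (∀ i < n, a ≠ i * m + j) → σ'.real 7 a = σ.real 7 a))
    (fun σ' => n - σ'.nat 3 0) 30 ?_ ?_) ?_
  · simp [h3, h4]
  · rintro σ' hF ⟨h1, h2, h5, h6⟩ ht
    have e0 : σ'.nat 0 0 = n := by rw [hF.nat 0 rfl, hn]
    have e1 : σ'.nat 1 0 = m := by rw [hF.nat 1 rfl, hm]
    have ex : σ'.ex = σ.ex := (hF.ex rfl).1
    simp only [Test.Holds, NExp.eval, e0, not_le] at ht
    simp only [wp_seq, wp_setN, wp_setR]
    simp [NExp.eval, RExp.eval, NExp.cost, RExp.cost, ex, e1, h2]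
    refine ⟨⟨ht, by ring, fun i hi => ?_, fun a ha => ?_⟩, by omega⟩
    · by_cases hii : i = σ'.nat 3 0
      · simp [hii]
      · rw [if_neg (by omega), h5 i (by omega)]
        simp
    · rw [if_neg (ha _ ht), h6 a ha]
  · rintro τ ⟨⟨h1, h2, h5, h6⟩, ht, hF, htime⟩
    have e0 : τ.nat 0 0 = n := by rw [hF.nat 0 rfl, hn]
    simp only [Test.Holds, NExp.eval, e0, not_not] at ht
    refine ⟨fun i hi => h5 i (by omega), h6, ⟨hF.nat, hF.real, hF.ex, hF.out⟩, htime.trans ?_⟩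
    simp [Test.cost, NExp.cost, h3]
    omega

theorem wp_storeSample {σ : Config} {m : ℕ} (hn : σ.nat 0 0 = n) (hm : σ.nat 1 0 = m) :
    wp c ω storeSample (fun τ =>
      (∀ i : Fin n, ∀ j < m, τ.real 7 (i * m + j) = ((ω (σ.drawn + j) i : ℤ) : ℝ)) ∧
      (∀ j < m, τ.real 8 j = c (ω (σ.drawn + j))) ∧ (∀ j < m, τ.real 9 j = -1) ∧
      τ.drawn = σ.drawn + m ∧ Frame storeSample σ τ ∧
      τ.time ≤ σ.time + 200 * (n + 1) * (m + 1)) σ := by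
  refine wp_mono (wp_frame (Q := fun τ =>
      (∀ i : Fin n, ∀ j < m, τ.real 7 (i * m + j) = ((ω (σ.drawn + j) i : ℤ) : ℝ)) ∧
      (∀ j < m, τ.real 8 j = c (ω (σ.drawn + j))) ∧ (∀ j < m, τ.real 9 j = -1) ∧
      τ.drawn = σ.drawn + m ∧ τ.time ≤ σ.time + 200 * (n + 1) * (m + 1)) ?_)
    fun τ ⟨⟨h1, h2, h3, h4, h5⟩, h6⟩ => ⟨h1, h2, h3, h4, h6, h5⟩
  rw [storeSample, wp_seq, wp_setN]
  set σ₁ : Config := Config.setNat _ _ _ _ _ with hσ₁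
  have t1 : σ₁.time = σ.time + 3 := by simp [hσ₁, NExp.cost]
  have d1 : σ₁.drawn = σ.drawn := rfl
  have n0 : σ₁.nat 0 0 = n := by simp [hσ₁, hn]
  have n1 : σ₁.nat 1 0 = m := by simp [hσ₁, hm]
  have n2 : σ₁.nat 2 0 = 0 := by simp [hσ₁, NExp.eval]
  refine wp_mono (wp_while (fun σ' => σ'.nat 2 0 ≤ m ∧ σ'.drawn = σ.drawn + σ'.nat 2 0 ∧
      (∀ i : Fin n, ∀ j < σ'.nat 2 0, σ'.real 7 (i * m + j) = ((ω (σ.drawn + j) i : ℤ) : ℝ)) ∧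
      (∀ j < σ'.nat 2 0, σ'.real 8 j = c (ω (σ.drawn + j))) ∧
      (∀ j < σ'.nat 2 0, σ'.real 9 j = -1))
    (fun σ' => m - σ'.nat 2 0) (100 * (n + 1)) ?_ ?_) ?_
  · simp [n2, d1]
  · rintro σ' hF ⟨h1, h2, h5, h6, h7⟩ ht
    have e0 : σ'.nat 0 0 = n := by rw [hF.nat 0 rfl, n0]
    have e1 : σ'.nat 1 0 = m := by rw [hF.nat 1 rfl, n1]
    simp only [Test.Holds, NExp.eval, e1, not_le] at ht
    simp only [wp_seq, wp_setN, wp_setR, wp_draw]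
    refine wp_mono (wp_storeBits (m := m) (j := σ'.nat 2 0) ?_ ?_ ht ?_ ?_) ?_
    · simp [e0]
    · simp [e1]
    · simp [NExp.eval]
    · simp [NExp.eval]
    · rintro τ ⟨k1, k2, hFτ, ktime⟩
      have f2 := congrFun (hFτ.nat 2 rfl) 0
      have f8 := hFτ.real 8 rfl
      have f9 := hFτ.real 9 rfl
      have fd := (hFτ.ex rfl).2.2
      simp [NExp.eval, RExp.eval, NExp.cost, RExp.cost] at k1 k2 ktime f2 fd
      rw [wp_setN]
      simp [NExp.eval, NExp.cost, f2, fd]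
      refine ⟨⟨ht, by omega, fun i j hj => ?_, fun j hj => ?_, fun j hj => ?_⟩, by omega, by omega⟩
      · by_cases hjj : j = σ'.nat 2 0
        · rw [hjj, k1 i i.2, h2]
          rcases Int.units_eq_one_or (ω (σ.drawn + σ'.nat 2 0) i) with h | h <;>
            norm_num [bits, h]
        · rw [k2, h5 i j (by omega)]
          intro i' hi' heq
          -- Entries of different examples differ modulo m, so writing one example leaves the
          -- earlier ones intact.
          have := congrArg (fun a => a % m) heq
          simp only [Nat.mul_add_mod', Nat.mod_eq_of_lt ht,
            Nat.mod_eq_of_lt (show j < m by omega)] at this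
          exact hjj this
      · rw [f8]
        simp only [Config.real_setNat, Config.real_setReal, NExp.eval, RExp.eval]
        by_cases hjj : j = σ'.nat 2 0
        · simp [hjj, h2]
        · simpa [hjj] using h6 j (by omega)
      · rw [f9]
        simp only [Config.real_setNat, Config.real_setReal, NExp.eval, RExp.eval]
        by_cases hjj : j = σ'.nat 2 0
        · simp [hjj]
        · simpa [hjj] using h7 j (by omega)
  · rintro τ ⟨⟨h1, h2, h5, h6, h7⟩, ht, hF, htime⟩
    have e1 : τ.nat 1 0 = m := by rw [hF.nat 1 rfl, n1]
    simp only [Test.Holds, NExp.eval, e1, not_not] at ht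
    have e2 : τ.nat 2 0 = m := le_antisymm h1 ht
    rw [e2] at h2 h5 h6 h7
    refine ⟨h5, h6, h7, h2, htime.trans ?_⟩
    simp [Test.cost, NExp.cost, n2, t1]
    nlinarith

end

/-! ### Correctness and running time of the search program -/

section

variable {n : ℕ} {c : Cube n → ℝ} {ω : ℕ → Cube n}

/-- Compute a new row of the matrix of characters, and its inner product with the labels. -/
def estimate : Prog :=
  setRV 10 (RC 0) ;; setNV 2 (.const 0) ;;
  .while (ltTest (NV 2) (NV 1))
    (.setR 9 (.add (NV 6) (NV 2))
        (.mul (.load 9 (.add (NV 7) (NV 2))) (.load 7 (.add (NV 10) (NV 2)))) ;;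
      setRV 10 (.add (RV 10) (.mul (.load 8 (NV 2)) (.load 9 (.add (NV 6) (NV 2))))) ;; incr 2)

/-- Try to extend one set by one variable. -/
def tryExtend : Prog :=
  estimate ;;
  .ite (.and (.rle (.mul (.div (RC 3) (.mul (RC 4) (RV 4))) (.ofNat (NV 1))) (RV 10))
      (.not (.rle (.add (.mul (RC 2) (RV 4)) (RC 2)) (.ofNat (NV 5)))))
    (.setN 11 (NV 5) (NV 8) ;; .setN 12 (NV 5) (NV 3) ;; setNV 6 (.add (NV 6) (NV 1)) ;; incr 5)
    .skip

/-- Try to extend all sets by one variable. -/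
def scanSets : Prog :=
  setNV 9 (NV 5) ;; setNV 8 (.const 0) ;; setNV 7 (.const 0) ;;
  .while (ltTest (NV 8) (NV 9)) (tryExtend ;; incr 8 ;; setNV 7 (.add (NV 7) (NV 1)))

/-- Find the family of sets with large coefficients. -/
def findFamily : Prog :=
  setNV 5 (.const 1) ;; setNV 6 (NV 1) ;; setNV 3 (.const 0) ;; setNV 10 (.const 0) ;;
  .while (ltTest (NV 3) (NV 0)) (scanSets ;; incr 3 ;; setNV 10 (.add (NV 10) (NV 1)))

/-- The row of T ∪ {i} is the entrywise product of the row of T and the row of signs of i, at cost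
O(m) whatever the size of T. It is written from position bt on, behind all rows in use, so `hle`
protects the parent row. -/
theorem wp_estimate {σ : Config} {m bt bq bi : ℕ} (hm : σ.nat 1 0 = m) (hbt : σ.nat 6 0 = bt)
    (hbq : σ.nat 7 0 = bq) (hbi : σ.nat 10 0 = bi) (hle : bq + m ≤ bt) :
    wp c ω estimate (fun τ =>
      (∀ j < m, τ.real 9 (bt + j) = σ.real 9 (bq + j) * σ.real 7 (bi + j)) ∧
      (∀ a < bt, τ.real 9 a = σ.real 9 a) ∧
      τ.real 10 0 = ∑ j ∈ Finset.range m,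
        σ.real 8 j * (σ.real 9 (bq + j) * σ.real 7 (bi + j)) ∧
      Frame estimate σ τ ∧ τ.time ≤ σ.time + 100 * (m + 1)) σ := by
  refine wp_mono (wp_frame (Q := fun τ =>
      (∀ j < m, τ.real 9 (bt + j) = σ.real 9 (bq + j) * σ.real 7 (bi + j)) ∧
      (∀ a < bt, τ.real 9 a = σ.real 9 a) ∧
      τ.real 10 0 = ∑ j ∈ Finset.range m,
        σ.real 8 j * (σ.real 9 (bq + j) * σ.real 7 (bi + j)) ∧
      τ.time ≤ σ.time + 100 * (m + 1)) ?_)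
    fun τ ⟨⟨h1, h2, h3, h4⟩, h6⟩ => ⟨h1, h2, h3, h6, h4⟩
  rw [estimate, wp_seq, wp_setR, wp_seq, wp_setN]
  set σ₁ : Config := Config.setNat _ _ _ _ _ with hσ₁
  have t1 : σ₁.time = σ.time + 7 := by simp [hσ₁, NExp.cost, RExp.cost]
  have r9 : ∀ a, σ₁.real 9 a = σ.real 9 a := by simp [hσ₁]
  have r7 : ∀ a, σ₁.real 7 a = σ.real 7 a := by simp [hσ₁]
  have r8 : ∀ a, σ₁.real 8 a = σ.real 8 a := by simp [hσ₁]
  have r10 : σ₁.real 10 0 = 0 := by simp [hσ₁, NExp.eval, RExp.eval]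
  have n1 : σ₁.nat 1 0 = m := by simp [hσ₁, hm]
  have n6 : σ₁.nat 6 0 = bt := by simp [hσ₁, hbt]
  have n7 : σ₁.nat 7 0 = bq := by simp [hσ₁, hbq]
  have n10 : σ₁.nat 10 0 = bi := by simp [hσ₁, hbi]
  have n2 : σ₁.nat 2 0 = 0 := by simp [hσ₁, NExp.eval]
  refine wp_mono (wp_while (fun σ' => σ'.nat 2 0 ≤ m ∧
      (∀ j < σ'.nat 2 0, σ'.real 9 (bt + j) = σ.real 9 (bq + j) * σ.real 7 (bi + j)) ∧
      (∀ a < bt, σ'.real 9 a = σ.real 9 a) ∧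
      σ'.real 10 0 = ∑ j ∈ Finset.range (σ'.nat 2 0),
        σ.real 8 j * (σ.real 9 (bq + j) * σ.real 7 (bi + j)))
    (fun σ' => m - σ'.nat 2 0) 50 ?_ ?_) ?_
  · simp [n2, r10, r9]
  · rintro σ' hF ⟨h1, h2, h3, h4⟩ ht
    have e1 : σ'.nat 1 0 = m := by rw [hF.nat 1 rfl, n1]
    have e6 : σ'.nat 6 0 = bt := by rw [hF.nat 6 rfl, n6]
    have e7 : σ'.nat 7 0 = bq := by rw [hF.nat 7 rfl, n7]
    have e10 : σ'.nat 10 0 = bi := by rw [hF.nat 10 rfl, n10]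
    have f7 : ∀ a, σ'.real 7 a = σ.real 7 a := fun a => by rw [hF.real 7 rfl, r7]
    have f8 : ∀ a, σ'.real 8 a = σ.real 8 a := fun a => by rw [hF.real 8 rfl, r8]
    simp only [Test.Holds, NExp.eval, e1, not_le] at ht
    simp only [wp_seq, wp_setN, wp_setR]
    have h9 := h3 (bq + σ'.nat 2 0) (by omega)
    simp [NExp.eval, RExp.eval, NExp.cost, RExp.cost, e6, e7, e10, f7, f8, h9, h4]
    refine ⟨⟨ht, fun j hj => ?_, fun a ha => ?_, ?_⟩, by omega⟩
    · by_cases hjj : j = σ'.nat 2 0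
      · simp [hjj]
      · rw [if_neg hjj, h2 j (by omega)]
    · rw [if_neg (by omega), h3 a ha]
    · rw [Finset.sum_range_succ]
  · rintro τ ⟨⟨h1, h2, h3, h4⟩, ht, hF, htime⟩
    have e1 : τ.nat 1 0 = m := by rw [hF.nat 1 rfl, n1]
    simp only [Test.Holds, NExp.eval, e1, not_not] at ht
    have e2 : τ.nat 2 0 = m := le_antisymm h1 ht
    rw [e2] at h2 h4
    refine ⟨h2, h3, h4, htime.trans ?_⟩
    simp [Test.cost, NExp.cost, n2, t1]
    omega

/-- The arrays for parents and last variables describe the sets of `G`. -/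
def Encodes (σ : Config) (G : Fam n) : Prop :=
  σ.nat 5 0 = G.len ∧ ∀ q < G.len, q ≠ 0 → σ.nat 11 q < q ∧ ∃ h : σ.nat 12 q < n,
    ⟨σ.nat 12 q, h⟩ ∉ G.set (σ.nat 11 q) ∧
      G.set q = insert ⟨σ.nat 12 q, h⟩ (G.set (σ.nat 11 q))

/-- The sample, the dimension and the parameters are stored. -/
structure Stored (c : Cube n → ℝ) (x : ℕ → Cube n) (m : ℕ) (τ : ℝ) (σ : Config) : Prop where
  dim : σ.nat 0 0 = n
  size : σ.nat 1 0 = m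
  tau : σ.real 4 0 = τ
  bits : ∀ i : Fin n, ∀ j < m, σ.real 7 (i * m + j) = ((x j i : ℤ) : ℝ)
  labels : ∀ j < m, σ.real 8 j = c (x j)

theorem Stored.of_frame {x : ℕ → Cube n} {m : ℕ} {t : ℝ} {σ τ : Config} {p : Prog}
    (h : Stored c x m t σ) (hF : Frame p σ τ) (h0 : p.writesNat 0 = false)
    (h1 : p.writesNat 1 = false) (h4 : p.writesReal 4 = false) (h7 : p.writesReal 7 = false)
    (h8 : p.writesReal 8 = false) : Stored c x m t τ := by
  refine ⟨?_, ?_, ?_, ?_, ?_⟩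
  · rw [hF.nat 0 h0]; exact h.dim
  · rw [hF.nat 1 h1]; exact h.size
  · rw [hF.real 4 h4]; exact h.tau
  · rw [hF.real 7 h7]; exact h.bits
  · rw [hF.real 8 h8]; exact h.labels

/-- The rows of the matrix of characters belong to the sets of `G`. -/
structure FamState (x : ℕ → Cube n) (m : ℕ) (G : Fam n) (σ : Config) : Prop where
  enc : Encodes σ G
  base : σ.nat 6 0 = G.len * m
  rows : ∀ q < G.len, ∀ j < m, σ.real 9 (q * m + j) = -chi (G.set q) (x j)

theorem FamState.of_eq {x : ℕ → Cube n} {m : ℕ} {G : Fam n} {σ τ : Config}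
    (h : FamState x m G σ) (h5 : τ.nat 5 0 = σ.nat 5 0) (h6 : τ.nat 6 0 = σ.nat 6 0)
    (h11 : ∀ a, τ.nat 11 a = σ.nat 11 a) (h12 : ∀ a, τ.nat 12 a = σ.nat 12 a)
    (h9 : ∀ a, τ.real 9 a = σ.real 9 a) : FamState x m G τ := by
  refine ⟨⟨h5.trans h.enc.1, ?_⟩, h6.trans h.base, fun q hq j hj => (h9 _).trans (h.rows q hq j hj)⟩
  simp only [h11, h12]
  exact h.enc.2

theorem sum_map_segment (f : Cube n → ℝ) (d m : ℕ) :
    ((segment ω d m).map f).sum = ∑ j ∈ Finset.range m, f (ω (d + j)) := by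
  induction m with
  | zero => simp [segment]
  | succ m ih => rw [segment_succ, List.map_append, List.sum_append, ih, Finset.sum_range_succ]; simp

/-- The new row is always written; a passed test keeps it by advancing the end of the table, a
failed one lets the next attempt overwrite it. -/
theorem wp_tryExtend {σ : Config} {m d q i : ℕ} {t : ℝ} {G : Fam n}
    (hs : Stored c (fun j => ω (d + j)) m t σ)
    (hG : FamState (fun j => ω (d + j)) m G σ) (hq : σ.nat 8 0 = q) (hql : q < G.len)
    (hbq : σ.nat 7 0 = q * m) (hi : σ.nat 3 0 = i) (hbi : σ.nat 10 0 = i * m) (hin : i < n)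
    (hiq : ⟨i, hin⟩ ∉ G.set q) :
    wp c ω tryExtend (fun τ =>
      FamState (fun j => ω (d + j)) m
        (G.extend (coefTest t c (segment ω d m)) (2 * t + 2) ⟨i, hin⟩ q) τ ∧
      Frame tryExtend σ τ ∧ τ.time ≤ σ.time + 200 * (m + 1)) σ := by
  refine wp_mono (wp_frame (Q := fun τ =>
      FamState (fun j => ω (d + j)) m
        (G.extend (coefTest t c (segment ω d m)) (2 * t + 2) ⟨i, hin⟩ q) τ ∧
      τ.time ≤ σ.time + 200 * (m + 1)) ?_)
    fun τ ⟨⟨h1, h2⟩, h6⟩ => ⟨h1, h6, h2⟩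
  rw [tryExtend, wp_seq]
  refine wp_mono (wp_estimate hs.size hG.base hbq hbi (by nlinarith)) ?_
  rintro τ ⟨k1, k2, k3, hF, ktime⟩
  have hrow : ∀ j < m, σ.real 9 (q * m + j) * σ.real 7 (i * m + j) =
      -chi (insert ⟨i, hin⟩ (G.set q)) (ω (d + j)) := by
    intro j hj
    rw [hG.rows q hql j hj, hs.bits ⟨i, hin⟩ j hj, chi_insert hiq]
    ring
  have hsum : τ.real 10 0 = ((segment ω d m).map fun x =>
      c x * -chi (insert ⟨i, hin⟩ (G.set q)) x).sum := by
    rw [k3, sum_map_segment]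
    refine Finset.sum_congr rfl fun j hj => ?_
    have hj := Finset.mem_range.1 hj
    rw [hs.labels j hj, hrow j hj]
  have hs' : Stored c (fun j => ω (d + j)) m t τ := hs.of_frame hF rfl rfl rfl rfl rfl
  have e5 : τ.nat 5 0 = G.len := by rw [hF.nat 5 rfl]; exact hG.enc.1
  have e6 : τ.nat 6 0 = G.len * m := by rw [hF.nat 6 rfl]; exact hG.base
  have e8 : τ.nat 8 0 = q := by rw [hF.nat 8 rfl]; exact hq
  have e3 : τ.nat 3 0 = i := by rw [hF.nat 3 rfl]; exact hi
  have e11 : ∀ a, τ.nat 11 a = σ.nat 11 a := fun a => by rw [hF.nat 11 rfl]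
  have e12 : ∀ a, τ.nat 12 a = σ.nat 12 a := fun a => by rw [hF.nat 12 rfl]
  have hG' : FamState (fun j => ω (d + j)) m G τ := by
    refine ⟨⟨e5, ?_⟩, e6, fun p hp j hj => ?_⟩
    · simp only [e11, e12]; exact hG.enc.2
    · rw [k2 _ (by nlinarith), hG.rows p hp j hj]
  have htest : Test.Holds τ (.and (.rle (.mul (.div (RC 3) (.mul (RC 4) (RV 4))) (.ofNat (NV 1)))
      (RV 10)) (.not (.rle (.add (.mul (RC 2) (RV 4)) (RC 2)) (.ofNat (NV 5))))) ↔
      (coefTest t c (segment ω d m) (insert ⟨i, hin⟩ (G.set q)) ∧ (G.len : ℝ) < 2 * t + 2) := by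
    simp [Test.Holds, RExp.eval, NExp.eval, hs'.tau, hs'.size, e5, hsum, coefTest]
  rw [wp_ite, htest]
  constructor
  · intro ht
    rw [Fam.extend, if_pos ht]
    simp only [wp_seq, wp_setN]
    refine ⟨⟨⟨?_, ?_⟩, ?_, ?_⟩, ?_⟩
    · simp [NExp.eval, e5]
    · simp only
      intro p hp hp0
      rcases Nat.lt_succ_iff_lt_or_eq.1 hp with hp | rfl
      · have := hG'.enc.2 p hp hp0
        have h11 : τ.nat 11 p < G.len := this.1.trans hp
        simpa [NExp.eval, e5, hp.ne, h11.ne, Function.update_of_ne] using this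
      · simp [NExp.eval, e5, e8, e3, hql, hql.ne, Function.update_of_ne, hiq, hin]
    · simp [NExp.eval, e6, hs'.size]; ring
    · simp only
      intro p hp j hj
      rcases Nat.lt_succ_iff_lt_or_eq.1 hp with hp | rfl
      · simpa [Function.update_of_ne hp.ne] using hG'.rows p hp j hj
      · simp only [Function.update_self, Config.real_setNat, Config.real_tick]
        rw [k1 j hj, hrow j hj]
    · simp [NExp.cost, RExp.cost, Test.cost]
      omega
  · intro ht
    rw [Fam.extend, if_neg ht, wp_skip]
    refine ⟨hG'.of_eq rfl rfl (fun _ => rfl) (fun _ => rfl) fun _ => rfl, ?_⟩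
    simp [NExp.cost, RExp.cost, Test.cost]
    omega

/-- The family grows during the scan, so the loop runs up to the length saved at the start; sets
that already received i are not extended by i again. -/
theorem wp_scanSets {σ : Config} {m d i : ℕ} {t : ℝ} {G : Fam n}
    (hs : Stored c (fun j => ω (d + j)) m t σ)
    (hG : FamState (fun j => ω (d + j)) m G σ)
    (hi : σ.nat 3 0 = i) (hbi : σ.nat 10 0 = i * m) (hin : i < n)
    (hiq : ∀ q < G.len, ⟨i, hin⟩ ∉ G.set q) :
    wp c ω scanSets (fun τ =>
      FamState (fun j => ω (d + j)) m
        (G.scan (coefTest t c (segment ω d m)) (2 * t + 2) ⟨i, hin⟩ G.len) τ ∧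
      Frame scanSets σ τ ∧ τ.time ≤ σ.time + 300 * (m + 1) * (G.len + 1)) σ := by
  refine wp_mono (wp_frame (Q := fun τ =>
      FamState (fun j => ω (d + j)) m
        (G.scan (coefTest t c (segment ω d m)) (2 * t + 2) ⟨i, hin⟩ G.len) τ ∧
      τ.time ≤ σ.time + 300 * (m + 1) * (G.len + 1)) ?_)
    fun τ ⟨⟨h1, h2⟩, h6⟩ => ⟨h1, h6, h2⟩
  simp only [scanSets, wp_seq, wp_setN]
  set σ₁ : Config := Config.setNat _ 7 _ _ _ with hσ₁
  have t1 : σ₁.time = σ.time + 10 := by simp [hσ₁, NExp.cost]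
  have n9 : σ₁.nat 9 0 = G.len := by simp [hσ₁, NExp.eval, hG.enc.1]
  have n8 : σ₁.nat 8 0 = 0 := by simp [hσ₁, NExp.eval]
  have n7 : σ₁.nat 7 0 = 0 := by simp [hσ₁, NExp.eval]
  have n3 : σ₁.nat 3 0 = i := by simp [hσ₁, hi]
  have n10 : σ₁.nat 10 0 = i * m := by simp [hσ₁, hbi]
  have hs₁ : Stored c (fun j => ω (d + j)) m t σ₁ :=
    ⟨by simpa [hσ₁] using hs.dim, by simpa [hσ₁] using hs.size, hs.tau, hs.bits, hs.labels⟩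
  have hG₁ : FamState (fun j => ω (d + j)) m G σ₁ := by
    refine ⟨⟨?_, ?_⟩, ?_, hG.rows⟩
    · simpa [hσ₁] using hG.enc.1
    · have := hG.enc.2
      simpa [hσ₁] using this
    · simpa [hσ₁] using hG.base
  clear_value σ₁; clear hσ₁
  refine wp_mono (wp_while (fun σ' => σ'.nat 8 0 ≤ G.len ∧ σ'.nat 7 0 = σ'.nat 8 0 * m ∧
      FamState (fun j => ω (d + j)) m
        (G.scan (coefTest t c (segment ω d m)) (2 * t + 2) ⟨i, hin⟩ (σ'.nat 8 0)) σ')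
    (fun σ' => G.len - σ'.nat 8 0) (220 * (m + 1)) ?_ ?_ ?_) ?_
  · rw [n8, n7]; simpa [Fam.scan] using hG₁
  · rintro σ' hF ⟨h1, h2, h3⟩ ht
    have e9 : σ'.nat 9 0 = G.len := by rw [hF.nat 9 rfl, n9]
    have e3 : σ'.nat 3 0 = i := by rw [hF.nat 3 rfl, n3]
    have e10 : σ'.nat 10 0 = i * m := by rw [hF.nat 10 rfl, n10]
    have hs' := hs₁.of_frame hF rfl rfl rfl rfl rfl
    simp only [Test.Holds, NExp.eval, e9, not_le] at ht
    have hold := G.scan_old (coefTest t c (segment ω d m)) (2 * t + 2) ⟨i, hin⟩ (σ'.nat 8 0)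
    simp only [wp_seq]
    refine wp_mono (wp_tryExtend hs' h3 rfl (by omega) h2 e3 e10 hin
      (by rw [hold.2 _ ht]; exact hiq _ ht)) ?_
    rintro τ ⟨k1, hFτ, ktime⟩
    have f8 : τ.nat 8 0 = σ'.nat 8 0 := by rw [hFτ.nat 8 rfl]
    have f7 : τ.nat 7 0 = σ'.nat 8 0 * m := by rw [hFτ.nat 7 rfl, h2]
    have f1 : τ.nat 1 0 = m := by rw [hFτ.nat 1 rfl]; exact hs'.size
    have hfam : ∀ v k v' k', FamState (fun j => ω (d + j)) m (G.scan (coefTest t c (segment ω d m))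
        (2 * t + 2) ⟨i, hin⟩ (σ'.nat 8 0 + 1)) ((τ.setNat 8 0 v k).setNat 7 0 v' k') := by
      intro v k v' k'
      exact k1.of_eq (by simp) (by simp) (by simp) (by simp) (by simp)
    rw [wp_seq, wp_setN, wp_setN]
    simp [NExp.eval, NExp.cost, f8, f7, f1]
    refine ⟨⟨ht, by ring, hfam _ _ _ _⟩, by omega, by omega⟩
  · intro σ' k h
    exact ⟨h.1, h.2.1, h.2.2.of_eq rfl rfl (fun _ => rfl) (fun _ => rfl) fun _ => rfl⟩
  · rintro τ ⟨⟨h1, h2, h3⟩, ht, hF, htime⟩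
    have e9 : τ.nat 9 0 = G.len := by rw [hF.nat 9 rfl, n9]
    simp only [Test.Holds, NExp.eval, e9, not_not] at ht
    have e8 : τ.nat 8 0 = G.len := le_antisymm h1 ht
    rw [e8] at h3
    refine ⟨h3, htime.trans ?_⟩
    simp [Test.cost, NExp.cost, n8, t1]
    nlinarith

theorem wp_findFamily {σ : Config} {m d : ℕ} {t : ℝ} (ht0 : 0 ≤ t)
    (hs : Stored c (fun j => ω (d + j)) m t σ) (hrow : ∀ j < m, σ.real 9 j = -1) {K : ℕ}
    (hK : 2 * t + 3 ≤ K) :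
    wp c ω findFamily (fun τ => Encodes τ (roundFam t c (segment ω d m)) ∧
      Frame findFamily σ τ ∧ τ.time ≤ σ.time + 400 * (m + 1) * (K + 1) * (n + 1)) σ := by
  refine wp_mono (wp_frame (Q := fun τ => Encodes τ (roundFam t c (segment ω d m)) ∧
      τ.time ≤ σ.time + 400 * (m + 1) * (K + 1) * (n + 1)) ?_)
    fun τ ⟨⟨h1, h2⟩, h6⟩ => ⟨h1, h6, h2⟩
  simp only [findFamily, wp_seq, wp_setN]
  set σ₁ : Config := Config.setNat _ 10 _ _ _ with hσ₁
  have t1 : σ₁.time = σ.time + 13 := by simp [hσ₁, NExp.cost]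
  have n3 : σ₁.nat 3 0 = 0 := by simp [hσ₁, NExp.eval]
  have n10 : σ₁.nat 10 0 = 0 := by simp [hσ₁, NExp.eval]
  have hs₁ : Stored c (fun j => ω (d + j)) m t σ₁ :=
    ⟨by simpa [hσ₁] using hs.dim, by simpa [hσ₁] using hs.size, hs.tau, hs.bits, hs.labels⟩
  -- The family is hidden behind a variable to keep `simp` from unfolding it in the loop.
  obtain ⟨F, hFam⟩ : ∃ F, F = family (coefTest t c (segment ω d m)) (2 * t + 2) := ⟨_, rfl⟩
  have hG₁ : FamState (fun j => ω (d + j)) m (F 0) σ₁ := by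
    refine ⟨⟨?_, ?_⟩, ?_, ?_⟩
    · simp [hσ₁, hFam, family, NExp.eval]
    · intro q hq hq0
      simp [hFam, family] at hq
      exact absurd hq hq0
    · simp [hσ₁, hFam, family, NExp.eval, hs.size]
    · intro q hq j hj
      simp [hFam, family] at hq
      simp [hσ₁, hFam, family, hq, chi, hrow j hj]
  clear_value σ₁; clear hσ₁
  refine wp_mono (wp_while (fun σ' => σ'.nat 3 0 ≤ n ∧ σ'.nat 10 0 = σ'.nat 3 0 * m ∧
      FamState (fun j => ω (d + j)) m (F (σ'.nat 3 0)) σ')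
    (fun σ' => n - σ'.nat 3 0) (320 * (m + 1) * (K + 1)) ?_ ?_ ?_) ?_
  · rw [n3, n10]; simpa using hG₁
  · rintro σ' hF ⟨h1, h2, h3⟩ ht
    have hs' := hs₁.of_frame hF rfl rfl rfl rfl rfl
    simp only [Test.Holds, NExp.eval, hs'.dim, not_le] at ht
    simp only [wp_seq]
    refine wp_mono (wp_scanSets hs' h3 rfl h2 ht fun q hq hmem =>
      lt_irrefl _ (family_lt _ _ _ q (hFam ▸ hq) _ (hFam ▸ hmem))) ?_
    rintro τ ⟨k1, hFτ, ktime⟩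
    have hlen : (F (σ'.nat 3 0)).len ≤ K := by
      have := (family_valid (coefTest t c (segment ω d m)) (cap := 2 * t + 2) (by linarith)
        (σ'.nat 3 0)).len_le
      have h' : ((F (σ'.nat 3 0)).len : ℝ) ≤ K := by rw [hFam]; linarith
      exact_mod_cast h'
    have f3 : τ.nat 3 0 = σ'.nat 3 0 := by rw [hFτ.nat 3 rfl]
    have f10 : τ.nat 10 0 = σ'.nat 3 0 * m := by rw [hFτ.nat 10 rfl, h2]
    have f1 : τ.nat 1 0 = m := by rw [hFτ.nat 1 rfl]; exact hs'.size
    have hfam : ∀ v k v' k', FamState (fun j => ω (d + j)) m (F (σ'.nat 3 0 + 1))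
        ((τ.setNat 3 0 v k).setNat 10 0 v' k') := by
      intro v k v' k'
      have hsucc : F (σ'.nat 3 0 + 1) = (F (σ'.nat 3 0)).scan (coefTest t c (segment ω d m))
          (2 * t + 2) ⟨σ'.nat 3 0, ht⟩ (F (σ'.nat 3 0)).len := by
        rw [hFam, family, dif_pos ht]
      rw [hsucc]
      exact k1.of_eq (by simp) (by simp) (by simp) (by simp) (by simp)
    rw [wp_seq, wp_setN, wp_setN]
    simp [NExp.eval, NExp.cost, f3, f10, f1]
    refine ⟨⟨ht, by ring, hfam _ _ _ _⟩, by omega, ?_⟩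
    have h300 : 300 * (m + 1) * ((F (σ'.nat 3 0)).len + 1) ≤ 300 * (m + 1) * (K + 1) := by gcongr
    have hP : 1 ≤ (m + 1) * (K + 1) := Nat.succ_le_of_lt (by positivity)
    rw [mul_assoc 300 (m + 1) (K + 1)] at h300
    rw [mul_assoc 320]
    omega
  · intro σ' k h
    exact ⟨h.1, h.2.1, h.2.2.of_eq rfl rfl (fun _ => rfl) (fun _ => rfl) fun _ => rfl⟩
  · rintro τ ⟨⟨h1, h2, h3⟩, ht, hF, htime⟩
    have hs' := hs₁.of_frame hF rfl rfl rfl rfl rfl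
    simp only [Test.Holds, NExp.eval, hs'.dim, not_not] at ht
    have e3 : τ.nat 3 0 = n := le_antisymm h1 ht
    rw [e3] at h3
    refine ⟨by rw [roundFam, ← hFam]; exact h3.enc, htime.trans ?_⟩
    simp [Test.cost, NExp.cost, n3, t1]
    have hP : 1 ≤ (m + 1) * (K + 1) := Nat.succ_le_of_lt (by positivity)
    rw [mul_assoc 320, mul_assoc 400]
    generalize (m + 1) * (K + 1) = P at hP
    clear * - hP
    nlinarith [Nat.mul_le_mul_left n hP]

end

/-! ### Correctness and running time of the multiplicative weights program -/

section

variable {n : ℕ} {c : Cube n → ℝ} {ω : ℕ → Cube n}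

/-- Initialize the multiplicative weights method. -/
def initWeights : Prog :=
  setRV 18 (RC 0) ;; setRV 13 (RC 1) ;; setRV 14 (RC 1) ;; setNV 13 (.const 0) ;;
    setNV 8 (.const 0) ;;
    .while (ltTest (NV 8) (NV 5)) (.setR 11 (NV 8) (RC 1) ;; .setR 12 (NV 8) (RC 0) ;; incr 8)

/-- Evaluate the disjunctions on the current example, and sum up weights and predictions. -/
def evalSets : Prog :=
  setRV 15 (.add (RC 1) (RV 11)) ;; setRV 16 (RV 11) ;; setNV 8 (.const 1) ;;
  .while (ltTest (NV 8) (NV 5))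
    (.setR 13 (NV 8) (.mul (.load 13 (.load 11 (NV 8)))
        (.sub (RC 1) (.ofNat (.ex (.load 12 (NV 8)))))) ;;
      .setR 14 (NV 8) (.sub (RC 1) (.load 13 (NV 8))) ;;
      setRV 15 (.add (RV 15) (.load 11 (NV 8))) ;;
      setRV 16 (.add (RV 16) (.mul (.load 11 (NV 8)) (.load 14 (NV 8)))) ;; incr 8)

/-- Update the weights. -/
def reweight : Prog :=
  setNV 8 (.const 0) ;;
  .while (ltTest (NV 8) (NV 5))
    (.setR 12 (NV 8) (.add (.load 12 (NV 8)) (.div (.load 11 (NV 8)) (RV 15))) ;;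
      .setR 11 (NV 8) (.mul (.load 11 (NV 8)) (.sub (RC 1) (.mul (RV 17) (.load 14 (NV 8))))) ;;
      incr 8)

/-- Predict, compare the prediction with the label, and update the weights. -/
def learnStep : Prog :=
  evalSets ;; setRV 16 (.div (RV 16) (RV 15)) ;;
  .ite (.rle (RV 16) .label)
    (setRV 18 (.add (RV 18) (.sub .label (RV 16))) ;; setRV 17 (.sub (RC 0) (.div (RV 0) (RC 16))))
    (setRV 18 (.add (RV 18) (.sub (RV 16) .label)) ;; setRV 17 (.div (RV 0) (RC 16))) ;;
  reweight

/-- The multiplicative weights method. -/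
def learnWeights : Prog :=
  initWeights ;; .while (ltTest (NV 13) (NV 1)) (.draw ;; learnStep ;; incr 13)

theorem Encodes.of_frame {G : Fam n} {σ τ : Config} {p : Prog} (h : Encodes σ G)
    (hF : Frame p σ τ) (h5 : p.writesNat 5 = false) (h11 : p.writesNat 11 = false)
    (h12 : p.writesNat 12 = false) : Encodes τ G := by
  unfold Encodes
  rw [hF.nat 5 h5, hF.nat 11 h11, hF.nat 12 h12]
  exact h

theorem wp_initWeights {σ : Config} {Q : ℕ} (h5 : σ.nat 5 0 = Q) :
    wp c ω initWeights (fun τ => (∀ q < Q, τ.real 11 q = 1) ∧ (∀ q < Q, τ.real 12 q = 0) ∧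
      τ.real 18 0 = 0 ∧ τ.real 13 0 = 1 ∧ τ.real 14 0 = 1 ∧ τ.nat 13 0 = 0 ∧
      Frame initWeights σ τ ∧ τ.time ≤ σ.time + 50 * (Q + 1)) σ := by
  refine wp_mono (wp_frame (Q := fun τ => (∀ q < Q, τ.real 11 q = 1) ∧ (∀ q < Q, τ.real 12 q = 0) ∧
      τ.real 18 0 = 0 ∧ τ.real 13 0 = 1 ∧ τ.real 14 0 = 1 ∧ τ.nat 13 0 = 0 ∧
      τ.time ≤ σ.time + 50 * (Q + 1)) ?_)
    fun τ ⟨⟨h1, h2, h3, h4, h5, h6, h7⟩, h8⟩ => ⟨h1, h2, h3, h4, h5, h6, h8, h7⟩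
  simp only [initWeights, wp_seq, wp_setN, wp_setR]
  set σ₁ : Config := Config.setNat _ 8 _ _ _ with hσ₁
  have t1 : σ₁.time = σ.time + 18 := by simp [hσ₁, NExp.cost, RExp.cost]
  have n5 : σ₁.nat 5 0 = Q := by simp [hσ₁, h5]
  have n8 : σ₁.nat 8 0 = 0 := by simp [hσ₁, NExp.eval]
  have n13 : σ₁.nat 13 0 = 0 := by simp [hσ₁, NExp.eval]
  have r18 : σ₁.real 18 0 = 0 := by simp [hσ₁, NExp.eval, RExp.eval]
  have r13 : σ₁.real 13 0 = 1 := by simp [hσ₁, NExp.eval, RExp.eval]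
  have r14 : σ₁.real 14 0 = 1 := by simp [hσ₁, NExp.eval, RExp.eval]
  clear_value σ₁; clear hσ₁
  refine wp_mono (wp_while (fun σ' => σ'.nat 8 0 ≤ Q ∧ (∀ q < σ'.nat 8 0, σ'.real 11 q = 1) ∧
      (∀ q < σ'.nat 8 0, σ'.real 12 q = 0)) (fun σ' => Q - σ'.nat 8 0) 30 ?_ ?_) ?_
  · simp [n8]
  · rintro σ' hF ⟨h1, h2, h3⟩ ht
    have e5 : σ'.nat 5 0 = Q := by rw [hF.nat 5 rfl, n5]
    simp only [Test.Holds, NExp.eval, e5, not_le] at ht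
    simp only [wp_seq, wp_setN, wp_setR]
    simp [NExp.eval, RExp.eval, NExp.cost, RExp.cost]
    refine ⟨⟨ht, fun q hq hne => h2 q (by omega), fun q hq hne => h3 q (by omega)⟩, by omega⟩
  · rintro τ ⟨⟨h1, h2, h3⟩, ht, hF, htime⟩
    have e5 : τ.nat 5 0 = Q := by rw [hF.nat 5 rfl, n5]
    simp only [Test.Holds, NExp.eval, e5, not_not] at ht
    have e8 : τ.nat 8 0 = Q := le_antisymm h1 ht
    rw [e8] at h2 h3
    refine ⟨h2, h3, by rw [hF.real 18 rfl, r18], by rw [hF.real 13 rfl, r13],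
      by rw [hF.real 14 rfl, r14], by rw [hF.nat 13 rfl, n13], htime.trans ?_⟩
    simp [Test.cost, NExp.cost, n8, t1]
    omega

theorem one_sub_bits (x : Cube n) {i : ℕ} (hi : i < n) :
    1 - (bits x i : ℝ) = (1 + ((x ⟨i, hi⟩ : ℤ) : ℝ)) / 2 := by
  rcases Int.units_eq_one_or (x ⟨i, hi⟩) with h | h <;> norm_num [bits, hi, h]

/-- Parents come before their children, so nor of each set is nor of the parent times one factor 1 -
bit. The loop starts at 1: entry 0 is the empty set, for which both nor and OR are 1, and 1 - nor
would give the wrong value of OR. -/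
theorem wp_evalSets {σ : Config} {G : Fam n} {cap : ℝ} {x : Cube n} (hG : Encodes σ G)
    (hv : G.Valid cap) (hx : σ.ex = bits x) (h13 : σ.real 13 0 = 1) (h14 : σ.real 14 0 = 1) :
    wp c ω evalSets (fun τ => (∀ q < G.len, τ.real 14 q = OR (G.set q) x) ∧
      τ.real 15 0 = 1 + ∑ q ∈ Finset.range G.len, σ.real 11 q ∧
      τ.real 16 0 = ∑ q ∈ Finset.range G.len, σ.real 11 q * OR (G.set q) x ∧
      τ.real 13 0 = 1 ∧ Frame evalSets σ τ ∧ τ.time ≤ σ.time + 100 * (G.len + 1)) σ := by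
  refine wp_mono (wp_frame (Q := fun τ => (∀ q < G.len, τ.real 14 q = OR (G.set q) x) ∧
      τ.real 15 0 = 1 + ∑ q ∈ Finset.range G.len, σ.real 11 q ∧
      τ.real 16 0 = ∑ q ∈ Finset.range G.len, σ.real 11 q * OR (G.set q) x ∧
      τ.real 13 0 = 1 ∧ τ.time ≤ σ.time + 100 * (G.len + 1)) ?_)
    fun τ ⟨⟨h1, h2, h3, h4, h5⟩, h8⟩ => ⟨h1, h2, h3, h4, h8, h5⟩
  simp only [evalSets, wp_seq, wp_setN, wp_setR]
  set σ₁ : Config := Config.setNat _ 8 _ _ _ with hσ₁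
  have t1 : σ₁.time = σ.time + 14 := by simp [hσ₁, NExp.cost, RExp.cost]
  have hG₁ : Encodes σ₁ G := by
    have := hG.2
    exact ⟨by simp [hσ₁, hG.1], by simpa [hσ₁] using this⟩
  have n8 : σ₁.nat 8 0 = 1 := by simp [hσ₁, NExp.eval]
  have r11 : ∀ q, σ₁.real 11 q = σ.real 11 q := by simp [hσ₁]
  have r13 : σ₁.real 13 0 = 1 := by simp [hσ₁, h13]
  have r14 : σ₁.real 14 0 = 1 := by simp [hσ₁, h14]
  have r15 : σ₁.real 15 0 = 1 + σ.real 11 0 := by simp [hσ₁, NExp.eval, RExp.eval]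
  have r16 : σ₁.real 16 0 = σ.real 11 0 := by simp [hσ₁, NExp.eval, RExp.eval]
  have hx₁ : σ₁.ex = bits x := hx
  clear_value σ₁; clear hσ₁
  refine wp_mono (wp_while (fun σ' => 1 ≤ σ'.nat 8 0 ∧ σ'.nat 8 0 ≤ G.len ∧
      (∀ q < σ'.nat 8 0, σ'.real 13 q = nor (G.set q) x) ∧
      (∀ q < σ'.nat 8 0, σ'.real 14 q = OR (G.set q) x) ∧
      σ'.real 15 0 = 1 + ∑ q ∈ Finset.range (σ'.nat 8 0), σ.real 11 q ∧
      σ'.real 16 0 = ∑ q ∈ Finset.range (σ'.nat 8 0), σ.real 11 q * OR (G.set q) x)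
      (fun σ' => G.len - σ'.nat 8 0) 70 ?_ ?_) ?_
  · rw [n8]
    have hpos := hv.pos
    simp [r15, r16, r13, r14, hv.zero]
    omega
  · rintro σ' hF ⟨h0, h1, h2, h3, h4, h5⟩ ht
    have hG' := hG₁.of_frame hF rfl rfl rfl
    have f11 : ∀ q, σ'.real 11 q = σ.real 11 q := fun q => by rw [hF.real 11 rfl, r11]
    have hx' : σ'.ex = bits x := by rw [(hF.ex rfl).1, hx₁]
    simp only [Test.Holds, NExp.eval, hG'.1, not_le] at ht
    obtain ⟨hp, hvn, hnot, hset⟩ := hG'.2 _ ht (by omega)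
    have hnor : nor (G.set (σ'.nat 11 (σ'.nat 8 0))) x *
        (1 - (bits x (σ'.nat 12 (σ'.nat 8 0)) : ℝ)) = nor (G.set (σ'.nat 8 0)) x := by
      rw [one_sub_bits x hvn, hset, nor_insert hnot]; ring
    have hor : 1 - nor (G.set (σ'.nat 8 0)) x = OR (G.set (σ'.nat 8 0)) x :=
      (OR_of_nonempty (hv.nonempty _ ht (by omega)) x).symm
    simp only [wp_seq, wp_setN, wp_setR]
    simp [NExp.eval, RExp.eval, NExp.cost, RExp.cost, f11, hx', h2 _ hp, hnor, hor, h4, h5]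
    refine ⟨⟨ht, fun q hq => ?_, fun q hq => ?_, ?_, ?_⟩, by omega⟩
    · split_ifs with hqq
      · rw [hqq]
      · exact h2 q (by omega)
    · split_ifs with hqq
      · rw [hqq]
      · exact h3 q (by omega)
    · rw [Finset.sum_range_succ]; ring
    · rw [Finset.sum_range_succ]
  · rintro τ ⟨⟨h0, h1, h2, h3, h4, h5⟩, ht, hF, htime⟩
    have hG' := hG₁.of_frame hF rfl rfl rfl
    simp only [Test.Holds, NExp.eval, hG'.1, not_not] at ht
    have e8 : τ.nat 8 0 = G.len := le_antisymm h1 ht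
    have h20 := h2 0 (by omega)
    rw [hv.zero, nor_empty] at h20
    rw [e8] at h3 h4 h5
    refine ⟨h3, h4, h5, h20, htime.trans ?_⟩
    simp [Test.cost, NExp.cost, n8, t1]
    have : (G.len - 1) * 77 ≤ G.len * 77 := Nat.mul_le_mul_right _ (Nat.sub_le _ _)
    omega

theorem wp_reweight {σ : Config} {Q : ℕ} (h5 : σ.nat 5 0 = Q) :
    wp c ω reweight (fun τ =>
      (∀ q < Q, τ.real 12 q = σ.real 12 q + σ.real 11 q / σ.real 15 0) ∧
      (∀ q < Q, τ.real 11 q = σ.real 11 q * (1 - σ.real 17 0 * σ.real 14 q)) ∧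
      Frame reweight σ τ ∧ τ.time ≤ σ.time + 60 * (Q + 1)) σ := by
  refine wp_mono (wp_frame (Q := fun τ =>
      (∀ q < Q, τ.real 12 q = σ.real 12 q + σ.real 11 q / σ.real 15 0) ∧
      (∀ q < Q, τ.real 11 q = σ.real 11 q * (1 - σ.real 17 0 * σ.real 14 q)) ∧
      τ.time ≤ σ.time + 60 * (Q + 1)) ?_)
    fun τ ⟨⟨h1, h2, h3⟩, h4⟩ => ⟨h1, h2, h4, h3⟩
  simp only [reweight, wp_seq, wp_setN]
  set σ₁ : Config := Config.setNat _ 8 _ _ _ with hσ₁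
  have t1 : σ₁.time = σ.time + 3 := by simp [hσ₁, NExp.cost]
  have n5 : σ₁.nat 5 0 = Q := by simp [hσ₁, h5]
  have n8 : σ₁.nat 8 0 = 0 := by simp [hσ₁, NExp.eval]
  have hr : σ₁.real = σ.real := rfl
  clear_value σ₁; clear hσ₁
  refine wp_mono (wp_while (fun σ' => σ'.nat 8 0 ≤ Q ∧
      (∀ q < σ'.nat 8 0, σ'.real 12 q = σ.real 12 q + σ.real 11 q / σ.real 15 0) ∧
      (∀ q < σ'.nat 8 0, σ'.real 11 q = σ.real 11 q * (1 - σ.real 17 0 * σ.real 14 q)) ∧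
      (∀ q, σ'.nat 8 0 ≤ q → σ'.real 12 q = σ.real 12 q ∧ σ'.real 11 q = σ.real 11 q))
      (fun σ' => Q - σ'.nat 8 0) 40 ?_ ?_) ?_
  · simp [n8, hr]
  · rintro σ' hF ⟨h1, h2, h3, h4⟩ ht
    have e5 : σ'.nat 5 0 = Q := by rw [hF.nat 5 rfl, n5]
    have e14 : ∀ q, σ'.real 14 q = σ.real 14 q := fun q => by rw [hF.real 14 rfl, hr]
    have e15 : ∀ q, σ'.real 15 q = σ.real 15 q := fun q => by rw [hF.real 15 rfl, hr]
    have e17 : ∀ q, σ'.real 17 q = σ.real 17 q := fun q => by rw [hF.real 17 rfl, hr]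
    simp only [Test.Holds, NExp.eval, e5, not_le] at ht
    simp only [wp_seq, wp_setN, wp_setR]
    simp [NExp.eval, RExp.eval, NExp.cost, RExp.cost, e14, e15, e17, (h4 _ le_rfl).1,
      (h4 _ le_rfl).2]
    refine ⟨⟨ht, fun q hq => ?_, fun q hq => ?_, fun q hq => ?_⟩, by omega⟩
    · split_ifs with hqq
      · rw [hqq]
      · exact h2 q (by omega)
    · split_ifs with hqq
      · rw [hqq]
      · exact h3 q (by omega)
    · rw [if_neg (by omega), if_neg (by omega)]
      exact h4 q (by omega)
  · rintro τ ⟨⟨h1, h2, h3, h4⟩, ht, hF, htime⟩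
    have e5 : τ.nat 5 0 = Q := by rw [hF.nat 5 rfl, n5]
    simp only [Test.Holds, NExp.eval, e5, not_not] at ht
    have e8 : τ.nat 8 0 = Q := le_antisymm h1 ht
    rw [e8] at h2 h3
    refine ⟨h2, h3, htime.trans ?_⟩
    simp [Test.cost, NExp.cost, n8, t1]
    omega

/-- The weights, the accumulated normalized weights and the loss are those of `s`. -/
structure MWState (Q : ℕ) (s : MW) (σ : Config) : Prop where
  w : ∀ q < Q, σ.real 11 q = s.w q
  avg : ∀ q < Q, σ.real 12 q = s.avg q
  loss : σ.real 18 0 = s.loss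

theorem wp_learnStep {σ : Config} {G : Fam n} {cap ε : ℝ} {x : Cube n} {s : MW}
    (hG : Encodes σ G) (hv : G.Valid cap) (hx : σ.ex = bits x) (hl : σ.label = c x)
    (h13 : σ.real 13 0 = 1) (h14 : σ.real 14 0 = 1) (hε : σ.real 0 0 = ε)
    (hs : MWState G.len s σ) :
    wp c ω learnStep (fun τ =>
      MWState G.len (s.step (ε / 16) G.len (fun q => OR (G.set q)) c x) τ ∧
      τ.real 13 0 = 1 ∧ τ.real 14 0 = 1 ∧ Frame learnStep σ τ ∧
      τ.time ≤ σ.time + 240 * (G.len + 1)) σ := by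
  refine wp_mono (wp_frame (Q := fun τ =>
      MWState G.len (s.step (ε / 16) G.len (fun q => OR (G.set q)) c x) τ ∧
      τ.real 13 0 = 1 ∧ τ.real 14 0 = 1 ∧ τ.time ≤ σ.time + 240 * (G.len + 1)) ?_)
    fun τ ⟨⟨h1, h2, h3, h4⟩, h5⟩ => ⟨h1, h2, h3, h5, h4⟩
  rw [learnStep, wp_seq]
  refine wp_mono (wp_evalSets hG hv hx h13 h14) ?_
  rintro τ ⟨k14, k15, k16, k13, hF, ktime⟩
  have htot : τ.real 15 0 = s.total G.len := by
    rw [k15, MW.total]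
    congr 1
    exact Finset.sum_congr rfl fun q hq => hs.w q (Finset.mem_range.1 hq)
  have hpred : τ.real 16 0 / τ.real 15 0 = s.pred G.len (fun q => OR (G.set q)) x := by
    rw [htot, k16, MW.pred]
    congr 1
    exact Finset.sum_congr rfl fun q hq => by rw [hs.w q (Finset.mem_range.1 hq)]
  have e18 : τ.real 18 0 = s.loss := by rw [hF.real 18 rfl]; exact hs.loss
  have e0 : τ.real 0 0 = ε := by rw [hF.real 0 rfl]; exact hε
  have e11 : ∀ q, τ.real 11 q = σ.real 11 q := fun q => by rw [hF.real 11 rfl]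
  have e12 : ∀ q, τ.real 12 q = σ.real 12 q := fun q => by rw [hF.real 12 rfl]
  have e5 : τ.nat 5 0 = G.len := by rw [hF.nat 5 rfl]; exact hG.1
  have el : τ.label = c x := by rw [(hF.ex rfl).2.1, hl]
  have k140 : τ.real 14 0 = 1 := by rw [k14 0 hv.pos, hv.zero, OR_empty]
  -- The common tail of both branches of the comparison with the label, which differ only in the
  -- sign of the rate and of the residual.
  have fin : ∀ υ : Config, υ.nat 5 0 = G.len → (∀ q, υ.real 11 q = σ.real 11 q) →
      (∀ q, υ.real 12 q = σ.real 12 q) → υ.real 13 0 = 1 → (∀ q, υ.real 14 q = τ.real 14 q) →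
      υ.real 15 0 = s.total G.len → υ.real 17 0 = s.dir (ε / 16) G.len (fun q => OR (G.set q)) c x →
      υ.real 18 0 = s.loss + |s.pred G.len (fun q => OR (G.set q)) x - c x| →
      υ.time ≤ τ.time + 60 → wp c ω reweight (fun τ =>
        MWState G.len (s.step (ε / 16) G.len (fun q => OR (G.set q)) c x) τ ∧
        τ.real 13 0 = 1 ∧ τ.real 14 0 = 1 ∧ τ.time ≤ σ.time + 240 * (G.len + 1)) υ := by
    intro υ u5 u11 u12 u13 u14 u15 u17 u18 utime
    refine wp_mono (wp_reweight u5) ?_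
    rintro υ' ⟨l12, l11, hFυ, ltime⟩
    refine ⟨⟨fun q hq => ?_, fun q hq => ?_, ?_⟩, ?_, ?_, by omega⟩
    · rw [l11 q hq, u11, hs.w q hq, u17, u14, k14 q hq]; rfl
    · rw [l12 q hq, u12, u11, hs.w q hq, hs.avg q hq, u15]; rfl
    · rw [hFυ.real 18 rfl, u18]; rfl
    · rw [hFυ.real 13 rfl, u13]
    · rw [hFυ.real 14 rfl, u14, k140]
  rw [wp_seq, wp_setR, wp_seq, wp_ite]
  have htest : ∀ υ : Config, υ.real 16 0 = τ.real 16 0 / τ.real 15 0 → υ.label = c x →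
      (Test.Holds υ (.rle (RV 16) .label) ↔ s.pred G.len (fun q => OR (G.set q)) x ≤ c x) := by
    intro υ h1 h2
    simp [Test.Holds, RExp.eval, NExp.eval, h1, h2, hpred]
  rw [htest _ (by simp [RExp.eval, NExp.eval]) (by simp [el])]
  constructor
  · intro hle
    rw [wp_seq, wp_setR, wp_setR]
    apply fin
    · simp [e5]
    · simp [e11]
    · simp [e12]
    · simp [k13]
    · simp
    · simp [htot]
    · simp [RExp.eval, NExp.eval, e0, MW.dir, hle]
    · simp [RExp.eval, NExp.eval, e18, el, hpred]
      rw [abs_of_nonpos (by linarith)]; ring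
    · simp [RExp.cost, NExp.cost, Test.cost]
  · intro hle
    rw [wp_seq, wp_setR, wp_setR]
    apply fin
    · simp [e5]
    · simp [e11]
    · simp [e12]
    · simp [k13]
    · simp
    · simp [htot]
    · simp [RExp.eval, NExp.eval, e0, MW.dir, hle]
    · simp [RExp.eval, NExp.eval, e18, el, hpred]
      rw [abs_of_nonneg (by linarith)]
    · simp [RExp.cost, NExp.cost, Test.cost]

theorem wp_learnWeights {σ : Config} {G : Fam n} {cap ε : ℝ} {m : ℕ}
    (hG : Encodes σ G) (hv : G.Valid cap) (hε : σ.real 0 0 = ε) (hm : σ.nat 1 0 = m) :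
    wp c ω learnWeights (fun τ => MWState G.len (roundMW ε c G (segment ω σ.drawn m)) τ ∧
      τ.drawn = σ.drawn + m ∧ Frame learnWeights σ τ ∧
      τ.time ≤ σ.time + 400 * (m + 1) * (G.len + n + 1)) σ := by
  refine wp_mono (wp_frame (Q := fun τ =>
      MWState G.len (roundMW ε c G (segment ω σ.drawn m)) τ ∧
      τ.drawn = σ.drawn + m ∧ τ.time ≤ σ.time + 400 * (m + 1) * (G.len + n + 1)) ?_)
    fun τ ⟨⟨h1, h2, h3⟩, h4⟩ => ⟨h1, h2, h4, h3⟩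
  rw [learnWeights, wp_seq]
  refine wp_mono (wp_initWeights hG.1) ?_
  rintro σ₁ ⟨r11, r12, r18, r13, r14, n13, hF₁, t1⟩
  have hG₁ := hG.of_frame hF₁ rfl rfl rfl
  have n1 : σ₁.nat 1 0 = m := by rw [hF₁.nat 1 rfl, hm]
  have r0 : σ₁.real 0 0 = ε := by rw [hF₁.real 0 rfl, hε]
  have d1 : σ₁.drawn = σ.drawn := (hF₁.ex rfl).2.2
  refine wp_mono (wp_while (fun σ' => σ'.nat 13 0 ≤ m ∧ σ'.drawn = σ.drawn + σ'.nat 13 0 ∧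
      MWState G.len (roundMW ε c G (segment ω σ.drawn (σ'.nat 13 0))) σ' ∧
      σ'.real 13 0 = 1 ∧ σ'.real 14 0 = 1)
      (fun σ' => m - σ'.nat 13 0) (250 * (G.len + n + 1)) ?_ ?_ ?_) ?_
  · refine ⟨by omega, by omega, ?_, r13, r14⟩
    rw [n13]
    exact ⟨r11, r12, r18⟩
  · rintro σ' hF ⟨h1, h2, h3, h4, h5⟩ ht
    have hG' := hG₁.of_frame hF rfl rfl rfl
    have e1 : σ'.nat 1 0 = m := by rw [hF.nat 1 rfl, n1]
    have e0 : σ'.real 0 0 = ε := by rw [hF.real 0 rfl, r0]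
    simp only [Test.Holds, NExp.eval, e1, not_le] at ht
    rw [wp_seq, wp_draw, wp_seq]
    refine wp_mono (wp_learnStep (G := G) (x := ω σ'.drawn) hG' hv rfl rfl h4 h5 e0
      ⟨h3.w, h3.avg, h3.loss⟩) ?_
    rintro τ ⟨k1, k2, k3, hFτ, ktime⟩
    have f13 : τ.nat 13 0 = σ'.nat 13 0 := by rw [hFτ.nat 13 rfl]; rfl
    have fd : τ.drawn = σ.drawn + (σ'.nat 13 0 + 1) := by rw [(hFτ.ex rfl).2.2]; simp [h2]; rfl
    rw [wp_setN]
    simp only [Config.time_takeExample] at ktime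
    simp [NExp.eval, NExp.cost, f13, fd, k2, k3]
    refine ⟨⟨ht, ?_⟩, by omega, by omega⟩
    rw [roundMW, segment_succ, List.foldl_append, List.foldl_cons, List.foldl_nil, ← h2]
    exact ⟨k1.w, k1.avg, k1.loss⟩
  · intro σ' k h
    exact ⟨h.1, h.2.1, ⟨h.2.2.1.w, h.2.2.1.avg, h.2.2.1.loss⟩, h.2.2.2⟩
  · rintro τ ⟨⟨h1, h2, h3, -, -⟩, ht, hF, htime⟩
    have e1 : τ.nat 1 0 = m := by rw [hF.nat 1 rfl, n1]
    simp only [Test.Holds, NExp.eval, e1, not_not] at ht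
    have e13 : τ.nat 13 0 = m := le_antisymm h1 ht
    rw [e13] at h2 h3
    refine ⟨h3, h2, htime.trans ?_⟩
    simp [Test.cost, NExp.cost, n13]
    have hP : 1 ≤ G.len + n + 1 := by omega
    have hP' : G.len + 1 ≤ G.len + n + 1 := by omega
    clear * - hP hP' t1
    generalize G.len + n + 1 = P at *
    nlinarith [Nat.mul_le_mul_left m hP]

end

/-! ### Sample sizes and the program for one round -/

section

variable {n : ℕ} {c : Cube n → ℝ} {ω : ℕ → Cube n}

/-- The least `ℓ` with `(n + 2) τ ≤ 2 ^ ℓ`. -/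
def logSize (n : ℕ) (τ : ℝ) : ℕ := ⌈Real.logb 2 ((n + 2) * τ)⌉₊

/-- The number of examples for the estimates in a round. -/
def sampleSize (n : ℕ) (τ : ℝ) : ℕ := ⌈768 * (logSize n τ : ℝ) * τ ^ 2⌉₊

theorem logSize_le_iff {τ : ℝ} (hτ : 0 < τ) {k : ℕ} :
    logSize n τ ≤ k ↔ ((n : ℝ) + 2) * τ ≤ 2 ^ k := by
  rw [logSize, Nat.ceil_le, Real.logb_le_iff_le_rpow one_lt_two (by positivity),
    Real.rpow_natCast]

theorem roundParams {s ε : ℝ} (hs : 1 ≤ s) (hε : 0 < ε) :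
    RoundParams n ε s (72 * s / ε ^ 2) (logSize n (72 * s / ε ^ 2))
      (sampleSize n (72 * s / ε ^ 2)) :=
  ⟨hs, rfl, (logSize_le_iff (by positivity)).1 le_rfl, Nat.le_ceil _⟩

theorem logSize_le_sampleSize {τ : ℝ} (hτ : 1 ≤ τ) : logSize n τ ≤ sampleSize n τ := by
  have h : (logSize n τ : ℝ) ≤ sampleSize n τ := by
    refine le_trans ?_ (Nat.le_ceil _)
    have h0 : (0 : ℝ) ≤ logSize n τ := Nat.cast_nonneg _
    nlinarith [mul_nonneg h0 (sub_nonneg.2 (one_le_pow₀ hτ : 1 ≤ τ ^ 2))]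
  exact_mod_cast h

/-- Compute the number of examples for the estimates. -/
def computeSize : Prog :=
  setNV 2 (.const 0) ;; setRV 3 (RC 1) ;;
  .while (.not (.rle (.mul (.add (.ofNat (NV 0)) (RC 2)) (RV 4)) (RV 3)))
    (setRV 3 (.add (RV 3) (RV 3)) ;; incr 2) ;;
  setRV 6 (.mul (.mul (.mul (RC 768) (.ofNat (NV 2))) (RV 4)) (RV 4)) ;;
  setNV 1 (.const 0) ;;
  .while (.not (.rle (RV 6) (.ofNat (NV 1)))) (incr 1)

/-- The machine has neither logarithms nor rounding, so ℓ is found by doubling a power of two and m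
by counting up to the real number 768ℓτ². As ℓ ≤ m, this costs O(m) steps, less than drawing the
sample. -/
theorem wp_computeSize {σ : Config} {t : ℝ} (ht : 1 ≤ t) (hn : σ.nat 0 0 = n)
    (h4 : σ.real 4 0 = t) :
    wp c ω computeSize (fun τ => τ.nat 1 0 = sampleSize n t ∧ Frame computeSize σ τ ∧
      τ.time ≤ σ.time + 100 * (sampleSize n t + 1)) σ := by
  refine wp_mono (wp_frame (Q := fun τ => τ.nat 1 0 = sampleSize n t ∧
      τ.time ≤ σ.time + 100 * (sampleSize n t + 1)) ?_) fun τ ⟨⟨h1, h2⟩, h3⟩ => ⟨h1, h3, h2⟩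
  simp only [computeSize, wp_seq, wp_setN, wp_setR]
  set σ₁ : Config := Config.setReal _ 3 _ _ _ with hσ₁
  have t1 : σ₁.time = σ.time + 7 := by simp [hσ₁, NExp.cost, RExp.cost]
  have n2 : σ₁.nat 2 0 = 0 := by simp [hσ₁, NExp.eval]
  have n0 : σ₁.nat 0 0 = n := by simp [hσ₁, hn]
  have r4 : σ₁.real 4 0 = t := by simp [hσ₁, h4]
  have r3 : σ₁.real 3 0 = 1 := by simp [hσ₁, NExp.eval, RExp.eval]
  clear_value σ₁; clear hσ₁
  refine wp_mono (wp_while (fun σ' => σ'.nat 2 0 ≤ logSize n t ∧ σ'.real 3 0 = 2 ^ σ'.nat 2 0)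
    (fun σ' => logSize n t - σ'.nat 2 0) 20 ?_ ?_) ?_
  · simp [n2, r3]
  · rintro σ' hF ⟨h1, h2⟩ hT
    have e0 : σ'.nat 0 0 = n := by rw [hF.nat 0 rfl, n0]
    have e4 : σ'.real 4 0 = t := by rw [hF.real 4 rfl, r4]
    simp only [Test.Holds, NExp.eval, RExp.eval, e0, e4, h2] at hT
    have hlt : σ'.nat 2 0 < logSize n t := by
      by_contra hcon
      exact hT (by exact_mod_cast (logSize_le_iff (by linarith)).1 (not_lt.1 hcon))
    simp only [wp_seq, wp_setN, wp_setR]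
    simp [NExp.eval, RExp.eval, NExp.cost, RExp.cost, h2]
    exact ⟨⟨hlt, by ring⟩, by omega⟩
  · rintro τ ⟨⟨h1, h2⟩, hT, hF, htime⟩
    have e0 : τ.nat 0 0 = n := by rw [hF.nat 0 rfl, n0]
    have e4 : τ.real 4 0 = t := by rw [hF.real 4 rfl, r4]
    simp only [Test.Holds, NExp.eval, RExp.eval, e0, e4, h2, not_not] at hT
    have e2 : τ.nat 2 0 = logSize n t :=
      le_antisymm h1 ((logSize_le_iff (by linarith)).2 (by exact_mod_cast hT))
    simp only [wp_seq, wp_setN, wp_setR]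
    set σ₂ : Config := Config.setNat _ 1 _ _ _ with hσ₂
    have t2 : σ₂.time = τ.time + 17 := by simp [hσ₂, NExp.cost, RExp.cost]
    have n1 : σ₂.nat 1 0 = 0 := by simp [hσ₂, NExp.eval]
    have r6 : σ₂.real 6 0 = 768 * (logSize n t : ℝ) * t ^ 2 := by
      simp [hσ₂, NExp.eval, RExp.eval, e2, e4]; ring
    clear_value σ₂; clear hσ₂
    refine wp_mono (wp_while (fun σ' => σ'.nat 1 0 ≤ sampleSize n t)
      (fun σ' => sampleSize n t - σ'.nat 1 0) 6 ?_ ?_) ?_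
    · simp [n1]
    · rintro σ' hF' h5 hT'
      have e6 : σ'.real 6 0 = 768 * (logSize n t : ℝ) * t ^ 2 := by rw [hF'.real 6 rfl, r6]
      simp only [Test.Holds, NExp.eval, RExp.eval, e6, not_le] at hT'
      have hlt : σ'.nat 1 0 < sampleSize n t := Nat.lt_ceil.2 hT'
      rw [wp_setN]
      simp [NExp.eval, NExp.cost]
      omega
    · rintro υ ⟨h5, hT', hF', htime'⟩
      have e6 : υ.real 6 0 = 768 * (logSize n t : ℝ) * t ^ 2 := by rw [hF'.real 6 rfl, r6]
      simp only [Test.Holds, NExp.eval, RExp.eval, e6, not_not] at hT'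
      refine ⟨le_antisymm h5 (Nat.ceil_le.2 hT'), htime'.trans ?_⟩
      have := logSize_le_sampleSize (n := n) ht
      simp [Test.cost, NExp.cost, RExp.cost, n1, n2, t1] at htime ⊢
      omega

/-- One round: it uses the size parameter `real 1` and the accuracy `real 0`. -/
def learnRound : Prog :=
  setRV 4 (.div (.mul (RC 72) (RV 1)) (.mul (RV 0) (RV 0))) ;;
  computeSize ;; storeSample ;; findFamily ;; learnWeights

/-- The memory holds the result of a round with the examples `l`. -/
structure RoundResult (ε τ : ℝ) (c : Cube n → ℝ) (m : ℕ) (l : List (Cube n)) (σ : Config) :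
    Prop where
  size : σ.nat 1 0 = m
  family : Encodes σ (roundFam τ c (l.take m))
  avg : ∀ q < (roundFam τ c (l.take m)).len,
    σ.real 12 q = (roundMW ε c (roundFam τ c (l.take m)) (l.drop m)).avg q
  loss : σ.real 18 0 = roundLoss ε τ c m l

/-- A bound for the running time of a round. -/
def roundTime (n : ℕ) (τ : ℝ) : ℕ := 1200 * (sampleSize n τ + 1) * (⌈2 * τ + 3⌉₊ + 1) * (n + 1)

theorem wp_learnRound {σ : Config} {ε s : ℝ} (hε : 0 < ε) (hε1 : ε < 1) (hs : 1 ≤ s)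
    (hn : σ.nat 0 0 = n) (h0 : σ.real 0 0 = ε) (h1 : σ.real 1 0 = s) :
    wp c ω learnRound (fun τ =>
      RoundResult ε (72 * s / ε ^ 2) c (sampleSize n (72 * s / ε ^ 2))
        (segment ω σ.drawn (sampleSize n (72 * s / ε ^ 2) + sampleSize n (72 * s / ε ^ 2))) τ ∧
      τ.drawn = σ.drawn + (sampleSize n (72 * s / ε ^ 2) + sampleSize n (72 * s / ε ^ 2)) ∧
      Frame learnRound σ τ ∧ τ.time ≤ σ.time + roundTime n (72 * s / ε ^ 2)) σ := by
  have ht : 72 ≤ 72 * s / ε ^ 2 := (roundParams (n := n) hs hε).seventy_two_le hε hε1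
  obtain ⟨t, htdef⟩ : ∃ t, t = 72 * s / ε ^ 2 := ⟨_, rfl⟩
  rw [← htdef] at ht ⊢
  obtain ⟨m, hm⟩ : ∃ m, m = sampleSize n t := ⟨_, rfl⟩
  rw [← hm]
  refine wp_mono (wp_frame (Q := fun τ => RoundResult ε t c m (segment ω σ.drawn (m + m)) τ ∧
      τ.drawn = σ.drawn + (m + m) ∧ τ.time ≤ σ.time + roundTime n t) ?_)
    fun τ ⟨⟨h1, h2, h3⟩, h4⟩ => ⟨h1, h2, h4, h3⟩
  rw [learnRound, wp_seq, wp_setR]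
  set σ₁ : Config := Config.setReal _ 4 _ _ _ with hσ₁
  have t1 : σ₁.time = σ.time + 13 := by simp [hσ₁, NExp.cost, RExp.cost]
  have n0 : σ₁.nat 0 0 = n := by simp [hσ₁, hn]
  have r0 : σ₁.real 0 0 = ε := by simp [hσ₁, NExp.eval, h0]
  have r4 : σ₁.real 4 0 = t := by
    simp [hσ₁, NExp.eval, RExp.eval, h0, h1, htdef]; ring
  have d1 : σ₁.drawn = σ.drawn := by simp [hσ₁]
  clear_value σ₁; clear hσ₁
  rw [wp_seq]
  refine wp_mono (wp_computeSize (by linarith) n0 r4) ?_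
  rintro σ₂ ⟨n1, hF₂, t2⟩
  rw [← hm] at n1 t2
  rw [wp_seq]
  refine wp_mono (wp_storeSample (by rw [hF₂.nat 0 rfl, n0]) n1) ?_
  rintro σ₃ ⟨r7, r8, r9, d3, hF₃, t3⟩
  have d2 : σ₂.drawn = σ.drawn := by rw [(hF₂.ex rfl).2.2, d1]
  have hst : Stored c (fun j => ω (σ.drawn + j)) m t σ₃ := by
    refine ⟨?_, ?_, ?_, ?_, ?_⟩
    · rw [hF₃.nat 0 rfl, hF₂.nat 0 rfl, n0]
    · rw [hF₃.nat 1 rfl, n1]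
    · rw [hF₃.real 4 rfl, hF₂.real 4 rfl, r4]
    · rw [← d2]; exact r7
    · rw [← d2]; exact r8
  rw [wp_seq]
  refine wp_mono (wp_findFamily (by linarith) hst r9 (Nat.le_ceil _)) ?_
  rintro σ₄ ⟨hG, hF₄, t4⟩
  obtain ⟨G, hGdef⟩ : ∃ G, G = roundFam t c (segment ω σ.drawn m) := ⟨_, rfl⟩
  rw [← hGdef] at hG
  have hv : G.Valid (2 * t + 2) := by
    rw [hGdef]; exact family_valid _ (by linarith) _
  have d4 : σ₄.drawn = σ.drawn + m := by rw [(hF₄.ex rfl).2.2, d3, d2]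
  have e0 : σ₄.real 0 0 = ε := by rw [hF₄.real 0 rfl, hF₃.real 0 rfl, hF₂.real 0 rfl, r0]
  have e1 : σ₄.nat 1 0 = m := by rw [hF₄.nat 1 rfl, hF₃.nat 1 rfl, n1]
  refine wp_mono (wp_learnWeights hG hv e0 e1) ?_
  rintro σ₅ ⟨hM, d5, hF₅, t5⟩
  rw [d4] at hM d5
  refine ⟨⟨?_, ?_, ?_, ?_⟩, by omega, ?_⟩
  · rw [hF₅.nat 1 rfl, e1]
  · rw [take_segment_add, ← hGdef]
    exact hG.of_frame hF₅ rfl rfl rfl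
  · rw [take_segment_add, drop_segment_add, ← hGdef]
    exact hM.avg
  · rw [roundLoss, take_segment_add, drop_segment_add, ← hGdef]
    exact hM.loss
  · have hlen : G.len ≤ ⌈2 * t + 3⌉₊ := by
      have h := hv.len_le.trans (by linarith [Nat.le_ceil (2 * t + 3)] :
        2 * t + 2 + 1 ≤ (⌈2 * t + 3⌉₊ : ℝ))
      exact_mod_cast h
    rw [roundTime, ← hm]
    generalize ⌈2 * t + 3⌉₊ = K at *
    clear * - hlen t1 t2 t3 t4 t5
    have h1 : (m + 1) * (G.len + n + 1) ≤ (m + 1) * ((K + 1) * (n + 1)) :=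
      Nat.mul_le_mul_left _ (by nlinarith)
    have h2 : (n + 1) * (m + 1) ≤ (m + 1) * ((K + 1) * (n + 1)) := by
      rw [mul_comm]; exact Nat.mul_le_mul_left _ (Nat.le_mul_of_pos_left _ (by omega))
    have h3 : m + 1 ≤ (m + 1) * ((K + 1) * (n + 1)) := Nat.le_mul_of_pos_right _ (by positivity)
    rw [mul_assoc] at t3 t5
    rw [mul_assoc, mul_assoc] at t4
    rw [mul_assoc, mul_assoc]
    generalize (m + 1) * ((K + 1) * (n + 1)) = R at *
    omega

end

/-! ### Writing the hypothesis -/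

section

variable {n : ℕ} {c : Cube n → ℝ} {ω : ℕ → Cube n}

/-- Write the variables of one disjunction. -/
def writeSet : Prog :=
  setNV 14 (NV 8) ;;
  .while (.nle (.const 1) (NV 14)) (.pushVar (.load 12 (NV 14)) ;; setNV 14 (.load 11 (NV 14)))

/-- Write the hypothesis. -/
def writeHypothesis : Prog :=
  setNV 8 (.const 0) ;;
  .while (ltTest (NV 8) (NV 5))
    (writeSet ;; .pushTerm (.div (.load 12 (NV 8)) (.ofNat (NV 1))) ;; incr 8)

/-- Following the parent pointers down to entry 0 lists the variables of the set. Pointers strictly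
decrease, so the current position serves as the loop measure. -/
theorem wp_writeSet {σ : Config} {G : Fam n} {cap : ℝ} (hG : Encodes σ G) (hv : G.Valid cap)
    (hq : σ.nat 8 0 < G.len) (hterm : σ.term = []) :
    wp c ω writeSet (fun τ => (∀ i : Fin n, (i : ℕ) ∈ τ.term ↔ i ∈ G.set (σ.nat 8 0)) ∧
      τ.out = σ.out ∧ Frame writeSet σ τ ∧ τ.time ≤ σ.time + 30 * (G.len + 1)) σ := by
  refine wp_mono (wp_frame (Q := fun τ =>
      (∀ i : Fin n, (i : ℕ) ∈ τ.term ↔ i ∈ G.set (σ.nat 8 0)) ∧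
      τ.out = σ.out ∧ τ.time ≤ σ.time + 30 * (G.len + 1)) ?_)
    fun τ ⟨⟨h1, h2, h3⟩, h4⟩ => ⟨h1, h2, h4, h3⟩
  simp only [writeSet, wp_seq, wp_setN]
  set σ₁ : Config := Config.setNat _ 14 _ _ _ with hσ₁
  have t1 : σ₁.time = σ.time + 4 := by simp [hσ₁, NExp.cost]
  have n14 : σ₁.nat 14 0 = σ.nat 8 0 := by simp [hσ₁, NExp.eval]
  have hG₁ : Encodes σ₁ G := by
    have := hG.2
    exact ⟨by simp [hσ₁, hG.1], by simpa [hσ₁] using this⟩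
  have ht₁ : σ₁.term = [] := hterm
  have ho₁ : σ₁.out = σ.out := rfl
  clear_value σ₁; clear hσ₁
  refine wp_mono (wp_while (fun σ' => σ'.nat 14 0 < G.len ∧ σ'.out = σ.out ∧
      ∀ i : Fin n, ((i : ℕ) ∈ σ'.term ∨ i ∈ G.set (σ'.nat 14 0)) ↔ i ∈ G.set (σ.nat 8 0))
      (fun σ' => σ'.nat 14 0) 10 ?_ ?_) ?_
  · simp [n14, hq, ht₁, ho₁]
  · rintro σ' hF ⟨h1, h2, h3⟩ ht
    have hG' := hG₁.of_frame hF rfl rfl rfl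
    simp only [Test.Holds, NExp.eval] at ht
    obtain ⟨hp, hvn, hnot, hset⟩ := hG'.2 _ h1 (by omega)
    rw [wp_seq, wp_pushVar, wp_setN]
    simp [NExp.eval, NExp.cost, h2]
    refine ⟨⟨by omega, fun i => ?_⟩, hp⟩
    rw [← h3 i, hset, Finset.mem_insert, Fin.ext_iff]
    tauto
  · rintro τ ⟨⟨h1, h2, h3⟩, ht, hF, htime⟩
    simp only [Test.Holds, NExp.eval, not_le] at ht
    have e : τ.nat 14 0 = 0 := by omega
    refine ⟨fun i => ?_, h2, htime.trans ?_⟩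
    · rw [← h3 i, e, hv.zero]; simp
    · simp [Test.cost, NExp.cost, n14, t1]
      omega

theorem hypothesis_cons (v : List ℕ) (a : ℝ) (out : List (List ℕ × ℝ)) {T : Finset (Fin n)}
    (hT : ∀ i : Fin n, (i : ℕ) ∈ v ↔ i ∈ T) (x : Cube n) :
    hypothesis n ((v, a) :: out) x = a * OR T x + hypothesis n out x := by
  classical
  have h : (Finset.univ.filter fun i : Fin n => (i : ℕ) ∈ v) = T := by
    ext i; simp [hT]
  simp only [hypothesis, List.map_cons, List.sum_cons]
  rw [← h]

theorem wp_writeHypothesis {σ : Config} {G : Fam n} {cap : ℝ} {a : ℕ → ℝ} {m : ℕ}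
    (hG : Encodes σ G) (hv : G.Valid cap) (ha : ∀ q < G.len, σ.real 12 q = a q)
    (hm : σ.nat 1 0 = m) (hterm : σ.term = []) (hout : σ.out = []) :
    wp c ω writeHypothesis (fun τ => hypothesis n τ.out = famHyp G a m ∧
      Frame writeHypothesis σ τ ∧ τ.time ≤ σ.time + 100 * (G.len + 1) ^ 2) σ := by
  refine wp_mono (wp_frame (Q := fun τ => hypothesis n τ.out = famHyp G a m ∧
      τ.time ≤ σ.time + 100 * (G.len + 1) ^ 2) ?_)
    fun τ ⟨⟨h1, h2⟩, h3⟩ => ⟨h1, h3, h2⟩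
  simp only [writeHypothesis, wp_seq, wp_setN]
  set σ₁ : Config := Config.setNat _ 8 _ _ _ with hσ₁
  have t1 : σ₁.time = σ.time + 3 := by simp [hσ₁, NExp.cost]
  have n8 : σ₁.nat 8 0 = 0 := by simp [hσ₁, NExp.eval]
  have n1 : σ₁.nat 1 0 = m := by simp [hσ₁, hm]
  have hG₁ : Encodes σ₁ G := by
    have := hG.2
    exact ⟨by simp [hσ₁, hG.1], by simpa [hσ₁] using this⟩
  have ha₁ : ∀ q < G.len, σ₁.real 12 q = a q := ha
  have ht₁ : σ₁.term = [] := hterm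
  have ho₁ : σ₁.out = [] := hout
  clear_value σ₁; clear hσ₁
  refine wp_mono (wp_while (fun σ' => σ'.nat 8 0 ≤ G.len ∧ σ'.term = [] ∧
      ∀ x, hypothesis n σ'.out x = ∑ q ∈ Finset.range (σ'.nat 8 0), a q / m * OR (G.set q) x)
      (fun σ' => G.len - σ'.nat 8 0) (30 * (G.len + 1) + 20) ?_ ?_) ?_
  · simp [n8, ht₁, ho₁, hypothesis]
  · rintro σ' hF ⟨h1, h2, h3⟩ ht
    have hG' := hG₁.of_frame hF rfl rfl rfl
    have e1 : σ'.nat 1 0 = m := by rw [hF.nat 1 rfl, n1]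
    simp only [Test.Holds, NExp.eval, hG'.1, not_le] at ht
    rw [wp_seq]
    refine wp_mono (wp_writeSet hG' hv ht h2) ?_
    rintro τ ⟨k1, k2, hFτ, k3⟩
    have e8 : τ.nat 8 0 = σ'.nat 8 0 := by rw [hFτ.nat 8 rfl]
    have e1' : τ.nat 1 0 = m := by rw [hFτ.nat 1 rfl, e1]
    have e12 : τ.real 12 (σ'.nat 8 0) = a (σ'.nat 8 0) := by
      rw [hFτ.real 12 rfl, hF.real 12 rfl, ha₁ _ ht]
    rw [wp_seq, wp_pushTerm, wp_setN]
    simp [NExp.eval, RExp.eval, NExp.cost, RExp.cost, e8, e1', e12, k2]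
    refine ⟨⟨ht, fun x => ?_⟩, by omega, by omega⟩
    rw [hypothesis_cons _ _ _ k1, h3 x, Finset.sum_range_succ, add_comm]
  · rintro τ ⟨⟨h1, h2, h3⟩, ht, hF, htime⟩
    have hG' := hG₁.of_frame hF rfl rfl rfl
    simp only [Test.Holds, NExp.eval, hG'.1, not_not] at ht
    have e : τ.nat 8 0 = G.len := le_antisymm h1 ht
    refine ⟨funext fun x => ?_, htime.trans ?_⟩
    · rw [h3 x, e]; rfl
    · simp [Test.cost, NExp.cost, n8, t1]
      nlinarith

end

/-! ### The two algorithms, and the run with known size -/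

section

variable {n : ℕ} {c : Cube n → ℝ} {ω : ℕ → Cube n}

/-- Compute the bound on the size that does not depend on the target. -/
def computeCap : Prog :=
  setNV 2 (.const 0) ;; setRV 3 (RC 1) ;; setRV 2 (RC 1) ;;
  .while (.not (.rle (.div (RC 6) (RV 0)) (RV 3)))
    (setRV 3 (.add (RV 3) (RV 3)) ;;
      setRV 2 (.mul (RV 2) (.mul (.div (RC 12) (RV 0)) (.div (RC 12) (RV 0)))) ;; incr 2)

/-- The size parameter is the minimum of the size of the target and the bound on the size. -/
def chooseSize : Prog :=
  setRV 1 (.ofNat (.load 0 (.const 1))) ;;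
  .ite (.rle (RC 1) (RV 1)) .skip (setRV 1 (RC 1)) ;;
  .ite (.rle (RV 1) (RV 2)) .skip (setRV 1 (RV 2))

/-- The algorithm that is given the size of the target. -/
def learnKnownSize : Prog :=
  .ite (.rle (RC 1) (RV 0)) .skip (computeCap ;; chooseSize ;; learnRound ;; writeHypothesis)

/-- One round, and the decision whether another one is needed. -/
def tryRound : Prog :=
  learnRound ;;
  .ite (.and (.not (.rle (RV 18) (.mul (.mul (.div (RC 3) (RC 4)) (RV 0)) (.ofNat (NV 1)))))
      (.not (.rle (RV 2) (RV 1))))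
    (setRV 1 (.add (RV 1) (RV 1)) ;; incr 16) (setNV 15 (.const 1))

/-- Rounds with size parameters that are powers of two. -/
def searchSize : Prog :=
  setRV 1 (RC 1) ;; setNV 15 (.const 0) ;; setNV 16 (.const 0) ;;
  .while (.nle (NV 15) (.const 0)) tryRound

/-- The algorithm that is not given the size of the target. -/
def learnUnknownSize : Prog :=
  .ite (.rle (RC 1) (RV 0)) .skip (computeCap ;; searchSize ;; writeHypothesis)

/-- Doubling a power of two until it reaches 6/ε takes exactly L steps by the minimality of L; the
cap collects a factor (12/ε)² in each. -/
theorem wp_computeCap {σ : Config} {ε : ℝ} {L : ℕ} (h0 : σ.real 0 0 = ε)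
    (hL : 6 / ε ≤ 2 ^ L) (hL' : ∀ k : ℕ, 6 / ε ≤ 2 ^ k → L ≤ k) :
    wp c ω computeCap (fun τ => τ.real 2 0 = (12 / ε) ^ (2 * L) ∧ Frame computeCap σ τ ∧
      τ.time ≤ σ.time + 60 * (L + 1)) σ := by
  refine wp_mono (wp_frame (Q := fun τ => τ.real 2 0 = (12 / ε) ^ (2 * L) ∧
      τ.time ≤ σ.time + 60 * (L + 1)) ?_) fun τ ⟨⟨h1, h2⟩, h3⟩ => ⟨h1, h3, h2⟩
  simp only [computeCap, wp_seq, wp_setN, wp_setR]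
  set σ₁ : Config := Config.setReal _ 2 _ _ _ with hσ₁
  have t1 : σ₁.time = σ.time + 11 := by simp [hσ₁, NExp.cost, RExp.cost]
  have n2 : σ₁.nat 2 0 = 0 := by simp [hσ₁, NExp.eval]
  have r0 : σ₁.real 0 0 = ε := by simp [hσ₁, h0]
  have r3 : σ₁.real 3 0 = 1 := by simp [hσ₁, NExp.eval, RExp.eval]
  have r2 : σ₁.real 2 0 = 1 := by simp [hσ₁, NExp.eval, RExp.eval]
  clear_value σ₁; clear hσ₁
  refine wp_mono (wp_while (fun σ' => σ'.nat 2 0 ≤ L ∧ σ'.real 3 0 = 2 ^ σ'.nat 2 0 ∧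
    σ'.real 2 0 = (12 / ε) ^ (2 * σ'.nat 2 0)) (fun σ' => L - σ'.nat 2 0) 40 ?_ ?_) ?_
  · simp [n2, r3, r2]
  · rintro σ' hF ⟨h1, h2, h3⟩ hT
    have e0 : σ'.real 0 0 = ε := by rw [hF.real 0 rfl, r0]
    simp only [Test.Holds, NExp.eval, RExp.eval, e0, h2] at hT
    have hlt : σ'.nat 2 0 < L := by
      refine lt_of_le_of_ne h1 fun h => hT ?_
      rw [h]; exact_mod_cast hL
    simp only [wp_seq, wp_setN, wp_setR]
    simp [NExp.eval, RExp.eval, NExp.cost, RExp.cost, h2, h3, e0]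
    exact ⟨⟨hlt, by ring, by ring⟩, by omega⟩
  · rintro τ ⟨⟨h1, h2, h3⟩, hT, hF, htime⟩
    have e0 : τ.real 0 0 = ε := by rw [hF.real 0 rfl, r0]
    simp only [Test.Holds, NExp.eval, RExp.eval, e0, h2, not_not] at hT
    have e2 : τ.nat 2 0 = L := le_antisymm h1 (hL' _ (by exact_mod_cast hT))
    refine ⟨by rw [h3, e2], htime.trans ?_⟩
    simp [Test.cost, NExp.cost, RExp.cost, n2, t1]
    omega

theorem wp_chooseSize {σ : Config} {s : ℕ} {cap : ℝ} (hs : σ.nat 0 1 = s)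
    (hcap : σ.real 2 0 = cap) :
    wp c ω chooseSize (fun τ => τ.real 1 0 = min (max 1 (s : ℝ)) cap ∧ Frame chooseSize σ τ ∧
      τ.time ≤ σ.time + 40) σ := by
  refine wp_mono (wp_frame (Q := fun τ => τ.real 1 0 = min (max 1 (s : ℝ)) cap ∧
      τ.time ≤ σ.time + 40) ?_) fun τ ⟨⟨h1, h2⟩, h3⟩ => ⟨h1, h3, h2⟩
  rw [chooseSize, wp_seq, wp_setR, wp_seq]
  have hsnd : ∀ (υ : Config) (v : ℝ), υ.real 1 0 = v → υ.real 2 0 = cap →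
      υ.time ≤ σ.time + 20 → wp c ω (.ite (.rle (RV 1) (RV 2)) .skip (setRV 1 (RV 2)))
        (fun τ => τ.real 1 0 = min v cap ∧ τ.time ≤ σ.time + 40) υ := by
    intro υ v h1 h2 h3
    rw [wp_ite, wp_skip, wp_setR]
    simp [Test.Holds, NExp.eval, RExp.eval, NExp.cost, RExp.cost, Test.cost, h1, h2]
    exact ⟨fun h => ⟨h, by omega⟩, fun h => ⟨h.le, by omega⟩⟩
  rw [wp_ite, wp_skip, wp_setR]
  constructor
  · intro h
    simp [Test.Holds, NExp.eval, RExp.eval, hs] at h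
    refine hsnd _ _ ?_ (by simp [hcap]) (by simp [NExp.cost, RExp.cost, Test.cost])
    simp [NExp.eval, RExp.eval, hs, h]
  · intro h
    simp [Test.Holds, NExp.eval, RExp.eval, hs] at h
    refine hsnd _ _ ?_ (by simp [hcap]) (by simp [NExp.cost, RExp.cost, Test.cost])
    simp [NExp.eval, RExp.eval, h]

/-- A bound for the running time of the algorithms. -/
def totalTime (n : ℕ) (τ : ℝ) (L K : ℕ) : ℕ :=
  100 * (L + 1) + (K + 1) * (roundTime n τ + 100) + 100 * (⌈2 * τ + 3⌉₊ + 1) ^ 2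

theorem roundFam_len_le {τ : ℝ} (hτ : 0 ≤ τ) (l : List (Cube n)) :
    (roundFam τ c l).len ≤ ⌈2 * τ + 3⌉₊ := by
  have hv := family_valid (coefTest τ c l) (cap := 2 * τ + 2) (by linarith) n
  have h := hv.len_le.trans (by linarith [Nat.le_ceil (2 * τ + 3)] :
    2 * τ + 2 + 1 ≤ (⌈2 * τ + 3⌉₊ : ℝ))
  exact_mod_cast h

theorem wp_writeHypothesis_of_roundResult {σ : Config} {ε τ : ℝ} {m : ℕ} {l : List (Cube n)}
    (hτ : 0 ≤ τ) (h : RoundResult ε τ c m l σ) (hterm : σ.term = []) (hout : σ.out = []) :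
    wp c ω writeHypothesis (fun υ => hypothesis n υ.out = roundHyp ε τ c m l ∧
      υ.drawn = σ.drawn ∧ υ.time ≤ σ.time + 100 * (⌈2 * τ + 3⌉₊ + 1) ^ 2) σ := by
  refine wp_mono (wp_writeHypothesis (cap := 2 * τ + 2) h.family
    (family_valid _ (by linarith) _) h.avg h.size hterm hout) ?_
  rintro υ ⟨h1, hF, h2⟩
  refine ⟨h1, (hF.ex rfl).2.2, h2.trans ?_⟩
  gcongr
  exact roundFam_len_le hτ _

theorem wp_learnKnownSize {ε : ℝ} {L : ℕ} (hε : 0 < ε) (hε1 : ε < 1)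
    (hL : 6 / ε ≤ 2 ^ L) (hL' : ∀ k : ℕ, 6 / ε ≤ 2 ^ k → L ≤ k) {s τ : ℝ} {m : ℕ}
    (hs : s = min (max 1 (size c : ℝ)) ((12 / ε) ^ (2 * L))) (hs1 : 1 ≤ s)
    (hτ : τ = 72 * s / ε ^ 2) (hm : m = sampleSize n τ) :
    wp c ω learnKnownSize (fun υ =>
      hypothesis n υ.out = roundHyp ε τ c m (segment ω 0 (m + m)) ∧ υ.drawn = m + m ∧
      υ.time ≤ totalTime n τ L 0) (start n (size c) ε) := by
  have h72 := (roundParams (n := n) hs1 hε).seventy_two_le hε hε1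
  rw [← hτ] at h72
  rw [learnKnownSize, wp_ite]
  have r0 : (start n (size c) ε).real 0 0 = ε := by simp [start, write_apply]
  have n0 : (start n (size c) ε).nat 0 0 = n := by simp [start, write_apply]
  have n1 : (start n (size c) ε).nat 0 1 = size c := by simp [start, write_apply]
  have ho : (start n (size c) ε).out = [] := rfl
  have hte : (start n (size c) ε).term = [] := rfl
  have hd : (start n (size c) ε).drawn = 0 := rfl
  have hti : (start n (size c) ε).time = 0 := rfl
  generalize start n (size c) ε = σ at *
  refine ⟨fun h => ?_, fun _ => ?_⟩
  · simp [Test.Holds, RExp.eval, NExp.eval, r0] at h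
    linarith
  · rw [wp_seq]
    refine wp_mono (wp_computeCap r0 hL hL') ?_
    rintro σ₁ ⟨h2, hF₁, t1⟩
    simp [Test.cost, NExp.cost, RExp.cost, hti] at t1
    rw [wp_seq]
    refine wp_mono (wp_chooseSize (s := size c) (by rw [hF₁.nat 0 rfl]; exact n1) h2) ?_
    rintro σ₂ ⟨h1, hF₂, t2⟩
    rw [← hs] at h1
    rw [wp_seq]
    refine wp_mono (wp_learnRound (s := s) hε hε1 hs1
      (by rw [hF₂.nat 0 rfl, hF₁.nat 0 rfl]; exact n0)
      (by rw [hF₂.real 0 rfl, hF₁.real 0 rfl]; exact r0) h1) ?_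
    rw [← hτ, ← hm]
    have d2 : σ₂.drawn = 0 := by rw [(hF₂.ex rfl).2.2, (hF₁.ex rfl).2.2]; exact hd
    rintro σ₃ ⟨hR, d3, hF₃, t3⟩
    rw [d2] at hR d3
    refine wp_mono (wp_writeHypothesis_of_roundResult (by linarith) hR
      (by rw [(hF₃.out rfl).1, (hF₂.out rfl).1, (hF₁.out rfl).1]; exact hte)
      (by rw [(hF₃.out rfl).2, (hF₂.out rfl).2, (hF₁.out rfl).2]; exact ho)) ?_
    rintro υ ⟨k1, k2, k3⟩
    refine ⟨k1, by omega, ?_⟩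
    rw [totalTime]
    omega

end

/-! ### The search for the size by doubling -/

section

variable {n : ℕ} {c : Cube n → ℝ} {ω : ℕ → Cube n}

theorem RoundResult.congr {ε τ : ℝ} {m : ℕ} {l : List (Cube n)} {σ υ : Config}
    (h : RoundResult ε τ c m l σ) (h1 : υ.nat 1 = σ.nat 1) (h5 : υ.nat 5 = σ.nat 5)
    (h11 : υ.nat 11 = σ.nat 11) (h12 : υ.nat 12 = σ.nat 12) (hr : υ.real = σ.real) :
    RoundResult ε τ c m l υ := by
  refine ⟨by rw [h1, h.size], ?_, by rw [hr]; exact h.avg, by rw [hr]; exact h.loss⟩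
  have := h.family
  unfold Encodes at this ⊢
  rwa [h5, h11, h12]

/-- The round with examples `l` is accepted. -/
def Accepted (ε τ : ℝ) (c : Cube n → ℝ) (m : ℕ) (l : List (Cube n)) : Prop :=
  roundLoss ε τ c m l ≤ 3 / 4 * ε * m

/-- The flag is set if the round is accepted or the guess has reached the cap; otherwise the guess
is doubled. The second reason for stopping ensures termination on every sequence of examples. -/
theorem wp_tryRound {σ : Config} {ε s cap τ : ℝ} {m : ℕ} {l : List (Cube n)} (hε : 0 < ε)
    (hε1 : ε < 1) (hs : 1 ≤ s) (hn : σ.nat 0 0 = n) (h0 : σ.real 0 0 = ε) (h1 : σ.real 1 0 = s)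
    (h2 : σ.real 2 0 = cap) (hτ : τ = 72 * s / ε ^ 2) (hm : m = sampleSize n τ)
    (hl : l = segment ω σ.drawn (m + m)) :
    wp c ω tryRound (fun υ => υ.drawn = σ.drawn + (m + m) ∧
      ((RoundResult ε τ c m l υ ∧ (Accepted ε τ c m l ∨ cap ≤ s) ∧ υ.nat 15 0 = 1 ∧
          υ.nat 16 0 = σ.nat 16 0 ∧ υ.real 1 0 = s) ∨
        (¬ Accepted ε τ c m l ∧ ¬ cap ≤ s ∧ υ.nat 15 0 = σ.nat 15 0 ∧
          υ.nat 16 0 = σ.nat 16 0 + 1 ∧ υ.real 1 0 = s + s)) ∧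
      υ.time ≤ σ.time + (roundTime n τ + 60)) σ := by
  rw [tryRound, wp_seq]
  refine wp_mono (wp_learnRound hε hε1 hs hn h0 h1) ?_
  rw [← hτ, ← hm, ← hl]
  rintro σ₁ ⟨hR, hd, hF, ht⟩
  have e0 : σ₁.real 0 0 = ε := by rw [hF.real 0 rfl, h0]
  have e1 : σ₁.real 1 0 = s := by rw [hF.real 1 rfl, h1]
  have e2 : σ₁.real 2 0 = cap := by rw [hF.real 2 rfl, h2]
  have e15 : σ₁.nat 15 0 = σ.nat 15 0 := by rw [hF.nat 15 rfl]
  have e16 : σ₁.nat 16 0 = σ.nat 16 0 := by rw [hF.nat 16 rfl]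
  rw [wp_ite, wp_setN, wp_seq, wp_setR, wp_setN]
  simp only [Test.Holds, NExp.eval, RExp.eval, hR.loss, e0, e1, e2, hR.size]
  push_cast
  constructor
  · rintro ⟨h3, h4⟩
    refine ⟨hd, Or.inr ⟨h3, h4, ?_⟩, ?_⟩
    · simp [e15, e16, e1]
    · simp [NExp.cost, RExp.cost, Test.cost]; omega
  · intro h3
    refine ⟨hd, Or.inl ⟨?_, ?_, ?_⟩, ?_⟩
    · refine hR.congr ?_ ?_ ?_ ?_ rfl <;> ext j <;> simp
    · by_contra hcon
      rw [not_or] at hcon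
      exact h3 hcon
    · simp [e16, e1]
    · simp [NExp.cost, RExp.cost, Test.cost]; omega

section Search

/-- The parameter `τ` of the `k`-th round of the search. -/
def tauAt (ε : ℝ) (k : ℕ) : ℝ := 72 * 2 ^ k / ε ^ 2

/-- The size of the samples of the `k`-th round of the search. -/
def sizeAt (n : ℕ) (ε : ℝ) (k : ℕ) : ℕ := sampleSize n (tauAt ε k)

/-- The number of examples drawn before the `k`-th round of the search. -/
def offset (n : ℕ) (ε : ℝ) (k : ℕ) : ℕ :=
  ∑ i ∈ Finset.range k, (sizeAt n ε i + sizeAt n ε i)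

/-- The examples of the `k`-th round of the search. -/
def samplesAt (ε : ℝ) (ω : ℕ → Cube n) (k : ℕ) : List (Cube n) :=
  segment ω (offset n ε k) (sizeAt n ε k + sizeAt n ε k)

theorem logSize_mono {τ τ' : ℝ} (hτ : 0 < τ) (h : τ ≤ τ') : logSize n τ ≤ logSize n τ' :=
  (logSize_le_iff hτ).2 (le_trans (by gcongr) ((logSize_le_iff (hτ.trans_le h)).1 le_rfl))

theorem sampleSize_mono {τ τ' : ℝ} (hτ : 0 < τ) (h : τ ≤ τ') :
    sampleSize n τ ≤ sampleSize n τ' := by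
  refine Nat.ceil_mono ?_
  have : (logSize n τ : ℝ) ≤ logSize n τ' := by exact_mod_cast logSize_mono hτ h
  gcongr

theorem roundTime_mono {τ τ' : ℝ} (hτ : 0 < τ) (h : τ ≤ τ') :
    roundTime n τ ≤ roundTime n τ' := by
  have h1 := sampleSize_mono (n := n) hτ h
  have h2 : ⌈2 * τ + 3⌉₊ ≤ ⌈2 * τ' + 3⌉₊ := Nat.ceil_mono (by linarith)
  unfold roundTime
  gcongr

theorem tauAt_pos {ε : ℝ} (hε : 0 < ε) (k : ℕ) : 0 < tauAt ε k := by
  unfold tauAt; positivity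

theorem tauAt_mono {ε : ℝ} (hε : 0 < ε) {k K : ℕ} (h : k ≤ K) : tauAt ε k ≤ tauAt ε K := by
  unfold tauAt
  gcongr
  norm_num

variable {ε cap : ℝ} {K : ℕ}

/-- K is any round that would certainly stop; the search stops there or earlier, and by monotonicity
every round costs at most as much as round K. -/
theorem wp_searchSize {σ : Config} (hε : 0 < ε) (hε1 : ε < 1) (hn : σ.nat 0 0 = n)
    (h0 : σ.real 0 0 = ε) (h2 : σ.real 2 0 = cap) (hd : σ.drawn = 0)
    (hK : Accepted ε (tauAt ε K) c (sizeAt n ε K) (samplesAt ε ω K) ∨ cap ≤ 2 ^ K) :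
    wp c ω searchSize (fun υ => (∃ k ≤ K,
      RoundResult ε (tauAt ε k) c (sizeAt n ε k) (samplesAt ε ω k) υ ∧
      (Accepted ε (tauAt ε k) c (sizeAt n ε k) (samplesAt ε ω k) ∨ cap ≤ 2 ^ k) ∧
      υ.drawn = offset n ε (k + 1)) ∧ Frame searchSize σ υ ∧
      υ.time ≤ σ.time + (K + 1) * (roundTime n (tauAt ε K) + 65) + 20) σ := by
  refine wp_mono (wp_frame (Q := fun υ => (∃ k ≤ K,
      RoundResult ε (tauAt ε k) c (sizeAt n ε k) (samplesAt ε ω k) υ ∧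
      (Accepted ε (tauAt ε k) c (sizeAt n ε k) (samplesAt ε ω k) ∨ cap ≤ 2 ^ k) ∧
      υ.drawn = offset n ε (k + 1)) ∧
      υ.time ≤ σ.time + (K + 1) * (roundTime n (tauAt ε K) + 65) + 20) ?_)
    fun τ ⟨⟨h1, h2⟩, h3⟩ => ⟨h1, h3, h2⟩
  simp only [searchSize, wp_seq, wp_setN, wp_setR]
  set σ₁ : Config := Config.setNat _ 16 _ _ _ with hσ₁
  have t1 : σ₁.time = σ.time + 10 := by simp [hσ₁, NExp.cost, RExp.cost]
  have n15 : σ₁.nat 15 0 = 0 := by simp [hσ₁, NExp.eval]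
  have n16 : σ₁.nat 16 0 = 0 := by simp [hσ₁, NExp.eval]
  have n0 : σ₁.nat 0 0 = n := by simp [hσ₁, hn]
  have r0 : σ₁.real 0 0 = ε := by simp [hσ₁, h0]
  have r2 : σ₁.real 2 0 = cap := by simp [hσ₁, h2]
  have r1 : σ₁.real 1 0 = 1 := by simp [hσ₁, NExp.eval, RExp.eval]
  have d1 : σ₁.drawn = 0 := by simp [hσ₁, hd]
  clear_value σ₁; clear hσ₁
  refine wp_mono (wp_while (fun σ' => σ'.nat 16 0 ≤ K ∧ σ'.real 1 0 = 2 ^ σ'.nat 16 0 ∧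
      ((σ'.nat 15 0 = 0 ∧ σ'.drawn = offset n ε (σ'.nat 16 0)) ∨
        (σ'.nat 15 0 = 1 ∧ σ'.drawn = offset n ε (σ'.nat 16 0 + 1) ∧
          RoundResult ε (tauAt ε (σ'.nat 16 0)) c (sizeAt n ε (σ'.nat 16 0))
            (samplesAt ε ω (σ'.nat 16 0)) σ' ∧
          (Accepted ε (tauAt ε (σ'.nat 16 0)) c (sizeAt n ε (σ'.nat 16 0))
            (samplesAt ε ω (σ'.nat 16 0)) ∨ cap ≤ 2 ^ σ'.nat 16 0))))
      -- Each iteration raises either the round number or the flag by one.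
      (fun σ' => K + 1 - (σ'.nat 16 0 + σ'.nat 15 0)) (roundTime n (tauAt ε K) + 60) ?_ ?_ ?_) ?_
  · refine ⟨by omega, by rw [r1, n16, pow_zero], Or.inl ⟨n15, ?_⟩⟩
    rw [d1, n16]; rfl
  · rintro σ' hF ⟨h3, h4, h5⟩ hT
    have e0 : σ'.nat 0 0 = n := by rw [hF.nat 0 rfl, n0]
    have f0 : σ'.real 0 0 = ε := by rw [hF.real 0 rfl, r0]
    have f2 : σ'.real 2 0 = cap := by rw [hF.real 2 rfl, r2]
    simp only [Test.Holds, NExp.eval] at hT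
    have e15 : σ'.nat 15 0 = 0 := by omega
    obtain ⟨k, hk⟩ : ∃ k, k = σ'.nat 16 0 := ⟨_, rfl⟩
    rw [← hk] at h3 h4 h5
    have hdr : σ'.drawn = offset n ε k := by
      rcases h5 with h5 | h5
      · exact h5.2
      · omega
    refine wp_mono (wp_tryRound (τ := tauAt ε k) (m := sizeAt n ε k) (l := samplesAt ε ω k)
      hε hε1 (one_le_pow₀ one_le_two) e0 f0 h4 f2 rfl rfl (by rw [hdr]; rfl)) ?_
    rintro υ ⟨k1, k2, k3⟩
    have hdr' : υ.drawn = offset n ε (k + 1) := by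
      rw [k1, hdr, offset, offset, Finset.sum_range_succ]
    have htime := roundTime_mono (n := n) (tauAt_pos hε k) (tauAt_mono hε h3)
    rcases k2 with ⟨g1, g2, g3, g4, g5⟩ | ⟨g1, g2, g3, g4, g5⟩
    · rw [← hk] at g4
      simp only [g4, ← hk]
      exact ⟨⟨h3, g5, Or.inr ⟨g3, hdr', g1, g2⟩⟩, by omega, by omega⟩
    · rw [← hk] at g4
      have hlt : k < K := by
        refine lt_of_le_of_ne h3 fun h => ?_
        rw [← h] at hK
        exact hK.elim g1 g2
      simp only [g4, ← hk]
      refine ⟨⟨hlt, by rw [g5, pow_succ]; ring, Or.inl ⟨by omega, hdr'⟩⟩, by omega, by omega⟩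
  · rintro σ' k ⟨h3, h4, h5⟩
    refine ⟨h3, h4, h5.imp id ?_⟩
    rintro ⟨g1, g2, g3, g4⟩
    exact ⟨g1, g2, g3.congr rfl rfl rfl rfl rfl, g4⟩
  · rintro υ ⟨⟨h3, h4, h5⟩, hT, hF, htime⟩
    simp only [Test.Holds, NExp.eval, not_le] at hT
    rcases h5 with ⟨g1, -⟩ | ⟨g1, g2, g3, g4⟩
    · omega
    · refine ⟨⟨_, h3, g3, g4, g2⟩, htime.trans ?_⟩
      simp [Test.cost, NExp.cost, n15, n16, t1]
      linarith

theorem wp_learnUnknownSize {L : ℕ} (hε : 0 < ε) (hε1 : ε < 1)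
    (hL : 6 / ε ≤ 2 ^ L) (hL' : ∀ k : ℕ, 6 / ε ≤ 2 ^ k → L ≤ k)
    (hK : Accepted ε (tauAt ε K) c (sizeAt n ε K) (samplesAt ε ω K) ∨
      (12 / ε) ^ (2 * L) ≤ (2 : ℝ) ^ K) :
    wp c ω learnUnknownSize (fun υ => (∃ k ≤ K,
      hypothesis n υ.out = roundHyp ε (tauAt ε k) c (sizeAt n ε k) (samplesAt ε ω k) ∧
      (Accepted ε (tauAt ε k) c (sizeAt n ε k) (samplesAt ε ω k) ∨
        (12 / ε) ^ (2 * L) ≤ (2 : ℝ) ^ k) ∧ υ.drawn = offset n ε (k + 1)) ∧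
      υ.time ≤ totalTime n (tauAt ε K) L K) (start n 0 ε) := by
  rw [learnUnknownSize, wp_ite]
  have r0 : (start n 0 ε).real 0 0 = ε := by simp [start, write_apply]
  have n0 : (start n 0 ε).nat 0 0 = n := by simp [start, write_apply]
  have ho : (start n 0 ε).out = [] := rfl
  have hte : (start n 0 ε).term = [] := rfl
  have hd : (start n 0 ε).drawn = 0 := rfl
  have hti : (start n 0 ε).time = 0 := rfl
  generalize start n 0 ε = σ at *
  refine ⟨fun h => ?_, fun _ => ?_⟩
  · simp [Test.Holds, RExp.eval, NExp.eval, r0] at h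
    linarith
  · rw [wp_seq]
    refine wp_mono (wp_computeCap r0 hL hL') ?_
    rintro σ₁ ⟨h2, hF₁, t1⟩
    simp [Test.cost, NExp.cost, RExp.cost, hti] at t1
    rw [wp_seq]
    refine wp_mono (wp_searchSize hε hε1 (by rw [hF₁.nat 0 rfl]; exact n0)
      (by rw [hF₁.real 0 rfl]; exact r0) h2 (by rw [(hF₁.ex rfl).2.2]; exact hd) hK) ?_
    rintro σ₂ ⟨⟨k, hk, hR, hacc, hdr⟩, hF₂, t2⟩
    refine wp_mono (wp_writeHypothesis_of_roundResult (tauAt_pos hε k).le hR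
      (by rw [(hF₂.out rfl).1, (hF₁.out rfl).1]; exact hte)
      (by rw [(hF₂.out rfl).2, (hF₁.out rfl).2]; exact ho)) ?_
    rintro υ ⟨k1, k2, k3⟩
    refine ⟨⟨k, hk, k1, hacc, by rw [k2, hdr]⟩, ?_⟩
    have h1 : 100 * (⌈2 * tauAt ε k + 3⌉₊ + 1) ^ 2 ≤ 100 * (⌈2 * tauAt ε K + 3⌉₊ + 1) ^ 2 := by
      have := Nat.ceil_mono (by linarith [tauAt_mono hε hk] :
        2 * tauAt ε k + 3 ≤ 2 * tauAt ε K + 3)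
      gcongr
    rw [totalTime]
    generalize roundTime n (tauAt ε K) = R at *
    have h2 : (K + 1) * (R + 65) + 20 ≤ (K + 1) * (R + 100) := by nlinarith
    omega

end Search

end

/-! ### Arithmetic of the resource bounds -/

section

variable {n : ℕ}

theorem half_le_log (n : ℕ) : 1 / 2 ≤ Real.log (n + 2) := by
  have h1 : Real.log 2 ≤ Real.log (n + 2) :=
    Real.log_le_log two_pos (by linarith [(Nat.cast_nonneg n : (0 : ℝ) ≤ n)])
  linarith [Real.log_two_gt_d9]

theorem one_le_log_two_add {A : ℝ} (hA : 1 ≤ A) : 1 ≤ Real.log (2 + A) := by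
  rw [Real.le_log_iff_exp_le (by linarith)]
  linarith [Real.exp_one_lt_d9]

section Bounds

variable {ε s S τ A : ℝ}

theorem one_le_ratio (hε : 0 < ε) (hε1 : ε < 1) (hs : 1 ≤ s) : s ≤ s ^ 2 / ε ^ 4 := by
  rw [le_div_iff₀ (by positivity)]
  have : ε ^ 4 ≤ 1 := pow_le_one₀ hε.le hε1.le
  nlinarith [mul_nonneg (by linarith : 0 ≤ s) (sub_nonneg.2 this)]

/-- The guess S overshoots s by a factor of at most 2, and 20736 = 72² · 2². -/
theorem tau_sq_le (hε : 0 < ε) (hS : 1 ≤ S) (hSs : S ≤ 2 * s) (hτ : τ = 72 * S / ε ^ 2) :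
    τ ^ 2 ≤ 20736 * (s ^ 2 / ε ^ 4) := by
  have h : τ ^ 2 = 5184 * S ^ 2 / ε ^ 4 := by rw [hτ]; field_simp; norm_num
  have h2 : S ^ 2 ≤ (2 * s) ^ 2 := by gcongr
  rw [h, ← mul_div_assoc]
  exact div_le_div_of_nonneg_right (by linarith) (by positivity)

theorem logSize_le (hτ : 1 ≤ τ) (hA : 1 ≤ A) (h : τ ^ 2 ≤ 20736 * A) :
    (logSize n τ : ℝ) ≤ 22 * Real.log (n + 2) * Real.log (2 + A) := by
  have hN := half_le_log n
  have hW := one_le_log_two_add hA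
  have hn : (0 : ℝ) < n + 2 := by positivity
  have hτ0 : 0 < τ := by linarith
  have h1 : Real.log τ ≤ 5 + Real.log (2 + A) := by
    have h3 : τ ≤ 144 * A := by nlinarith
    have h4 : Real.log (144 * A) = Real.log 144 + Real.log A :=
      Real.log_mul (by norm_num) (by linarith)
    have h5 : Real.log 144 ≤ 5 := by
      rw [Real.log_le_iff_le_exp (by norm_num)]
      have he := Real.exp_one_gt_d9
      have : Real.exp 5 = Real.exp 1 ^ 5 := by rw [← Real.exp_nat_mul]; norm_num
      rw [this]
      calc (144 : ℝ) ≤ 2.718 ^ 5 := by norm_num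
        _ ≤ _ := by gcongr; linarith
    have h6 : Real.log A ≤ Real.log (2 + A) := Real.log_le_log (by linarith) (by linarith)
    linarith [Real.log_le_log hτ0 h3]
  have hceil : (logSize n τ : ℝ) < Real.logb 2 ((n + 2) * τ) + 1 := by
    refine Nat.ceil_lt_add_one (Real.logb_nonneg one_lt_two ?_)
    nlinarith [(Nat.cast_nonneg n : (0 : ℝ) ≤ n)]
  have hlogb : Real.logb 2 ((n + 2) * τ) ≤ 3 / 2 * (Real.log (n + 2) + Real.log τ) := by
    rw [Real.logb, Real.log_mul hn.ne' hτ0.ne', div_le_iff₀ (Real.log_pos one_lt_two)]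
    have h0 := Real.log_two_gt_d9
    have h7 : 0 ≤ Real.log (n + 2) + Real.log τ := by linarith [Real.log_nonneg hτ]
    nlinarith
  nlinarith

theorem sampleSize_le (hτ : 1 ≤ τ) (hA : 1 ≤ A) (h : τ ^ 2 ≤ 20736 * A) :
    (sampleSize n τ : ℝ) + 1 ≤ 4 * 10 ^ 8 * (Real.log (n + 2) * Real.log (2 + A) * A) := by
  have hN := half_le_log n
  have hW := one_le_log_two_add hA
  have hl := logSize_le (n := n) hτ hA h
  have hceil : (sampleSize n τ : ℝ) < 768 * (logSize n τ : ℝ) * τ ^ 2 + 1 :=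
    Nat.ceil_lt_add_one (by positivity)
  have h1 : (logSize n τ : ℝ) * τ ^ 2 ≤
      22 * Real.log (n + 2) * Real.log (2 + A) * (20736 * A) := by gcongr
  have h2 : 1 / 2 ≤ Real.log (n + 2) * Real.log (2 + A) * A := by
    have : 1 / 2 ≤ Real.log (n + 2) * Real.log (2 + A) := by nlinarith
    nlinarith
  nlinarith

theorem rounds_le {K : ℕ} (hε : 0 < ε) (hε1 : ε < 1) (hs : 1 ≤ s) (hK : (2 : ℝ) ^ K ≤ 2 * s) :
    (K : ℝ) + 1 ≤ 4 * Real.log (2 + s ^ 2 / ε ^ 4) := by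
  have hA := one_le_ratio hε hε1 hs
  have hW := one_le_log_two_add (hs.trans hA)
  have h1 : (K : ℝ) * Real.log 2 ≤ Real.log 2 + Real.log s := by
    rw [← Real.log_pow, ← Real.log_mul two_ne_zero (by linarith)]
    exact Real.log_le_log (by positivity) hK
  have h2 : Real.log s ≤ Real.log (2 + s ^ 2 / ε ^ 4) :=
    Real.log_le_log (by linarith) (by linarith)
  have h0 := Real.log_two_gt_d9
  have h3 : (K : ℝ) * (2 / 3) ≤ K * Real.log 2 := by
    gcongr; linarith
  have h4 := Real.log_two_lt_d9
  linarith

/-- The constant in the bounds. -/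
def boundConst : ℝ := 10 ^ 24

/-- With N = log(n+2), A = s²/ε⁴ and W = log(2+A), there are O(W) rounds of O(N W A) examples each,
so W² would suffice; the exponent 14 is the one required by the time bound. Known size is the case K
= 0. -/
theorem sample_bound {K D : ℕ} {m : ℕ} (hε : 0 < ε) (hε1 : ε < 1) (hs : 1 ≤ s) (hS : 1 ≤ S)
    (hSs : S ≤ 2 * s) (hτ : τ = 72 * S / ε ^ 2) (hK : (2 : ℝ) ^ K ≤ 2 * s)
    (hm : m = sampleSize n τ) (hD : D ≤ (K + 1) * (m + m)) :
    (D : ℝ) ≤ sampleBound boundConst 14 n s ε := by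
  have hA := hs.trans (one_le_ratio hε hε1 hs)
  have hτ1 : 1 ≤ τ := by
    linarith [(roundParams (n := n) hS hε).seventy_two_le hε hε1]
  have h1 := sampleSize_le (n := n) hτ1 hA (tau_sq_le hε hS hSs hτ)
  have h2 := rounds_le hε hε1 hs hK
  have hW := one_le_log_two_add hA
  have hN := half_le_log n
  rw [← hm] at h1
  have hD' : (D : ℝ) ≤ ((K : ℝ) + 1) * (m + m) := by exact_mod_cast hD
  unfold sampleBound
  generalize s ^ 2 / ε ^ 4 = A at *
  generalize Real.log (2 + A) = W at *
  generalize Real.log ((n : ℝ) + 2) = N at *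
  have hX : 0 ≤ N * A := by nlinarith
  have h3 : ((K : ℝ) + 1) * (m + m) ≤ (4 * W) * (8 * 10 ^ 8 * (N * W * A)) := by
    gcongr
    linarith
  have h4 : W ^ 2 ≤ W ^ 14 := pow_le_pow_right₀ hW (by norm_num)
  calc (D : ℝ) ≤ (4 * W) * (8 * 10 ^ 8 * (N * W * A)) := hD'.trans h3
    _ = 32 * 10 ^ 8 * (N * A) * W ^ 2 := by ring
    _ ≤ boundConst * (N * A) * W ^ 14 := by
      unfold boundConst; gcongr; norm_num
    _ = boundConst * N * (A * W ^ 14) := by ring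

/-- For n = 0 the logarithm is below 1; the factor 2^14, paid for by the constant, lets its 14th
power dominate terms without a logarithm. -/
theorem one_le_log_pow (n : ℕ) : 1 ≤ 2 ^ 14 * Real.log (n + 2) ^ 14 := by
  rw [← mul_pow]
  exact one_le_pow₀ (by linarith [half_le_log n])

/-- Everything is bounded in terms of u = 1 + s/ε. The leading term is the product of O(u⁴) rounds,
O(N u⁸) examples with N = log(n+2), O(u²) sets and n + 1 variables, whence the exponent 14. -/
theorem time_bound {K L T : ℕ} (hε : 0 < ε) (hε1 : ε < 1) (hs : 1 ≤ s) (hS : 1 ≤ S)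
    (hSs : S ≤ 2 * s) (hτ : τ = 72 * S / ε ^ 2) (hK : (2 : ℝ) ^ K ≤ 2 * s)
    (hL : (2 : ℝ) ^ L ≤ 12 / ε) (hT : T ≤ totalTime n τ L K) :
    (T : ℝ) ≤ timeBound boundConst 14 n s ε := by
  have hA := hs.trans (one_le_ratio hε hε1 hs)
  have hτ1 : 72 ≤ τ := hτ ▸ (roundParams (n := n) hS hε).seventy_two_le hε hε1
  have h1 := sampleSize_le (n := n) (by linarith) hA (tau_sq_le hε hS hSs hτ)
  have h2 := rounds_le hε hε1 hs hK
  have hW1 := one_le_log_two_add hA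
  have hN := half_le_log n
  have hu1 : 1 / ε ≤ s / ε := by gcongr
  have hε' : 1 ≤ 1 / ε := by rw [le_div_iff₀ hε]; linarith
  obtain ⟨u, hu⟩ : ∃ u, u = 1 + s / ε := ⟨_, rfl⟩
  have hu2 : 1 ≤ u := by linarith
  have hτu : τ ≤ 144 * u ^ 2 := by
    have h3 : τ = 72 * S * (1 / ε) ^ 2 := by rw [hτ]; ring
    have h4 : S * (1 / ε) ≤ 2 * (s / ε) := by
      have := mul_le_mul_of_nonneg_right hSs (by positivity : 0 ≤ 1 / ε)
      linarith [(by ring : 2 * s * (1 / ε) = 2 * (s / ε))]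
    have h5 : S * (1 / ε) * (1 / ε) ≤ (2 * u) * u :=
      mul_le_mul (by linarith) (by linarith) (by positivity) (by linarith)
    rw [h3]; linarith
  have hAu : s ^ 2 / ε ^ 4 ≤ u ^ 4 := by
    have h3 : s ^ 2 / ε ^ 4 = (s / ε) ^ 2 * (1 / ε) ^ 2 := by field_simp
    calc s ^ 2 / ε ^ 4 = (s / ε) ^ 2 * (1 / ε) ^ 2 := h3
      _ ≤ u ^ 2 * u ^ 2 := by gcongr <;> linarith
      _ = u ^ 4 := by ring
  have hLu : (L : ℝ) ≤ 12 * u := by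
    have h3 : (L : ℝ) ≤ 2 ^ L := by exact_mod_cast Nat.lt_two_pow_self.le
    have h4 : 12 / ε = 12 * (1 / ε) := by ring
    linarith
  have hW : Real.log (2 + s ^ 2 / ε ^ 4) ≤ 2 * u ^ 4 := by
    have := Real.log_le_sub_one_of_pos (by linarith : 0 < 2 + s ^ 2 / ε ^ 4)
    linarith
  have hceil : ((⌈2 * τ + 3⌉₊ : ℕ) : ℝ) + 1 ≤ 300 * u ^ 2 := by
    have := Nat.ceil_lt_add_one (by linarith : 0 ≤ 2 * τ + 3)
    nlinarith
  have hT' : (T : ℝ) ≤ totalTime n τ L K := by exact_mod_cast hT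
  refine hT'.trans ?_
  unfold totalTime roundTime timeBound
  push_cast
  rw [← hu]
  clear hT hT' hτu hτ hSs hL hK
  have hR0 : (0 : ℝ) ≤ (⌈2 * τ + 3⌉₊ : ℕ) := Nat.cast_nonneg _
  have hm0 : (0 : ℝ) ≤ sampleSize n τ := Nat.cast_nonneg _
  generalize ((⌈2 * τ + 3⌉₊ : ℕ) : ℝ) = R at *
  generalize (sampleSize n τ : ℝ) = m at *
  have hP := one_le_log_pow n
  have hP' : Real.log ((n : ℝ) + 2) ≤ 2 ^ 13 * Real.log (n + 2) ^ 14 := by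
    have h3 : 1 ≤ (2 * Real.log ((n : ℝ) + 2)) ^ 13 := one_le_pow₀ (by linarith)
    calc Real.log ((n : ℝ) + 2) ≤ Real.log (n + 2) * (2 * Real.log ((n : ℝ) + 2)) ^ 13 :=
          le_mul_of_one_le_right (by linarith) h3
      _ = _ := by ring
  generalize Real.log (2 + s ^ 2 / ε ^ 4) = W at *
  generalize s ^ 2 / ε ^ 4 = A at *
  generalize Real.log ((n : ℝ) + 2) = N at *
  have hm : m + 1 ≤ 8 * 10 ^ 8 * N * u ^ 8 := by
    have h3 : N * W * A ≤ N * (2 * u ^ 4) * u ^ 4 := by gcongr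
    linarith
  have hu4 : u ≤ u ^ 4 := le_self_pow₀ hu2 (by norm_num)
  have hu14 : u ^ 4 ≤ u ^ 14 := pow_le_pow_right₀ hu2 (by norm_num)
  have hn : (1 : ℝ) ≤ n + 1 := by linarith [(Nat.cast_nonneg n : (0 : ℝ) ≤ n)]
  have hK' : (K : ℝ) + 1 ≤ 8 * u ^ 4 := by linarith
  have hR2 : (R + 1) ^ 2 ≤ 90000 * u ^ 4 := by
    have := pow_le_pow_left₀ (by linarith : 0 ≤ R + 1) hceil 2
    linarith
  have hmid : ((K : ℝ) + 1) * (1200 * (m + 1) * (R + 1) * (n + 1) + 100) ≤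
      (8 * u ^ 4) * (1200 * (8 * 10 ^ 8 * N * u ^ 8) * (300 * u ^ 2) * (n + 1) + 100) := by
    gcongr
  have hlow : u ^ 14 ≤ (n + 1) * (2 ^ 14 * N ^ 14) * u ^ 14 :=
    le_mul_of_one_le_left (by positivity) (by nlinarith)
  have hhigh : N * ((n + 1) * u ^ 14) ≤ 2 ^ 13 * N ^ 14 * ((n + 1) * u ^ 14) := by gcongr
  have hX : 0 ≤ (n + 1) * N ^ 14 * u ^ 14 := by positivity
  unfold boundConst
  linarith

end Bounds

end

/-! ### Success probabilities and the conclusion -/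

section

variable {n : ℕ} {c : Cube n → ℝ} {ω : ℕ → Cube n} {ε : ℝ}

instance (n : ℕ) : IsProbabilityMeasure (examples n) := by
  unfold examples; infer_instance

/-- From 1 ≤ μ(G) + μ(B), which holds by subadditivity alone; the set of successful runs need not be
measurable. -/
theorem two_thirds_le_examples {G B : Set (ℕ → Cube n)} {p : ℝ} (h : ∀ ω, ω ∉ B → ω ∈ G)
    (hB : examples n B ≤ ENNReal.ofReal p) (hp : p ≤ 1 / 3) : (2 / 3 : ENNReal) ≤ examples n G := by
  have h1 : (1 : ℝ≥0∞) ≤ examples n G + examples n B := by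
    rw [← measure_univ (μ := examples n)]
    refine le_trans (measure_mono fun ω _ => ?_) (measure_union_le G B)
    by_cases hω : ω ∈ B
    · exact Or.inr hω
    · exact Or.inl (h ω hω)
  have h2 : examples n B ≤ 1 / 3 := by
    refine hB.trans ((ENNReal.ofReal_le_ofReal hp).trans ?_)
    rw [ENNReal.ofReal_div_of_pos (by norm_num)]
    simp
  have h3 : (1 : ℝ≥0∞) = 2 / 3 + 1 / 3 := by
    rw [← ENNReal.add_div]; norm_num
    exact (ENNReal.div_self (by norm_num) (by norm_num)).symm
  have h4 : (2 / 3 : ℝ≥0∞) + 1 / 3 ≤ examples n G + 1 / 3 := by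
    rw [← h3]; exact h1.trans (by gcongr)
  exact (ENNReal.add_le_add_iff_right (by simp)).1 h4

theorem goodOutput_of_roundHyp {τ S : ℝ} {m : ℕ} {l : List (Cube n)} {σ : Config}
    (hε : 0 < ε) (hε1 : ε < 1) (hs : 1 ≤ sEps c ε) (hS : 0 ≤ S) (hSs : S ≤ 2 * sEps c ε)
    (hτ : τ = 72 * S / ε ^ 2) (hl : l.length = m + m) (hh : hypothesis n σ.out = roundHyp ε τ c m l)
    (hd : l1dist (roundHyp ε τ c m l) c ≤ ε) : GoodOutput c ε boundConst σ := by
  have hτ0 : 0 ≤ τ := by rw [hτ]; positivity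
  obtain ⟨h1, h2⟩ := roundHyp_mem_CV (c := c) hε hε1 hτ0 l hl
  rw [GoodOutput, hh]
  refine ⟨h1, hd, h2.trans ?_⟩
  rw [le_div_iff₀ (by positivity)]
  have h3 : τ * ε ^ 2 = 72 * S := by rw [hτ]; field_simp
  have h4 : ε ^ 2 ≤ 1 := pow_le_one₀ hε.le hε1.le
  unfold boundConst
  linarith

/-! ### Accuracies that make the task trivial -/

theorem isCoverageOn_zero : IsCoverageOn 0 (fun _ : Cube n => (0 : ℝ)) :=
  ⟨Fin.elim0, Fin.elim0, fun u => u.elim0, fun x => by simp⟩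

theorem sEps_nonneg (hε : 0 < ε) : 0 ≤ sEps c ε :=
  le_min (le_trans zero_le_one (le_max_left _ _)) (zpow_nonneg (by positivity) _)

/-- The empty output represents 0, which is within distance 1 of c. For large ε the quantity `sEps`
may be below 1, but a hypothesis of size 0 and no examples fit any non-negative bound, and 1 + s/ε ≥
1 covers the constant running time. -/
theorem trivial_case {σ : Config} (hε : 1 ≤ ε) (hc : c ∈ CV n) (ho : σ.out = [])
    (hd : σ.drawn = 0) (ht : σ.time ≤ 100) :
    GoodOutput c ε boundConst σ ∧ WithinBounds c ε boundConst 14 σ := by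
  have hε0 : 0 < ε := by linarith
  have hs := sEps_nonneg (c := c) hε0
  have hh : hypothesis n σ.out = fun _ => 0 := by
    funext x; simp [hypothesis, ho]
  refine ⟨?_, ?_, ?_⟩
  · rw [GoodOutput, hh]
    refine ⟨⟨⟨0, isCoverageOn_zero⟩, fun x => by simp⟩, ?_, ?_⟩
    · refine le_trans ?_ hε
      rw [l1dist, div_le_one (by positivity)]
      calc ∑ x, |0 - c x| ≤ ∑ _x : Cube n, (1 : ℝ) :=
            Finset.sum_le_sum fun x _ => by
              rw [zero_sub, abs_neg, abs_of_nonneg (hc.2 x).1]; exact (hc.2 x).2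
        _ = _ := by simp
    · have h0 : size (fun _ : Cube n => (0 : ℝ)) = 0 :=
        Nat.le_zero.1 (Nat.sInf_le isCoverageOn_zero)
      rw [h0, Nat.cast_zero]
      unfold boundConst
      positivity
  · have h1 : (σ.time : ℝ) ≤ 100 := by exact_mod_cast ht
    have h2 : (1 : ℝ) ≤ (1 + sEps c ε / ε) ^ 14 :=
      one_le_pow₀ (by linarith [div_nonneg hs hε0.le])
    have h3 := one_le_log_pow n
    have h4 : (1 : ℝ) ≤ n + 1 := by linarith [(Nat.cast_nonneg n : (0 : ℝ) ≤ n)]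
    have h5 : (1 : ℝ) ≤ (n + 1) * (2 ^ 14 * Real.log (n + 2) ^ 14) * (1 + sEps c ε / ε) ^ 14 :=
      one_le_mul_of_one_le_of_one_le (one_le_mul_of_one_le_of_one_le h4 h3) h2
    unfold timeBound boundConst
    linarith
  · rw [hd, Nat.cast_zero]
    unfold sampleBound boundConst
    have h1 := half_le_log n
    have h2 : 0 ≤ Real.log (2 + sEps c ε ^ 2 / ε ^ 4) :=
      Real.log_nonneg (by linarith [(by positivity : 0 ≤ sEps c ε ^ 2 / ε ^ 4)])
    positivity

theorem wp_trivial {p : Prog} {k : ℕ} (hε : 1 ≤ ε) (hc : c ∈ CV n) :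
    wp c ω (.ite (.rle (RC 1) (RV 0)) .skip p)
      (fun σ => GoodOutput c ε boundConst σ ∧ WithinBounds c ε boundConst 14 σ) (start n k ε) := by
  have r0 : (start n k ε).real 0 0 = ε := by simp [start, write_apply]
  rw [wp_ite, wp_skip]
  refine ⟨fun _ => trivial_case hε hc rfl rfl ?_, fun h => ?_⟩
  · simp [Test.cost, RExp.cost, NExp.cost, start]
  · simp [Test.Holds, RExp.eval, NExp.eval, r0] at h
    linarith

/-! ### The target size is known -/

/-- The bounds on time and examples hold in every run, because one round with s = s_ε has a fixed
number of examples and a capped family. The output fails only if the round rejects or accepts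
wrongly; the program itself does not look at acceptance. -/
theorem learnKnownSize_spec (hε : 0 < ε) (hc : c ∈ CV n) :
    (∀ ω, wp c ω learnKnownSize (WithinBounds c ε boundConst 14) (start n (size c) ε)) ∧
      (2 / 3 : ENNReal) ≤ examples n
        {ω | wp c ω learnKnownSize (GoodOutput c ε boundConst) (start n (size c) ε)} := by
  by_cases hε1 : ε < 1
  swap
  · have h := fun ω => wp_trivial (ω := ω) (k := size c)
      (p := computeCap.seq (chooseSize.seq (learnRound.seq writeHypothesis))) (not_lt.1 hε1) hc
    refine ⟨fun ω => wp_mono (h ω) fun _ h => h.2, ?_⟩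
    refine two_thirds_le_examples (B := ∅) (p := 0) (fun ω _ => ?_) (by simp) (by norm_num)
    exact wp_mono (h ω) fun _ h => h.1
  · obtain ⟨L, hL, hL', hL12, hsEps⟩ := exists_sEps_eq (n := n) hε hε1
    have hs1 := one_le_sEps c hε hε1
    obtain ⟨s, hs⟩ : ∃ s, s = sEps c ε := ⟨_, rfl⟩
    obtain ⟨τ, hτ⟩ : ∃ τ, τ = 72 * s / ε ^ 2 := ⟨_, rfl⟩
    obtain ⟨m, hm⟩ : ∃ m, m = sampleSize n τ := ⟨_, rfl⟩
    have hs1' : 1 ≤ s := hs ▸ hs1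
    have hrun := fun ω => wp_learnKnownSize (ω := ω) hε hε1 hL hL' (hs.trans (hsEps c)) hs1' hτ hm
    refine ⟨fun ω => wp_mono (hrun ω) ?_, ?_⟩
    · rintro σ ⟨-, h2, h3⟩
      have hK : (2 : ℝ) ^ 0 ≤ 2 * sEps c ε := by rw [pow_zero]; linarith
      exact ⟨time_bound hε hε1 hs1 hs1' (by linarith) hτ hK hL12 h3,
        sample_bound hε hε1 hs1 hs1' (by linarith) hτ hK hm (by omega)⟩
    · have hP : RoundParams n ε s τ (logSize n τ) m := by
        rw [hm, hτ]; exact roundParams hs1' hε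
      refine two_thirds_le_examples (p := 1 / 144 + 1 / 100)
        (B := {ω | (fun l => roundLoss ε τ c m l ≤ 3 / 4 * ε * m ∧
            ε < l1dist (roundHyp ε τ c m l) c) (segment ω 0 (m + m))} ∪
          {ω | (fun l => ¬ roundLoss ε τ c m l ≤ 3 / 4 * ε * m) (segment ω 0 (m + m))})
        (fun ω hω => ?_) ?_ (by norm_num)
      · simp only [Set.mem_union, Set.mem_ofPred_eq, not_or, not_and, not_lt, not_not] at hω
        refine wp_mono (hrun ω) ?_
        rintro σ ⟨h1, -, -⟩
        exact goodOutput_of_roundHyp hε hε1 hs1 (by linarith) (by linarith) hτ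
          (length_segment _ _ _) h1 (hω.1 hω.2)
      · rw [ENNReal.ofReal_add (by norm_num) (by norm_num)]
        refine (measure_union_le _ _).trans (add_le_add ?_ ?_)
        · have h1 : 1 / (144 * s) ≤ 1 / 144 := by gcongr; linarith
          exact (examples_segment_le _ _ _).trans
            (ENNReal.ofReal_le_ofReal ((hP.listProb_unsound_le hc hε hε1).trans h1))
        · exact (examples_segment_le _ _ _).trans
            (ENNReal.ofReal_le_ofReal (hP.listProb_reject_le hc hε hε1 hs.ge))

/-! ### The target size is not known -/

theorem offset_succ_le (hε : 0 < ε) {k K : ℕ} (h : k ≤ K) :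
    offset n ε (k + 1) ≤ (K + 1) * (sizeAt n ε K + sizeAt n ε K) := by
  have hle : ∀ i ∈ Finset.range (k + 1),
      sizeAt n ε i + sizeAt n ε i ≤ sizeAt n ε K + sizeAt n ε K := fun i hi => by
    have := sampleSize_mono (n := n) (tauAt_pos hε i)
      (tauAt_mono hε (by have := Finset.mem_range.1 hi; omega : i ≤ K))
    exact add_le_add this this
  refine (Finset.sum_le_sum hle).trans ?_
  rw [Finset.sum_const, Finset.card_range, smul_eq_mul]
  gcongr

/-- Wrong acceptance becomes half as likely with each doubling; the subtracted last term makes the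
induction close. -/
theorem sum_half_pow_le (K : ℕ) :
    ∑ k ∈ Finset.range (K + 1), 1 / (144 * (2 : ℝ) ^ k) ≤ 1 / 72 - 1 / (144 * 2 ^ K) := by
  induction K with
  | zero => norm_num
  | succ K ih =>
    rw [Finset.sum_range_succ]
    have h : 1 / (144 * (2 : ℝ) ^ K) = 2 * (1 / (144 * 2 ^ (K + 1))) := by
      rw [pow_succ]; field_simp
    linarith

theorem exists_two_pow {s : ℝ} (hs : 1 ≤ s) : ∃ K : ℕ, s ≤ 2 ^ K ∧ (2 : ℝ) ^ K ≤ 2 * s ∧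
    ∀ k, s ≤ 2 ^ k → K ≤ k := by
  have hex : ∃ K : ℕ, s ≤ 2 ^ K := by
    obtain ⟨K, hK⟩ := pow_unbounded_of_one_lt s one_lt_two
    exact ⟨K, hK.le⟩
  classical
  refine ⟨Nat.find hex, Nat.find_spec hex, ?_, fun k => Nat.find_min' hex⟩
  rcases h : Nat.find hex with _ | K
  · rw [pow_zero]; linarith
  · have := Nat.find_min hex (m := K) (by omega)
    rw [pow_succ]; linarith

/-- Let K be the first round whose guess reaches s_ε. The bad events are a wrong acceptance in some
round up to K and a rejection in round K; a union bound suffices, and independence between rounds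
plays no role. -/
theorem learnUnknownSize_spec (hε : 0 < ε) (hc : c ∈ CV n) :
    (∀ ω, ∃ σ, Exec c ω learnUnknownSize (start n 0 ε) σ) ∧
      (2 / 3 : ENNReal) ≤ examples n
        {ω | wp c ω learnUnknownSize (fun σ => GoodOutput c ε boundConst σ ∧
          WithinBounds c ε boundConst 14 σ) (start n 0 ε)} := by
  by_cases hε1 : ε < 1
  swap
  · have h := fun ω => wp_trivial (ω := ω) (k := 0)
      (p := computeCap.seq (searchSize.seq writeHypothesis)) (not_lt.1 hε1) hc
    refine ⟨fun ω => (h ω).imp fun _ h => h.1, ?_⟩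
    exact two_thirds_le_examples (B := ∅) (p := 0) (fun ω _ => h ω) (by simp) (by norm_num)
  · obtain ⟨L, hL, hL', hL12, hsEps⟩ := exists_sEps_eq (n := n) hε hε1
    refine ⟨fun ω => ?_, ?_⟩
    · obtain ⟨K, hK⟩ := pow_unbounded_of_one_lt ((12 / ε) ^ (2 * L)) one_lt_two
      exact (wp_learnUnknownSize (c := c) (ω := ω) hε hε1 hL hL' (Or.inr hK.le)).imp
        fun _ h => h.1
    have hs1 := one_le_sEps c hε hε1
    obtain ⟨K, hK, hK2, hKmin⟩ := exists_two_pow hs1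
    have hP : ∀ k, RoundParams n ε (2 ^ k) (tauAt ε k) (logSize n (tauAt ε k)) (sizeAt n ε k) :=
      fun k => roundParams (one_le_pow₀ one_le_two) hε
    -- The cap is at least s_ε, so no round before K can be stopped by the cap.
    have hcap : ∀ k, (12 / ε) ^ (2 * L) ≤ (2 : ℝ) ^ k → K ≤ k := fun k hk =>
      hKmin k (((hsEps c).trans_le (min_le_right _ _)).trans hk)
    refine two_thirds_le_examples (p := 1 / 72 + 1 / 100)
      (B := (⋃ k ∈ Finset.range (K + 1), {ω | (fun l =>
            roundLoss ε (tauAt ε k) c (sizeAt n ε k) l ≤ 3 / 4 * ε * sizeAt n ε k ∧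
            ε < l1dist (roundHyp ε (tauAt ε k) c (sizeAt n ε k) l) c) (samplesAt ε ω k)}) ∪
        {ω | (fun l => ¬ roundLoss ε (tauAt ε K) c (sizeAt n ε K) l ≤ 3 / 4 * ε * sizeAt n ε K)
            (samplesAt ε ω K)})
      (fun ω hω => ?_) ?_ (by norm_num)
    · simp only [Set.mem_union, Set.mem_iUnion, Set.mem_ofPred_eq, not_or, not_and, not_lt,
        not_not, not_exists] at hω
      obtain ⟨hsound, hacc⟩ := hω
      refine wp_mono (wp_learnUnknownSize (K := K) hε hε1 hL hL' (Or.inl hacc)) ?_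
      rintro σ ⟨⟨k, hk, h1, h2, h3⟩, h4⟩
      have hk2 : (2 : ℝ) ^ k ≤ 2 * sEps c ε :=
        (pow_le_pow_right₀ one_le_two hk).trans hK2
      -- A stop because of the cap can only occur in round K itself, which accepts outside the bad
      -- events; hence the returned hypothesis always comes from an accepted round.
      have hacck : Accepted ε (tauAt ε k) c (sizeAt n ε k) (samplesAt ε ω k) := by
        rcases h2 with h2 | h2
        · exact h2
        · rw [le_antisymm hk (hcap k h2)]; exact hacc
      refine ⟨goodOutput_of_roundHyp hε hε1 hs1 (by positivity) hk2 rfl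
        (length_segment _ _ _) h1 (hsound k (Finset.mem_range.2 (by omega)) hacck), ?_, ?_⟩
      · exact time_bound hε hε1 hs1 (one_le_pow₀ one_le_two) hK2 rfl hK2 hL12 h4
      · exact sample_bound hε hε1 hs1 (one_le_pow₀ one_le_two) hK2 rfl hK2 rfl
          (h3.trans_le (offset_succ_le hε hk))
    · rw [ENNReal.ofReal_add (by norm_num) (by norm_num)]
      refine (measure_union_le _ _).trans (add_le_add ?_ ?_)
      · refine (measure_biUnion_finset_le _ _).trans ?_
        refine (Finset.sum_le_sum fun k _ => (examples_segment_le _ _ _).trans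
          (ENNReal.ofReal_le_ofReal ((hP k).listProb_unsound_le hc hε hε1))).trans ?_
        rw [← ENNReal.ofReal_sum_of_nonneg fun k _ => by positivity]
        refine ENNReal.ofReal_le_ofReal ((sum_half_pow_le K).trans ?_)
        linarith [(by positivity : (0 : ℝ) ≤ 1 / (144 * 2 ^ K))]
      · exact (examples_segment_le _ _ _).trans
          (ENNReal.ofReal_le_ofReal ((hP K).listProb_reject_le hc hε hε1 hK))

end

end CoverageLearning

end


theorem mainTheorem5 :
    -- the algorithm is given only the dimension, the accuracy and random examples
    (∃ (P : CoverageLearning.Prog) (C : ℝ) (d : ℕ),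
      ∀ (n : ℕ) (ε : ℝ) (c : CoverageLearning.Cube n → ℝ), 0 < ε → c ∈ CoverageLearning.CV n →
        (∀ ω : ℕ → CoverageLearning.Cube n,
          ∃ σ, CoverageLearning.Exec c ω P (CoverageLearning.start n 0 ε) σ) ∧
        (2 / 3 : ENNReal) ≤ CoverageLearning.examples n
          {ω | ∃ σ, CoverageLearning.Exec c ω P (CoverageLearning.start n 0 ε) σ ∧
            CoverageLearning.GoodOutput c ε C σ ∧
            CoverageLearning.WithinBounds c ε C d σ}) ∧
    -- the algorithm is also given the size of the target; the resource bounds hold in every run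
    (∃ (P : CoverageLearning.Prog) (C : ℝ) (d : ℕ),
      ∀ (n : ℕ) (ε : ℝ) (c : CoverageLearning.Cube n → ℝ), 0 < ε → c ∈ CoverageLearning.CV n →
        (∀ ω : ℕ → CoverageLearning.Cube n,
          ∃ σ, CoverageLearning.Exec c ω P
              (CoverageLearning.start n (CoverageLearning.size c) ε) σ ∧
            CoverageLearning.WithinBounds c ε C d σ) ∧
        (2 / 3 : ENNReal) ≤ CoverageLearning.examples n
          {ω | ∃ σ, CoverageLearning.Exec c ω P
              (CoverageLearning.start n (CoverageLearning.size c) ε) σ ∧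
            CoverageLearning.GoodOutput c ε C σ}) :=
  ⟨⟨CoverageLearning.learnUnknownSize, CoverageLearning.boundConst, 14, fun _ _ _ hε hc =>
      CoverageLearning.learnUnknownSize_spec hε hc⟩,
    ⟨CoverageLearning.learnKnownSize, CoverageLearning.boundConst, 14, fun _ _ _ hε hc =>
      CoverageLearning.learnKnownSize_spec hε hc⟩⟩
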